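/- Let $k$ be a field of characteristic $0$. A chord diagram of order $n$ is an oriented circle (the Wilson line) with $n$ disjoint pairs of points (chords), up to orientation-preserving diffeomorphism. Let $\mathcal A=\bigoplus_n\mathcal A_n$, where $\mathcal A_n$ is the $k$-vector space generated by the chord diagrams of order $n$ modulo the four-term relations: $D_1-D_2+D_3-D_4=0$ whenever $D_1,\dots,D_4$ differ only in the position of one end of a chord $a$, which lies immediately before (in $D_1$), immediately after (in $D_2$) one end of another chord $b$, and immediately before (in $D_3$), immediately after (in $D_4$) the other end of $b$. The coproduct is $\Delta(D)=\sum_{E\subset D}E\otimes(D\setminus E)$, the sum over all sets $E$ of chords of $D$; let $1\in\mathcal A_0$ be the class of the diagram without chords, $\mathcal P=\{a\in\mathcal A:\Delta(a)=1\otimes a+a\otimes 1\}$ and $\mathcal P_n=\mathcal P\cap\mathcal A_n$. A Feynman (Jacobi) diagram of order $n$ is a graph (loops and multiple edges allowed) with $2n$ vertices, each of degree $1$ (the legs) or $3$, with a cyclic ordering of the legs and of the three edge ends at each trivalent vertex, and with at least one leg on each connected component, up to isomorphism. Chord diagrams are the Feynman diagrams without trivalent vertices. Via the canonical isomorphism induced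 by this inclusion, $\mathcal A_n$ is identified with the space generated by the Feynman diagrams of order $n$ modulo the three-term relations $D_Y=D_{||}-D_X$; here $D_Y$ has a leg joined by an edge $x$ to a trivalent vertex at which the edges are $x,b,a$ in counterclockwise order, and $D_{||}$, $D_X$ are obtained by deleting $x$ and its two end vertices and letting $a$ and $b$ end at two consecutive legs at the place of the deleted leg, in the counterclockwise order $a,b$ and $b,a$ respectively. Let $\mathcal A_n^{(\ell)}\subset\mathcal A_n$ be the subspace generated by the Feynman diagrams of order $n$ with at most $\ell$ legs, and $\mathcal P_n^{(\ell)}=\mathcal P\cap\mathcal A_n^{(\ell)}$. A hanging tree of a Feynman diagram $F$ is a subgraph $T$ that is a tree with more than one edge and has a leaf $r$ (a vertex of degree $1$ in $T$) such that no vertex of $T$ other than $r$ meets an edge of $F$ outside $T$ (so removing $r$ disconnects $T$ from the rest of $F$). In particular, a connected component of $F$ that is a tree with more than one edge is a hanging tree. (i) The space $\mathcal P$ has a basis consisting of (classes of) connected Feynman diagrams without hanging trees. (ii) For every $n\ge 2$ the filtration of $\mathcal P_n$ by the subspaces $\mathcal P_n^{(\ell)}$ stabilizes at $\mathcal P_n^{(n)}$,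 i.e. $\mathcal P_n^{(n)}=\mathcal P_n^{(n+1)}=\dots=\mathcal P_n$. (iii) For every $n\ge 2$ the wheel $w_n$ with $n$ spokes (a cycle of $n$ trivalent vertices in the interior of the Wilson line, the $i$-th one joined to the $i$-th of $n$ legs) lies in $\mathcal P_n^{(n)}$, and its class spans the quotient $\mathcal P_n^{(n)}/\mathcal P_n^{(n-1)}$. -/

import Mathlib

open scoped TensorProduct

/-! ## Chord diagrams and the space of chord diagrams modulo four-term relations -/

/-- A chord diagram, presented by the cyclic word read along the Wilson line: the letters name the
chords, and every chord that occurs has exactly two end points.  The starting point of the word and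
the names of the chords are forgotten by `ChordDiagram.Iso`. -/
@[ext]
structure ChordDiagram where
  /-- The chords met when one runs once along the Wilson line. -/
  word : List ℕ
  two : ∀ e ∈ word, word.count e = 2

namespace ChordDiagram

/-- Two words present the same chord diagram: they agree up to renaming the chords and up to
rotating the Wilson line. -/
def Iso (D D' : ChordDiagram) : Prop :=
  ∃ π : Equiv.Perm ℕ, (D.word.map π).IsRotated D'.word

/-- The set of chords. -/
def chords (D : ChordDiagram) : Finset ℕ := D.word.toFinset

/-- The diagram consisting of those chords of `D` that lie in `E`. -/
def restrict (D : ChordDiagram) (E : Finset ℕ) : ChordDiagram where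
  word := D.word.filter (· ∈ E)
  two := by
    intro e he
    rw [List.mem_filter] at he
    exact (List.count_filter (p := fun c => decide (c ∈ E)) he.2).trans (D.two e he.1)

/-- The chord diagram without chords. -/
def empty : ChordDiagram := ⟨[], by simp⟩

/-- The configurations of a four-term relation: one end of the chord `a` moves across the two ends
of the chord `b`; everything else, including the other end of `a`, stays in place. -/
def FourTerm (D₁ D₂ D₃ D₄ : ChordDiagram) : Prop :=
  ∃ (a b : ℕ) (U V : List ℕ),
    D₁.word = a :: b :: (U ++ b :: V) ∧
    D₂.word = b :: a :: (U ++ b :: V) ∧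
    D₃.word = b :: (U ++ a :: b :: V) ∧
    D₄.word = b :: (U ++ b :: a :: V)

end ChordDiagram

/-- The relations of the space of chord diagrams: presentations of the same diagram are identified,
and the four-term combinations vanish. -/
noncomputable def chordRelations (k : Type*) [Field k] : Submodule k (ChordDiagram →₀ k) :=
  Submodule.span k
    ({x | ∃ D D' : ChordDiagram, D.Iso D' ∧
        x = Finsupp.single D 1 - Finsupp.single D' 1} ∪
     {x | ∃ D₁ D₂ D₃ D₄ : ChordDiagram, ChordDiagram.FourTerm D₁ D₂ D₃ D₄ ∧
        x = Finsupp.single D₁ 1 - Finsupp.single D₂ 1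
          + Finsupp.single D₃ 1 - Finsupp.single D₄ 1})

/-- The space `𝒜` of chord diagrams modulo four-term relations. -/
abbrev ChordSpace (k : Type*) [Field k] : Type _ := (ChordDiagram →₀ k) ⧸ chordRelations k

/-- The class of a chord diagram in `𝒜`. -/
noncomputable def ChordDiagram.cls (k : Type*) [Field k] (D : ChordDiagram) : ChordSpace k :=
  (chordRelations k).mkQ (Finsupp.single D 1)

/-- The homogeneous component `𝒜_n`, spanned by the diagrams with `n` chords. -/
noncomputable def ChordSpace.degree (k : Type*) [Field k] (n : ℕ) : Submodule k (ChordSpace k) :=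
  Submodule.span k {x | ∃ D : ChordDiagram, D.word.length = 2 * n ∧ x = D.cls k}

/-! ## Feynman diagrams modulo three-term (STU) relations -/

/-- The combinatorial data of a Feynman diagram.  Natural numbers name the edges.  `legs` lists, in
counterclockwise order along the Wilson line, the edges that end at the univalent vertices; `verts`
lists the trivalent vertices, each one as the triple of the edges that meet there in their cyclic
(counterclockwise) order.  A loop occurs twice in its triple. -/
structure DiagramData where
  legs : List ℕ
  verts : List (ℕ × ℕ × ℕ)

namespace DiagramData

/-- The three edges meeting at a trivalent vertex. -/
def triple (v : ℕ × ℕ × ℕ) : List ℕ := [v.1, v.2.1, v.2.2]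

/-- All edge ends. -/
def ends (D : DiagramData) : List ℕ := D.legs ++ D.verts.flatMap triple

/-- The set of edges. -/
def edges (D : DiagramData) : Finset ℕ := D.ends.toFinset

/-- The vertices: the legs (univalent vertices) and the trivalent ones. -/
abbrev Vertex (D : DiagramData) : Type := Fin D.legs.length ⊕ Fin D.verts.length

/-- The edges at a vertex, with multiplicity. -/
def edgesAt (D : DiagramData) : D.Vertex → List ℕ
  | Sum.inl i => [D.legs.get i]
  | Sum.inr j => triple (D.verts.get j)

/-- The degree of the vertex `x` in the subgraph with edge set `S` (a loop counts twice). -/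
def degreeIn (D : DiagramData) (S : Finset ℕ) (x : D.Vertex) : ℕ :=
  (D.edgesAt x).countP (· ∈ S)

/-- The vertices of the subgraph with edge set `S`. -/
def vertexSet (D : DiagramData) (S : Finset ℕ) : Finset D.Vertex :=
  Finset.univ.filter fun x => 0 < D.degreeIn S x

/-- Two edges of the subgraph with edge set `S` share a vertex. -/
def Adjacent (D : DiagramData) (S : Finset ℕ) (e f : ℕ) : Prop :=
  e ∈ S ∧ f ∈ S ∧ ∃ x : D.Vertex, e ∈ D.edgesAt x ∧ f ∈ D.edgesAt x

/-- The subgraph with edge set `S` is nonempty and connected. -/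
def ConnectedOn (D : DiagramData) (S : Finset ℕ) : Prop :=
  S.Nonempty ∧ ∀ e ∈ S, ∀ f ∈ S, Relation.ReflTransGen (D.Adjacent S) e f

/-- The diagram is connected (as a graph, without the Wilson line). -/
def Connected (D : DiagramData) : Prop := D.ConnectedOn D.edges

/-- The subgraph with edge set `S` is a tree: it is connected and has one vertex more than edges. -/
def IsTree (D : DiagramData) (S : Finset ℕ) : Prop :=
  D.ConnectedOn S ∧ (D.vertexSet S).card = S.card + 1

/-- The subgraph with edge set `S` is a hanging tree: it is a tree with more than one edge and it has
a leaf `r` (a vertex of degree one in the tree) such that no other vertex of the tree meets an edge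
outside of the tree; so removing `r` disconnects the tree from the rest of the diagram. -/
def IsHangingTree (D : DiagramData) (S : Finset ℕ) : Prop :=
  S ⊆ D.edges ∧ D.IsTree S ∧ 1 < S.card ∧
    ∃ r ∈ D.vertexSet S, D.degreeIn S r = 1 ∧
      ∀ x ∈ D.vertexSet S, x ≠ r → ∀ e ∈ D.edgesAt x, e ∈ S

/-- The multiset of the trivalent vertices, each one a cyclically ordered triple of edges. -/
def cyclicVerts (D : DiagramData) : Multiset (Cycle ℕ) :=
  (D.verts.map fun v => (triple v : Cycle ℕ) : List (Cycle ℕ))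

/-- Isomorphism of graphs with orientations: a renaming of the edges that respects the cyclic order
of the legs and the set of the trivalent vertices with their cyclic orders. -/
def Iso (D D' : DiagramData) : Prop :=
  ∃ π : Equiv.Perm ℕ, (D.legs.map π).IsRotated D'.legs ∧
    D.cyclicVerts.map (Cycle.map π) = D'.cyclicVerts

end DiagramData

/-- A Feynman diagram: a graph with vertices of degrees one and three, cyclic orderings as above,
and at least one univalent vertex on every connected component. -/
@[ext]
structure FeynmanDiagram extends DiagramData where
  /-- Every edge has two ends. -/
  two : ∀ e ∈ toDiagramData.ends, toDiagramData.ends.count e = 2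
  /-- Every component has a leg. -/
  anchored : ∀ e ∈ toDiagramData.edges, ∃ f ∈ toDiagramData.legs,
    Relation.ReflTransGen (toDiagramData.Adjacent toDiagramData.edges) e f

namespace FeynmanDiagram

/-- A Feynman diagram has order `n` if it has `2n` vertices. -/
def HasOrder (F : FeynmanDiagram) (n : ℕ) : Prop := F.legs.length + F.verts.length = 2 * n

/-- The diagrams of a three-term relation `D_Y = D_|| - D_X`: in `D_Y` a leg `x` is joined to the
trivalent vertex with edges `x, b, a` in counterclockwise order; in `D_||` and `D_X` the leg and the
vertex are replaced by two consecutive legs `a, b` and `b, a` respectively. -/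
def ThreeTerm (DY DI DX : FeynmanDiagram) : Prop :=
  ∃ (x a b : ℕ) (L : List ℕ) (T : List (ℕ × ℕ × ℕ)),
    (DY.legs = x :: L ∧ DY.verts = (x, b, a) :: T) ∧
    (DI.legs = a :: b :: L ∧ DI.verts = T) ∧
    (DX.legs = b :: a :: L ∧ DX.verts = T)

end FeynmanDiagram

/-- The relations of the space of Feynman diagrams: isomorphic diagrams are identified, and
`D_Y - D_|| + D_X` vanishes. -/
noncomputable def feynmanRelations (k : Type*) [Field k] : Submodule k (FeynmanDiagram →₀ k) :=
  Submodule.span k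
    ({x | ∃ F F' : FeynmanDiagram, F.toDiagramData.Iso F'.toDiagramData ∧
        x = Finsupp.single F 1 - Finsupp.single F' 1} ∪
     {x | ∃ DY DI DX : FeynmanDiagram, FeynmanDiagram.ThreeTerm DY DI DX ∧
        x = Finsupp.single DY 1 - Finsupp.single DI 1 + Finsupp.single DX 1})

/-- The space of Feynman diagrams modulo three-term relations. -/
abbrev FeynmanSpace (k : Type*) [Field k] : Type _ := (FeynmanDiagram →₀ k) ⧸ feynmanRelations k

/-- The class of a Feynman diagram. -/
noncomputable def FeynmanDiagram.cls (k : Type*) [Field k] (F : FeynmanDiagram) : FeynmanSpace k :=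
  (feynmanRelations k).mkQ (Finsupp.single F 1)

theorem FeynmanDiagram.cls_eq_of_iso (k : Type*) [Field k] {F F' : FeynmanDiagram}
    (h : F.toDiagramData.Iso F'.toDiagramData) : F.cls k = F'.cls k := by
  rw [← sub_eq_zero, FeynmanDiagram.cls, FeynmanDiagram.cls, ← map_sub, Submodule.mkQ_apply,
    Submodule.Quotient.mk_eq_zero]
  exact Submodule.subset_span (Or.inl ⟨F, F', h, rfl⟩)

theorem FeynmanDiagram.cls_threeTerm (k : Type*) [Field k] {DY DI DX : FeynmanDiagram}
    (h : FeynmanDiagram.ThreeTerm DY DI DX) : DY.cls k = DI.cls k - DX.cls k := by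
  rw [← sub_eq_zero, sub_sub_eq_add_sub, add_sub_right_comm, FeynmanDiagram.cls,
    FeynmanDiagram.cls, FeynmanDiagram.cls, ← map_sub, ← map_add, Submodule.mkQ_apply,
    Submodule.Quotient.mk_eq_zero]
  exact Submodule.subset_span (Or.inr ⟨DY, DI, DX, h, rfl⟩)

theorem ChordDiagram.cls_eq_of_iso (k : Type*) [Field k] {D D' : ChordDiagram}
    (h : D.Iso D') : D.cls k = D'.cls k := by
  rw [← sub_eq_zero, ChordDiagram.cls, ChordDiagram.cls, ← map_sub, Submodule.mkQ_apply,
    Submodule.Quotient.mk_eq_zero]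
  exact Submodule.subset_span (Or.inl ⟨D, D', h, rfl⟩)

theorem ChordDiagram.cls_fourTerm (k : Type*) [Field k] {D₁ D₂ D₃ D₄ : ChordDiagram}
    (h : ChordDiagram.FourTerm D₁ D₂ D₃ D₄) :
    D₁.cls k - D₂.cls k + D₃.cls k - D₄.cls k = 0 := by
  simp only [ChordDiagram.cls]
  rw [← map_sub, ← map_add, ← map_sub, Submodule.mkQ_apply, Submodule.Quotient.mk_eq_zero]
  exact Submodule.subset_span (Or.inr ⟨D₁, D₂, D₃, D₄, h, rfl⟩)

/-! ## Chord diagrams as Feynman diagrams -/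

/-- A chord diagram is a Feynman diagram without trivalent vertices. -/
def ChordDiagram.toFeynman (D : ChordDiagram) : FeynmanDiagram where
  legs := D.word
  verts := []
  two := by simpa [DiagramData.ends] using D.two
  anchored := by
    intro e he
    exact ⟨e, by simpa [DiagramData.edges, DiagramData.ends] using he, Relation.ReflTransGen.refl⟩

/-- A diagram with one trivalent vertex, obtained from a chord diagram by joining two neighbouring
end points `p`, `q` to a new leg `x`. -/
def ChordDiagram.joinEnds (w : List ℕ) (hw : ∀ e ∈ w, w.count e = 2) (x p q : ℕ) (L : List ℕ)
    (hx : x ∉ w) (hp : p ∈ L) (hq : q ∈ L) (h : (p :: q :: L).Perm w) : FeynmanDiagram where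
  legs := x :: L
  verts := [(x, q, p)]
  two := by
    have hperm : (DiagramData.ends ⟨x :: L, [(x, q, p)]⟩).Perm (x :: x :: w) := by
      refine List.Perm.trans ?_ ((h.cons x).cons x)
      rw [List.perm_iff_count]
      intro c
      simp only [DiagramData.ends, DiagramData.triple, List.flatMap_cons, List.flatMap_nil,
        List.append_nil, List.count_append, List.count_cons, List.count_nil]
      omega
    intro e he
    rw [hperm.count_eq]
    rw [hperm.mem_iff] at he
    by_cases hex : e = x
    · subst hex
      simp [List.count_eq_zero_of_not_mem hx]
    · have hew : e ∈ w := by simpa [hex] using he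
      rw [List.count_cons_of_ne (Ne.symm hex), List.count_cons_of_ne (Ne.symm hex)]
      exact hw e hew
  anchored := by
    intro e he
    refine ⟨e, ?_, Relation.ReflTransGen.refl⟩
    simp only [DiagramData.edges, DiagramData.ends, DiagramData.triple, List.mem_toFinset,
      List.flatMap_cons, List.flatMap_nil, List.append_nil, List.mem_append, List.mem_cons,
      List.not_mem_nil, or_false] at he ⊢
    rcases he with (h | h) | h | h | h
    · exact Or.inl h
    · exact Or.inr h
    · exact Or.inl h
    · exact Or.inr (h ▸ hq)
    · exact Or.inr (h ▸ hp)

/-- The four-term relations follow from the three-term relations. -/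
theorem ChordDiagram.toFeynman_fourTerm (k : Type*) [Field k] {D₁ D₂ D₃ D₄ : ChordDiagram}
    (h : ChordDiagram.FourTerm D₁ D₂ D₃ D₄) :
    D₁.toFeynman.cls k - D₂.toFeynman.cls k + D₃.toFeynman.cls k - D₄.toFeynman.cls k = 0 := by
  obtain ⟨a, b, U, V, h₁, h₂, h₃, h₄⟩ := h
  have tw : ∀ e ∈ a :: b :: (U ++ b :: V), (a :: b :: (U ++ b :: V)).count e = 2 := by
    rw [← h₁]; exact D₁.two
  have hab : a ≠ b := by
    rintro rfl
    have := tw a (by simp)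
    simp only [List.count_cons, List.count_append] at this
    simp at this
  have haL : a ∈ U ++ V := by
    have := tw a (by simp)
    simp only [List.count_cons, List.count_append] at this
    simp [hab.symm] at this
    have h0 : 0 < (U ++ V).count a := by rw [List.count_append]; omega
    exact List.count_pos_iff.mp h0
  have hUV : ∀ e, e ∈ U ∨ e ∈ V → e ∈ a :: b :: (U ++ b :: V) := by
    intro e he
    simp only [List.mem_cons, List.mem_append]
    tauto
  have hbUV : b ∉ U ∧ b ∉ V := by
    have := tw b (by simp)
    simp only [List.count_cons, List.count_append] at this
    simp [hab] at this
    have h0 : U.count b = 0 ∧ V.count b = 0 := by omega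
    exact ⟨List.count_eq_zero.mp h0.1, List.count_eq_zero.mp h0.2⟩
  obtain ⟨x, hx⟩ := Infinite.exists_notMem_finset (a :: b :: (U ++ b :: V)).toFinset
  rw [List.mem_toFinset] at hx
  have hxU : x ∉ U := fun h => hx (hUV x (Or.inl h))
  have hxV : x ∉ V := fun h => hx (hUV x (Or.inr h))
  have hxa : x ≠ a := fun h => hx (by simp [h])
  have hxb : x ≠ b := fun h => hx (by simp [h])
  rw [List.mem_append] at haL
  let Y := ChordDiagram.joinEnds _ tw x a b (U ++ b :: V) hx
    (by simp only [List.mem_cons, List.mem_append]; tauto) (by simp) (List.Perm.refl _)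
  let Y' := ChordDiagram.joinEnds _ tw x b a (V ++ b :: U) hx (by simp)
    (by simp only [List.mem_cons, List.mem_append]; tauto) (by
      rw [List.perm_iff_count]
      intro c
      simp only [List.count_append, List.count_cons]
      omega)
  have hw₃ : (b :: (U ++ a :: b :: V)) ~r (a :: b :: (V ++ b :: U)) := by
    have := List.isRotated_append (l := b :: U) (l' := a :: b :: V)
    simpa using this
  have hw₄ : (b :: (U ++ b :: a :: V)) ~r (b :: a :: (V ++ b :: U)) := by
    have := List.isRotated_append (l := b :: U) (l' := b :: a :: V)
    simpa using this
  let D₃' : ChordDiagram := ⟨a :: b :: (V ++ b :: U), by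
    intro e he
    rw [← h₃] at hw₃
    rw [← hw₃.perm.count_eq]
    exact D₃.two e (hw₃.perm.mem_iff.mpr he)⟩
  let D₄' : ChordDiagram := ⟨b :: a :: (V ++ b :: U), by
    intro e he
    rw [← h₄] at hw₄
    rw [← hw₄.perm.count_eq]
    exact D₄.two e (hw₄.perm.mem_iff.mpr he)⟩
  have e₃ : D₃.toFeynman.cls k = D₃'.toFeynman.cls k :=
    FeynmanDiagram.cls_eq_of_iso k ⟨1, by
      simpa [ChordDiagram.toFeynman, D₃', h₃] using hw₃, by
      simp [ChordDiagram.toFeynman, DiagramData.cyclicVerts]⟩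
  have e₄ : D₄.toFeynman.cls k = D₄'.toFeynman.cls k :=
    FeynmanDiagram.cls_eq_of_iso k ⟨1, by
      simpa [ChordDiagram.toFeynman, D₄', h₄] using hw₄, by
      simp [ChordDiagram.toFeynman, DiagramData.cyclicVerts]⟩
  have s₁ : Y.cls k = D₁.toFeynman.cls k - D₂.toFeynman.cls k :=
    FeynmanDiagram.cls_threeTerm k ⟨x, a, b, U ++ b :: V, [], ⟨rfl, rfl⟩, ⟨h₁, rfl⟩, ⟨h₂, rfl⟩⟩
  have s₂ : Y'.cls k = D₄'.toFeynman.cls k - D₃'.toFeynman.cls k :=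
    FeynmanDiagram.cls_threeTerm k ⟨x, b, a, V ++ b :: U, [], ⟨rfl, rfl⟩, ⟨rfl, rfl⟩, ⟨rfl, rfl⟩⟩
  have fix : ∀ l : List ℕ, x ∉ l → b ∉ l → l.map (Equiv.swap x b) = l := by
    intro l hxl hbl
    conv_rhs => rw [← List.map_id l]
    refine List.map_congr_left fun c hc => ?_
    exact Equiv.swap_apply_of_ne_of_ne (fun h => hxl (h ▸ hc)) (fun h => hbl (h ▸ hc))
  have s₃ : Y.cls k = Y'.cls k := by
    refine FeynmanDiagram.cls_eq_of_iso k ⟨Equiv.swap x b, ?_, ?_⟩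
    · have hr := List.isRotated_append (l := b :: U) (l' := x :: V)
      simpa [Y, Y', ChordDiagram.joinEnds, fix U hxU hbUV.1, fix V hxV hbUV.2] using hr
    · have hc : ((b :: [x, a] : List ℕ) : Cycle ℕ) = ([x, a] ++ [b] : List ℕ) :=
        Cycle.coe_cons_eq_coe_append _ _
      simpa [Y, Y', ChordDiagram.joinEnds, DiagramData.cyclicVerts, DiagramData.triple,
        Equiv.swap_apply_of_ne_of_ne hxa.symm hab] using hc
  rw [e₃, e₄]
  have : D₁.toFeynman.cls k - D₂.toFeynman.cls k = D₄'.toFeynman.cls k - D₃'.toFeynman.cls k := by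
    rw [← s₁, ← s₂, s₃]
  rw [this]
  abel

/-- The linear map from `𝒜` to the space of Feynman diagrams modulo three-term relations that is
induced by the inclusion of chord diagrams into Feynman diagrams. -/
noncomputable def chordToFeynman (k : Type*) [Field k] : ChordSpace k →ₗ[k] FeynmanSpace k :=
  (chordRelations k).liftQ
    (Finsupp.linearCombination k fun D : ChordDiagram => D.toFeynman.cls k) (by
      rw [chordRelations, Submodule.span_le]
      rintro x (⟨D, D', h, rfl⟩ | ⟨D₁, D₂, D₃, D₄, h, rfl⟩)
      · obtain ⟨π, hπ⟩ := h
        have : D.toFeynman.cls k = D'.toFeynman.cls k :=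
          FeynmanDiagram.cls_eq_of_iso k ⟨π, hπ, by
            simp [ChordDiagram.toFeynman, DiagramData.cyclicVerts]⟩
        simp [this]
      · have := ChordDiagram.toFeynman_fourTerm k h
        simpa using this)

/-! ## The coproduct and primitive elements -/

/-- The coproduct of a chord diagram: the sum of `E ⊗ (D \ E)` over all sets `E` of chords. -/
noncomputable def ChordDiagram.comul (k : Type*) [Field k] (D : ChordDiagram) :
    ChordSpace k ⊗[k] ChordSpace k :=
  ∑ E ∈ D.chords.powerset, (D.restrict E).cls k ⊗ₜ[k] (D.restrict (D.chords \ E)).cls k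

theorem ChordDiagram.restrict_isRotated {D D' : ChordDiagram} {π : Equiv.Perm ℕ}
    (h : (D.word.map π).IsRotated D'.word) (E : Finset ℕ) :
    (D.restrict E).Iso (D'.restrict (E.map π.toEmbedding)) := by
  refine ⟨π, ?_⟩
  have h1 : (D.restrict E).word.map π
      = (D.word.map π).filter (· ∈ E.map π.toEmbedding) := by
    simp only [ChordDiagram.restrict, List.filter_map]
    congr 1
    refine List.filter_congr fun c _ => ?_
    simp
  rw [h1]
  obtain ⟨n, hn⟩ := h
  obtain ⟨l₁, l₂, hl, hr⟩ : ∃ l₁ l₂, D.word.map π = l₁ ++ l₂ ∧ D'.word = l₂ ++ l₁ := by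
    refine ⟨_, _, (List.take_append_drop (n % (D.word.map π).length) _).symm, ?_⟩
    rw [← hn, List.rotate_eq_drop_append_take_mod]
  simp only [ChordDiagram.restrict, hl, hr, List.filter_append]
  exact List.isRotated_append

theorem ChordDiagram.comul_iso (k : Type*) [Field k] {D D' : ChordDiagram} (h : D.Iso D') :
    D.comul k = D'.comul k := by
  obtain ⟨π, hπ⟩ := h
  have hch : D'.chords = D.chords.map π.toEmbedding := by
    ext c
    rw [ChordDiagram.chords, List.mem_toFinset, ← hπ.mem_iff]
    simp only [ChordDiagram.chords, List.mem_map, Finset.mem_map, List.mem_toFinset,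
      Equiv.coe_toEmbedding]
  unfold ChordDiagram.comul
  refine Finset.sum_bij (fun E _ => E.map π.toEmbedding) ?_ ?_ ?_ ?_
  · intro E hE
    rw [Finset.mem_powerset] at hE ⊢
    rw [hch]
    exact Finset.map_subset_map.mpr hE
  · intro E _ E' _ hEE
    exact Finset.map_injective _ hEE
  · intro E hE
    rw [Finset.mem_powerset, hch, Finset.subset_map_iff] at hE
    obtain ⟨E', hE', rfl⟩ := hE
    exact ⟨E', Finset.mem_powerset.mpr hE', rfl⟩
  · intro E hE
    rw [ChordDiagram.cls_eq_of_iso k (ChordDiagram.restrict_isRotated hπ E),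
      ChordDiagram.cls_eq_of_iso k (ChordDiagram.restrict_isRotated hπ (D.chords \ E)),
      Finset.map_sdiff, hch]

/-- Restricting the four diagrams of a four-term relation either gives a four-term relation or
makes the terms cancel in pairs. -/
theorem ChordDiagram.restrict_fourTerm {a b : ℕ} {U V : List ℕ} {D₁ D₂ D₃ D₄ : ChordDiagram}
    (h₁ : D₁.word = a :: b :: (U ++ b :: V)) (h₂ : D₂.word = b :: a :: (U ++ b :: V))
    (h₃ : D₃.word = b :: (U ++ a :: b :: V)) (h₄ : D₄.word = b :: (U ++ b :: a :: V))
    (E : Finset ℕ) :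
    (a ∈ E → b ∈ E → ChordDiagram.FourTerm (D₁.restrict E) (D₂.restrict E) (D₃.restrict E)
        (D₄.restrict E)) ∧
    (a ∉ E ∨ b ∉ E → D₁.restrict E = D₂.restrict E ∧ D₃.restrict E = D₄.restrict E) ∧
    (a ∉ E → D₁.restrict E = D₃.restrict E) := by
  refine ⟨fun ha hb => ⟨a, b, U.filter (· ∈ E), V.filter (· ∈ E), ?_, ?_, ?_, ?_⟩,
    fun h => ?_, fun ha => ?_⟩
  · simp [ChordDiagram.restrict, h₁, ha, hb]
  · simp [ChordDiagram.restrict, h₂, ha, hb]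
  · simp [ChordDiagram.restrict, h₃, ha, hb]
  · simp [ChordDiagram.restrict, h₄, ha, hb]
  · rw [ChordDiagram.ext_iff, ChordDiagram.ext_iff]
    simp only [ChordDiagram.restrict, h₁, h₂, h₃, h₄, List.filter_cons, List.filter_append]
    rcases h with h | h <;> simp [h]
  · rw [ChordDiagram.ext_iff]
    simp only [ChordDiagram.restrict, h₁, h₃, List.filter_cons, List.filter_append]
    by_cases hb : b ∈ E <;> simp [ha, hb]

theorem ChordDiagram.comul_fourTerm (k : Type*) [Field k] {D₁ D₂ D₃ D₄ : ChordDiagram}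
    (h : ChordDiagram.FourTerm D₁ D₂ D₃ D₄) :
    D₁.comul k - D₂.comul k + D₃.comul k - D₄.comul k = 0 := by
  obtain ⟨a, b, U, V, h₁, h₂, h₃, h₄⟩ := h
  have ha : a ∈ D₁.chords := by simp [ChordDiagram.chords, h₁]
  have hb : b ∈ D₁.chords := by simp [ChordDiagram.chords, h₁]
  have c₂ : D₂.chords = D₁.chords := by
    ext c; simp only [ChordDiagram.chords, h₁, h₂, List.mem_toFinset, List.mem_cons,
      List.mem_append]; tauto
  have c₃ : D₃.chords = D₁.chords := by
    ext c; simp only [ChordDiagram.chords, h₁, h₃, List.mem_toFinset, List.mem_cons,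
      List.mem_append]; tauto
  have c₄ : D₄.chords = D₁.chords := by
    ext c; simp only [ChordDiagram.chords, h₁, h₄, List.mem_toFinset, List.mem_cons,
      List.mem_append]; tauto
  unfold ChordDiagram.comul
  rw [c₂, c₃, c₄, ← Finset.sum_sub_distrib, ← Finset.sum_add_distrib, ← Finset.sum_sub_distrib]
  refine Finset.sum_eq_zero fun E _ => ?_
  obtain ⟨p₁, p₂, p₃⟩ := ChordDiagram.restrict_fourTerm h₁ h₂ h₃ h₄ E
  obtain ⟨q₁, q₂, q₃⟩ := ChordDiagram.restrict_fourTerm h₁ h₂ h₃ h₄ (D₁.chords \ E)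
  by_cases haE : a ∈ E
  · have haE' : a ∉ D₁.chords \ E := by simp [haE]
    rw [← (q₂ (Or.inl haE')).1, ← (q₂ (Or.inl haE')).2, ← q₃ haE']
    by_cases hbE : b ∈ E
    · rw [← TensorProduct.sub_tmul, ← TensorProduct.add_tmul, ← TensorProduct.sub_tmul,
        ChordDiagram.cls_fourTerm k (p₁ haE hbE), TensorProduct.zero_tmul]
    · rw [(p₂ (Or.inr hbE)).1, (p₂ (Or.inr hbE)).2]
      abel
  · have haE' : a ∈ D₁.chords \ E := by simp [ha, haE]
    rw [← (p₂ (Or.inl haE)).1, ← (p₂ (Or.inl haE)).2, ← p₃ haE]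
    by_cases hbE : b ∈ E
    · have hbE' : b ∉ D₁.chords \ E := by simp [hbE]
      rw [(q₂ (Or.inr hbE')).1, (q₂ (Or.inr hbE')).2]
      abel
    · have hbE' : b ∈ D₁.chords \ E := by simp [hb, hbE]
      rw [← TensorProduct.tmul_sub, ← TensorProduct.tmul_add, ← TensorProduct.tmul_sub,
        ChordDiagram.cls_fourTerm k (q₁ haE' hbE'), TensorProduct.tmul_zero]

theorem chordRelations_le_ker_comul (k : Type*) [Field k] :
    chordRelations k ≤ LinearMap.ker
      (Finsupp.linearCombination k fun D : ChordDiagram => D.comul k) := by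
  refine Submodule.span_le.mpr ?_
  rintro x (⟨D, D', h, rfl⟩ | ⟨D₁, D₂, D₃, D₄, h, rfl⟩)
  · simp [ChordDiagram.comul_iso k h]
  · have := ChordDiagram.comul_fourTerm k h
    simpa using this

/-- The coproduct `Δ : 𝒜 → 𝒜 ⊗ 𝒜`. -/
noncomputable def chordComul (k : Type*) [Field k] :
    ChordSpace k →ₗ[k] ChordSpace k ⊗[k] ChordSpace k :=
  (chordRelations k).liftQ
    (Finsupp.linearCombination k fun D : ChordDiagram => D.comul k)
    (chordRelations_le_ker_comul k)

/-- The primitive space `𝒫 = {a ∈ 𝒜 : Δ a = 1 ⊗ a + a ⊗ 1}`, where `1` is the class of the diagram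
without chords. -/
noncomputable def primitives (k : Type*) [Field k] : Submodule k (ChordSpace k) where
  carrier := {a | chordComul k a =
    ChordDiagram.empty.cls k ⊗ₜ[k] a + a ⊗ₜ[k] ChordDiagram.empty.cls k}
  add_mem' := by
    intro a b ha hb
    simp only [Set.mem_ofPred_eq] at ha hb ⊢
    rw [map_add, ha, hb, TensorProduct.tmul_add, TensorProduct.add_tmul]
    abel
  zero_mem' := by simp
  smul_mem' := by
    intro c a ha
    simp only [Set.mem_ofPred_eq] at ha ⊢
    rw [map_smul, ha, TensorProduct.tmul_smul, smul_add, ← TensorProduct.smul_tmul' c a]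

/-- The homogeneous component `𝒫_n` of the primitive space. -/
noncomputable def primitivesDegree (k : Type*) [Field k] (n : ℕ) : Submodule k (ChordSpace k) :=
  primitives k ⊓ ChordSpace.degree k n

/-! ## The filtration by the number of legs -/

/-- The subspace `𝒜_n^(ℓ)` of `𝒜_n`, generated by the Feynman diagrams of order `n` with at most `ℓ`
legs: an element of `𝒜` is represented by the diagram `F` if it corresponds to `F` in the space of
Feynman diagrams modulo three-term relations. -/
noncomputable def legFiltration (k : Type*) [Field k] (n l : ℕ) : Submodule k (ChordSpace k) :=
  Submodule.span k {a | a ∈ ChordSpace.degree k n ∧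
    ∃ F : FeynmanDiagram, F.HasOrder n ∧ F.legs.length ≤ l ∧ chordToFeynman k a = F.cls k}

/-- The subspace `𝒫_n^(ℓ) = 𝒫 ∩ 𝒜_n^(ℓ)`. -/
noncomputable def primitivesFiltration (k : Type*) [Field k] (n l : ℕ) :
    Submodule k (ChordSpace k) :=
  primitives k ⊓ legFiltration k n l

/-! ## Wheels -/

theorem wheel_ends_perm (n : ℕ) :
    (DiagramData.ends ⟨List.range n, (List.range n).map fun i => (i, n + (i + 1) % n, n + i)⟩).Perm
      (List.range (2 * n) ++ List.range (2 * n)) := by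
  have h1 : ((List.range n).map fun i => n + (i + 1) % n).Perm
      ((List.range n).map fun i => n + i) := by
    have h2 : ((List.range n).map fun i => (i + 1) % n) = (List.range n).rotate 1 := by
      refine List.ext_getElem (by simp) fun i hi _ => ?_
      simp [List.getElem_rotate]
    have h3 : ((List.range n).map fun i => n + (i + 1) % n)
        = ((List.range n).rotate 1).map fun i => n + i := by
      rw [← h2, List.map_map]; rfl
    rw [h3]
    exact (List.rotate_perm _ 1).map _
  have h4 : ∀ l : List ℕ,
      ((l.map fun i => (i, n + (i + 1) % n, n + i)).flatMap DiagramData.triple).Perm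
        (l ++ ((l.map fun i => n + (i + 1) % n) ++ l.map fun i => n + i)) := by
    intro l
    induction l with
    | nil => simp
    | cons i l ih =>
      rw [List.perm_iff_count] at ih ⊢
      intro c
      have := ih c
      simp only [List.map_cons, List.flatMap_cons, DiagramData.triple, List.count_append,
        List.count_cons, List.count_nil] at this ⊢
      omega
  have h5 : List.range (2 * n) = List.range n ++ (List.range n).map fun i => n + i := by
    rw [two_mul, List.range_add]
  have h6 := (h4 (List.range n)).trans ((h1.append_right _).append_left _)
  rw [List.perm_iff_count] at h6 ⊢
  intro c
  have := h6 c
  simp only [DiagramData.ends, h5, List.count_append] at this ⊢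
  omega

/-- The wheel with `n` spokes: the spokes `0, …, n - 1` end on the Wilson line in this order, and the
edge `n + i` of the rim joins the inner ends of the spokes `i - 1` and `i` (modulo `n`). -/
def wheel (n : ℕ) : FeynmanDiagram where
  legs := List.range n
  verts := (List.range n).map fun i => (i, n + (i + 1) % n, n + i)
  two := by
    intro e he
    rw [(wheel_ends_perm n).mem_iff] at he
    rw [(wheel_ends_perm n).count_eq, List.count_append,
      List.count_eq_one_of_mem List.nodup_range (by simpa using he)]
  anchored := by
    intro e he
    have he' := he
    rw [DiagramData.edges, List.mem_toFinset, (wheel_ends_perm n).mem_iff] at he'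
    have hlt : e < 2 * n := by simpa using he'
    by_cases hen : e < n
    · exact ⟨e, by simpa using hen, Relation.ReflTransGen.refl⟩
    · have hj : e - n < n := by omega
      refine ⟨e - n, by simpa using hj, Relation.ReflTransGen.single ⟨he, ?_, ?_⟩⟩
      · rw [DiagramData.edges, List.mem_toFinset, (wheel_ends_perm n).mem_iff]
        simp only [List.mem_append, List.mem_range, or_self]
        omega
      · refine ⟨Sum.inr ⟨e - n, by simpa using hj⟩, ?_, ?_⟩
        · simp only [DiagramData.edgesAt, DiagramData.triple, List.get_eq_getElem,
            List.getElem_map, List.getElem_range, List.mem_cons]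
          right; right; left; omega
        · simp [DiagramData.edgesAt, DiagramData.triple]

/-! The first task is to attach to every diagram a class in `𝒜` itself, where primitivity is
defined. `value` resolves trivalent vertices at legs, one after the other, by the three-term
relation, until only chords remain. The result does not depend on the choices, by induction on the
number of trivalent vertices: resolutions at two different vertices commute, while resolutions at
one vertex through two different legs differ by a four-term relation. The induction has to carry
along a four-term relation for diagrams that still have trivalent vertices
(`WellDefined.wellDefined_and_fourTermHolds`). By `chordToFeynman_value` the class so obtained is
represented by the diagram, so the rest of the argument takes place in `𝒜`. Resolution also gives
the antisymmetry of trivalent vertices (`value_flip`).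

The coproduct of a diagram distributes its connected components over the two factors
(`chordComul_value`); hence connected diagrams are primitive. For the converse, `𝒜` gets its
commutative product, and `adams` is the product after the coproduct. It doubles primitive elements.
On a diagram with `N` unions of components it is multiplication by `N` modulo diagrams with fewer
unions: each of its `N` terms is the same graph with permuted legs, and transposing legs of two
components costs a diagram in which these components are merged. In characteristic zero the
eigenvalue `2` differs from every `N > 2`, so a primitive element descends to diagrams with at most
two unions, the connected ones and the empty one; the empty one cannot contribute, as `adams` fixes
it (`mem_connected_of_mem_primitives`).

For a connected diagram, permuting the legs changes the class only by connected diagrams with fewer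
legs. A cherry, i.e. two legs at one trivalent vertex, changes sign when its legs are exchanged, so
twice a diagram with a cherry is a combination of diagrams with fewer legs. Induction on the number
of legs shows that connected diagrams without cherries span `𝒫`.

The three assertions are then counting. A hanging tree, its leaf `r` left aside, has one leg more
than trivalent vertices, so two of its legs form a cherry (`IsHangingTree.hasCherry`); a basis is
extracted from the cherry-free connected diagrams. In such a diagram of order `n ≥ 2` the legs sit
on different trivalent vertices, so there are at most `n` of them among the `2n` vertices. If there
are exactly `n`, every trivalent vertex carries one leg and the remaining edges form a single cycle:
up to signs and diagrams with fewer legs this is the wheel (`value_mem_wheelSpan`). -/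

/-! ### Rotated lists and cyclic triples. -/

theorem List.isRotated_iff_exists_append {α : Type*} {l l' : List α} :
    l ~r l' ↔ ∃ A B, l = A ++ B ∧ l' = B ++ A := by
  constructor
  · rintro ⟨n, rfl⟩
    refine ⟨_, _, (List.take_append_drop (n % l.length) l).symm, ?_⟩
    rw [List.rotate_eq_drop_append_take_mod]
  · rintro ⟨A, B, rfl, rfl⟩
    exact List.isRotated_append

/-- Rotating a list from one entry to another one. -/
theorem List.IsRotated.cons_cases {α : Type*} {x y : α} {L M : List α}
    (h : (x :: L) ~r (y :: M)) :
    (x = y ∧ L = M) ∨ ∃ U V, L = U ++ y :: V ∧ M = V ++ x :: U := by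
  obtain ⟨A, B, h₁, h₂⟩ := List.isRotated_iff_exists_append.mp h
  rcases A with _ | ⟨c, A⟩
  · simp only [List.nil_append, List.append_nil] at h₁ h₂
    rw [← h₁] at h₂
    simp only [List.cons.injEq] at h₂
    exact Or.inl ⟨h₂.1.symm, h₂.2.symm⟩
  · rcases B with _ | ⟨d, B⟩
    · simp only [List.nil_append, List.append_nil] at h₁ h₂
      rw [← h₁] at h₂
      simp only [List.cons.injEq] at h₂
      exact Or.inl ⟨h₂.1.symm, h₂.2.symm⟩
    · simp only [List.cons_append, List.cons.injEq] at h₁ h₂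
      obtain ⟨rfl, rfl⟩ := h₁
      obtain ⟨rfl, rfl⟩ := h₂
      exact Or.inr ⟨A, B, rfl, rfl⟩

theorem Cycle.coe_triple_eq {α : Type*} {x b a x' b' a' : α}
    (h : (([x, b, a] : List α) : Cycle α) = ([x', b', a'] : List α)) :
    (x' = x ∧ b' = b ∧ a' = a) ∨ (x' = b ∧ b' = a ∧ a' = x) ∨ (x' = a ∧ b' = x ∧ a' = b) := by
  obtain ⟨A, B, h₁, h₂⟩ := List.isRotated_iff_exists_append.mp (Cycle.coe_eq_coe.mp h)
  rcases A with _ | ⟨c, _ | ⟨d, _ | ⟨e, A⟩⟩⟩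
  · simp only [List.nil_append, List.append_nil] at h₁ h₂
    rw [← h₁] at h₂
    exact Or.inl (by simpa using h₂)
  · simp only [List.cons_append, List.nil_append, List.cons.injEq] at h₁
    obtain ⟨rfl, rfl⟩ := h₁
    simp only [List.cons_append, List.nil_append, List.cons.injEq, and_true] at h₂
    exact Or.inr (Or.inl h₂)
  · simp only [List.cons_append, List.nil_append, List.cons.injEq] at h₁
    obtain ⟨rfl, rfl, rfl⟩ := h₁
    simp only [List.cons_append, List.nil_append, List.cons.injEq, and_true] at h₂
    exact Or.inr (Or.inr h₂)
  · simp only [List.cons_append, List.cons.injEq] at h₁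
    obtain ⟨rfl, rfl, rfl, h₃⟩ := h₁
    rw [eq_comm, List.append_eq_nil_iff] at h₃
    obtain ⟨rfl, rfl⟩ := h₃
    exact Or.inl (by simpa using h₂)

/-! ### Edge ends, cyclic vertices and the pairing condition. -/

namespace DiagramData

/-- The list of the edge ends at the trivalent vertices. -/
def vertEnds (T : List (ℕ × ℕ × ℕ)) : List ℕ := T.flatMap triple

/-- The multiset of the cyclically ordered triples of a list of trivalent vertices. -/
def cyc (T : List (ℕ × ℕ × ℕ)) : Multiset (Cycle ℕ) :=
  (T.map fun v => (triple v : Cycle ℕ) : List (Cycle ℕ))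

/-- Renaming the edges at the trivalent vertices. -/
def mapVerts (f : ℕ → ℕ) (T : List (ℕ × ℕ × ℕ)) : List (ℕ × ℕ × ℕ) :=
  T.map fun v => (f v.1, f v.2.1, f v.2.2)

/-- Every edge has two ends. -/
def IsPaired (L : List ℕ) (T : List (ℕ × ℕ × ℕ)) : Prop :=
  ∀ e, L.count e + (vertEnds T).count e = 0 ∨ L.count e + (vertEnds T).count e = 2

@[simp] theorem vertEnds_nil : vertEnds [] = [] := rfl

@[simp] theorem vertEnds_cons (v : ℕ × ℕ × ℕ) (T : List (ℕ × ℕ × ℕ)) :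
    vertEnds (v :: T) = v.1 :: v.2.1 :: v.2.2 :: vertEnds T := by
  simp [vertEnds, triple]

@[simp] theorem vertEnds_append (T T' : List (ℕ × ℕ × ℕ)) :
    vertEnds (T ++ T') = vertEnds T ++ vertEnds T' := by
  simp [vertEnds]

@[simp] theorem cyc_nil : cyc [] = 0 := rfl

theorem cyc_cons (v : ℕ × ℕ × ℕ) (T : List (ℕ × ℕ × ℕ)) :
    cyc (v :: T) = (triple v : Cycle ℕ) ::ₘ cyc T := rfl

theorem cyc_append (T T' : List (ℕ × ℕ × ℕ)) : cyc (T ++ T') = cyc T + cyc T' := by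
  simp [cyc]

@[simp] theorem card_cyc (T : List (ℕ × ℕ × ℕ)) : Multiset.card (cyc T) = T.length := by
  simp [cyc]

theorem cyc_perm {T T' : List (ℕ × ℕ × ℕ)} (h : T.Perm T') : cyc T = cyc T' :=
  Multiset.coe_eq_coe.mpr (h.map _)

theorem cyc_mapVerts (f : ℕ → ℕ) (T : List (ℕ × ℕ × ℕ)) :
    cyc (mapVerts f T) = (cyc T).map (Cycle.map f) := by
  simp only [cyc, mapVerts, Multiset.map_coe, List.map_map]
  rfl

theorem vertEnds_mapVerts (f : ℕ → ℕ) (T : List (ℕ × ℕ × ℕ)) :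
    vertEnds (mapVerts f T) = (vertEnds T).map f := by
  induction T with
  | nil => rfl
  | cons v T ih => simpa [mapVerts] using ih

theorem cyc_rotate_left (x b a : ℕ) (T : List (ℕ × ℕ × ℕ)) :
    cyc ((x, b, a) :: T) = cyc ((b, a, x) :: T) := by
  rw [cyc_cons, cyc_cons]
  congr 1
  exact Cycle.coe_cons_eq_coe_append [b, a] x

theorem cyc_rotate_right (x b a : ℕ) (T : List (ℕ × ℕ × ℕ)) :
    cyc ((x, b, a) :: T) = cyc ((a, x, b) :: T) := (cyc_rotate_left a x b T).symm

theorem coe_vertEnds (T : List (ℕ × ℕ × ℕ)) :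
    (vertEnds T : Multiset ℕ) = (cyc T).bind Cycle.toMultiset := by
  induction T with
  | nil => rfl
  | cons v T ih =>
    rw [cyc_cons, Multiset.cons_bind, ← ih]
    simp [triple]

theorem vertEnds_perm {T T' : List (ℕ × ℕ × ℕ)} (h : cyc T = cyc T') :
    (vertEnds T).Perm (vertEnds T') := by
  rw [← Multiset.coe_eq_coe, coe_vertEnds, coe_vertEnds, h]

theorem exists_perm_cons_of_cyc_eq {T : List (ℕ × ℕ × ℕ)} {c : Cycle ℕ}
    {s : Multiset (Cycle ℕ)} (h : cyc T = c ::ₘ s) :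
    ∃ v T', T.Perm (v :: T') ∧ (triple v : Cycle ℕ) = c ∧ cyc T' = s := by
  have hc : c ∈ cyc T := by simp [h]
  simp only [cyc, Multiset.mem_coe, List.mem_map] at hc
  obtain ⟨v, hv, rfl⟩ := hc
  have hp := List.perm_cons_erase hv
  refine ⟨v, T.erase v, hp, rfl, ?_⟩
  rw [cyc_perm hp, cyc_cons] at h
  exact (Multiset.cons_inj_right _).mp h

theorem exists_cyc_eq_cons_of_mem {T : List (ℕ × ℕ × ℕ)} {v : ℕ × ℕ × ℕ} {x : ℕ} (hv : v ∈ T)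
    (hx : x ∈ triple v) : ∃ a b T', cyc T = cyc ((x, b, a) :: T') := by
  have hp := List.perm_cons_erase hv
  obtain ⟨p, q, r⟩ := v
  simp only [triple, List.mem_cons, List.not_mem_nil, or_false] at hx
  rcases hx with rfl | rfl | rfl
  · exact ⟨r, q, _, cyc_perm hp⟩
  · exact ⟨p, r, _, (cyc_perm hp).trans (cyc_rotate_left _ _ _ _)⟩
  · exact ⟨q, p, _, (cyc_perm hp).trans (cyc_rotate_right _ _ _ _)⟩

theorem exists_cyc_eq_cons {T : List (ℕ × ℕ × ℕ)} {x : ℕ} (hx : x ∈ vertEnds T) :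
    ∃ a b T', cyc T = cyc ((x, b, a) :: T') := by
  simp only [vertEnds, List.mem_flatMap] at hx
  obtain ⟨v, hv, hx⟩ := hx
  exact exists_cyc_eq_cons_of_mem hv hx

theorem length_eq_of_cyc_eq {T T' : List (ℕ × ℕ × ℕ)} (h : cyc T = cyc T') :
    T.length = T'.length := by
  rw [← card_cyc, h, card_cyc]

theorem IsPaired.of_perm {L L' : List ℕ} {T T' : List (ℕ × ℕ × ℕ)} (h : IsPaired L T)
    (hp : (L ++ vertEnds T).Perm (L' ++ vertEnds T')) : IsPaired L' T' := by
  intro e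
  have := hp.count_eq e
  simp only [List.count_append] at this
  rw [← this]
  exact h e

theorem IsPaired.congr {L L' : List ℕ} {T T' : List (ℕ × ℕ × ℕ)} (h : IsPaired L T)
    (hL : L.Perm L') (hT : cyc T = cyc T') : IsPaired L' T' :=
  h.of_perm (hL.append (vertEnds_perm hT))

theorem IsPaired.map {L : List ℕ} {T : List (ℕ × ℕ × ℕ)} (h : IsPaired L T)
    (π : Equiv.Perm ℕ) : IsPaired (L.map π) (mapVerts π T) := by
  intro e
  have := h (π.symm e)
  have h1 : ∀ l : List ℕ, (l.map π).count e = l.count (π.symm e) := by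
    intro l
    conv_lhs => rw [← π.apply_symm_apply e]
    exact List.count_map_of_injective l π π.injective _
  rw [vertEnds_mapVerts, h1, h1]
  exact this

/-- The ends of the edges `x`, `a`, `b` at a leg joined to a trivalent vertex. -/
theorem IsPaired.counts {P Q : List ℕ} {T : List (ℕ × ℕ × ℕ)} {x a b : ℕ}
    (h : IsPaired (P ++ x :: Q) ((x, b, a) :: T)) :
    x ∉ P ∧ x ∉ Q ∧ x ≠ a ∧ x ≠ b ∧ x ∉ vertEnds T := by
  have := h x
  simp only [List.count_append, List.count_cons, vertEnds_cons, beq_self_eq_true, if_true] at this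
  have h1 : P.count x = 0 ∧ Q.count x = 0 ∧ (vertEnds T).count x = 0 := by omega
  refine ⟨List.count_eq_zero.mp h1.1, List.count_eq_zero.mp h1.2.1, ?_, ?_,
    List.count_eq_zero.mp h1.2.2⟩
  · rintro rfl
    simp at this
    omega
  · rintro rfl
    simp at this
    omega

theorem IsPaired.resolve {P Q : List ℕ} {T : List (ℕ × ℕ × ℕ)} {x a b : ℕ}
    (h : IsPaired (P ++ x :: Q) ((x, b, a) :: T)) : IsPaired (P ++ a :: b :: Q) T := by
  obtain ⟨h1, h2, h3, h4, h5⟩ := h.counts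
  intro e
  have := h e
  by_cases hex : x = e
  · subst hex
    left
    simp [List.count_append, List.count_eq_zero.mpr h1,
      List.count_eq_zero.mpr h2, List.count_eq_zero.mpr h5, h3.symm, h4.symm]
  · simp only [List.count_append, List.count_cons, vertEnds_cons, beq_iff_eq, if_neg hex]
      at this ⊢
    omega

theorem IsPaired.swap {P Q : List ℕ} {T : List (ℕ × ℕ × ℕ)} {a b : ℕ}
    (h : IsPaired (P ++ a :: b :: Q) T) : IsPaired (P ++ b :: a :: Q) T :=
  h.congr ((List.Perm.swap b a Q).append_left P) rfl

end DiagramData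

/-! ### The class of a diagram, defined by resolving trivalent vertices. -/

namespace DiagramData

/-- The data of a three-term resolution: a leg `x` joined to a vertex with edges `x, b, a`, the
remaining legs and the remaining vertices. -/
structure Resolution where
  x : ℕ
  b : ℕ
  a : ℕ
  legs : List ℕ
  verts : List (ℕ × ℕ × ℕ)

/-- `r` resolves the diagram with legs `L` and trivalent vertices `T`. -/
def Resolution.Of (r : Resolution) (L : List ℕ) (T : List (ℕ × ℕ × ℕ)) : Prop :=
  L ~r (r.x :: r.legs) ∧ cyc T = cyc ((r.x, r.b, r.a) :: r.verts)

open Classical in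
/-- The class in `𝒜` of a diagram with `n` trivalent vertices, computed by resolving one of them
after the other; diagrams that cannot be resolved are sent to zero. -/
noncomputable def valueAux (k : Type*) [Field k] :
    ℕ → List ℕ → List (ℕ × ℕ × ℕ) → ChordSpace k
  | 0, L, _ => if h : ∀ e ∈ L, L.count e = 2 then ChordDiagram.cls k ⟨L, h⟩ else 0
  | n + 1, L, T =>
    -- The resolution is an arbitrary choice; that it does not matter is the content of
    -- `WellDefined`.
    if h : ∃ r : Resolution, r.Of L T then
      valueAux k n (h.choose.a :: h.choose.b :: h.choose.legs) h.choose.verts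
        - valueAux k n (h.choose.b :: h.choose.a :: h.choose.legs) h.choose.verts
    else 0

/-- The class in `𝒜` of the diagram with legs `L` and trivalent vertices `T`. -/
noncomputable def value (k : Type*) [Field k] (L : List ℕ) (T : List (ℕ × ℕ × ℕ)) :
    ChordSpace k := valueAux k T.length L T

variable {k : Type*} [Field k]

theorem IsPaired.chord {L : List ℕ} (h : IsPaired L []) : ∀ e ∈ L, L.count e = 2 := by
  intro e he
  have h1 := h e
  have h2 := List.count_pos_iff.mpr he
  simp only [vertEnds_nil, List.count_nil] at h1
  omega

theorem value_chord {L : List ℕ} (h : ∀ e ∈ L, L.count e = 2) :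
    value k L [] = ChordDiagram.cls k ⟨L, h⟩ := by
  simp only [value, List.length_nil, valueAux]
  rw [dif_pos h]

/-- The difference of the two resolved diagrams. -/
noncomputable def Resolution.diff (k : Type*) [Field k] (r : Resolution) : ChordSpace k :=
  value k (r.a :: r.b :: r.legs) r.verts - value k (r.b :: r.a :: r.legs) r.verts

theorem Resolution.Of.length {r : Resolution} {L : List ℕ} {T : List (ℕ × ℕ × ℕ)}
    (h : r.Of L T) : T.length = r.verts.length + 1 := length_eq_of_cyc_eq h.2

theorem exists_value_eq_diff {L : List ℕ} {T : List (ℕ × ℕ × ℕ)}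
    (h : ∃ r : Resolution, r.Of L T) : ∃ r : Resolution, r.Of L T ∧ value k L T = r.diff k := by
  refine ⟨h.choose, h.choose_spec, ?_⟩
  have hl := h.choose_spec.length
  rw [value, hl, valueAux, dif_pos h]
  rfl

theorem value_eq_zero {L : List ℕ} {T : List (ℕ × ℕ × ℕ)} (hT : T ≠ [])
    (h : ¬ ∃ r : Resolution, r.Of L T) : value k L T = 0 := by
  obtain ⟨v, T, rfl⟩ := List.exists_cons_of_ne_nil hT
  rw [value, List.length_cons, valueAux, dif_neg h]

/-- The class of a diagram with `n` trivalent vertices is invariant under isomorphisms and satisfies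
the three-term relation. -/
structure WellDefined (k : Type*) [Field k] (n : ℕ) : Prop where
  iso : ∀ (L : List ℕ) (T : List (ℕ × ℕ × ℕ)) (L' : List ℕ) (T' : List (ℕ × ℕ × ℕ))
    (π : Equiv.Perm ℕ), T.length = n → IsPaired L T → (L.map π) ~r L' →
    cyc (mapVerts π T) = cyc T' → value k L T = value k L' T'
  stu : ∀ (x a b : ℕ) (L : List ℕ) (T : List (ℕ × ℕ × ℕ)), T.length + 1 = n →
    IsPaired (x :: L) ((x, b, a) :: T) →
    value k (x :: L) ((x, b, a) :: T) = value k (a :: b :: L) T - value k (b :: a :: L) T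

/-- The classes of the diagrams with `n` trivalent vertices satisfy the four-term relations in which
the edge `b` is a chord and one end of the edge `a` is moved. -/
def FourTermHolds (k : Type*) [Field k] (n : ℕ) : Prop :=
  ∀ (a b : ℕ) (U V : List ℕ) (T : List (ℕ × ℕ × ℕ)), T.length = n →
    IsPaired (a :: b :: (U ++ b :: V)) T →
    value k (a :: b :: (U ++ b :: V)) T - value k (b :: a :: (U ++ b :: V)) T
      + value k (b :: (U ++ a :: b :: V)) T - value k (b :: (U ++ b :: a :: V)) T = 0

theorem mapVerts_one (T : List (ℕ × ℕ × ℕ)) : mapVerts (1 : Equiv.Perm ℕ) T = T := by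
  simp [mapVerts]

theorem map_perm_one (L : List ℕ) : L.map (1 : Equiv.Perm ℕ) = L := by
  simp

/-! ### Independence of the choices, by induction on the number of trivalent vertices. -/

namespace WellDefined

variable {n : ℕ}

theorem congr (G : WellDefined k n) {L L' : List ℕ} {T T' : List (ℕ × ℕ × ℕ)}
    (hn : T.length = n) (hp : IsPaired L T) (hL : L ~r L') (hT : cyc T = cyc T') :
    value k L T = value k L' T' :=
  G.iso L T L' T' 1 hn hp (by rwa [map_perm_one]) (by rwa [mapVerts_one])

theorem rotate (G : WellDefined k n) {A B : List ℕ} {T : List (ℕ × ℕ × ℕ)}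
    (hn : T.length = n) (hp : IsPaired (A ++ B) T) :
    value k (A ++ B) T = value k (B ++ A) T :=
  G.congr hn hp List.isRotated_append rfl

/-- The leg `x` is rotated to the front, where `stu` applies, and the two resolved diagrams are
rotated back. -/
theorem stu_at (G : WellDefined k (n + 1)) (G' : WellDefined k n) {P Q : List ℕ}
    {T T' : List (ℕ × ℕ × ℕ)} {x a b : ℕ} (hn : T.length = n + 1)
    (hp : IsPaired (P ++ x :: Q) T) (hT : cyc T = cyc ((x, b, a) :: T')) :
    value k (P ++ x :: Q) T = value k (P ++ a :: b :: Q) T' - value k (P ++ b :: a :: Q) T' := by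
  have hp' := hp.congr (List.Perm.refl _) hT
  have hn' : T'.length = n := by
    have := length_eq_of_cyc_eq hT
    simp only [List.length_cons] at this
    omega
  rw [G.congr hn hp (List.isRotated_append (l := P) (l' := x :: Q)) hT, List.cons_append,
    G.stu x a b (Q ++ P) T' (by omega) (hp'.congr List.perm_append_comm rfl),
    G'.rotate (A := P) hn' hp'.resolve, G'.rotate (A := P) hn' hp'.resolve.swap]
  rfl

theorem four_at (G : WellDefined k n) (G4 : FourTermHolds k n) {a b : ℕ} {P Q R : List ℕ} {T : List (ℕ × ℕ × ℕ)}
    (hn : T.length = n) (hp : IsPaired (P ++ a :: b :: (Q ++ b :: R)) T) :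
    value k (P ++ a :: b :: (Q ++ b :: R)) T - value k (P ++ b :: a :: (Q ++ b :: R)) T
      + value k (P ++ b :: (Q ++ a :: b :: R)) T - value k (P ++ b :: (Q ++ b :: a :: R)) T
      = 0 := by
  have h := G4 a b Q (R ++ P) T hn (hp.congr (by
    rw [List.perm_iff_count]; intro c
    simp only [List.count_append, List.count_cons]; omega) rfl)
  have hp2 := hp.swap
  have hp3 : IsPaired (P ++ b :: (Q ++ a :: b :: R)) T := hp.congr (by
    rw [List.perm_iff_count]; intro c
    simp only [List.count_append, List.count_cons]; omega) rfl
  have hp4 : IsPaired (P ++ b :: (Q ++ b :: a :: R)) T := hp.congr (by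
    rw [List.perm_iff_count]; intro c
    simp only [List.count_append, List.count_cons]; omega) rfl
  rw [G.rotate hn hp, G.rotate hn hp2, G.rotate hn hp3, G.rotate hn hp4]
  simpa using h

theorem zero (k : Type*) [Field k] : WellDefined k 0 where
  iso := by
    intro L T L' T' π hn hp hL hT
    obtain rfl := List.eq_nil_of_length_eq_zero hn
    have hl := length_eq_of_cyc_eq hT
    obtain rfl := List.eq_nil_of_length_eq_zero (hl.symm.trans (by rfl))
    have hp' : IsPaired L' [] := (hp.map π).congr hL.perm hT
    rw [value_chord hp.chord, value_chord hp'.chord]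
    exact ChordDiagram.cls_eq_of_iso k ⟨π, hL⟩
  stu := by intro _ _ _ _ _ h; omega

theorem fourTermHolds_zero (k : Type*) [Field k] : FourTermHolds k 0 := by
  intro a b U V T hn hp
  obtain rfl := List.eq_nil_of_length_eq_zero hn
  have hp2 : IsPaired (b :: a :: (U ++ b :: V)) [] := IsPaired.swap (P := []) hp
  have hp3 : IsPaired (b :: (U ++ a :: b :: V)) [] := hp.congr (by
    rw [List.perm_iff_count]; intro c
    simp only [List.count_append, List.count_cons]; omega) rfl
  have hp4 : IsPaired (b :: (U ++ b :: a :: V)) [] := hp.congr (by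
    rw [List.perm_iff_count]; intro c
    simp only [List.count_append, List.count_cons]; omega) rfl
  rw [value_chord hp.chord, value_chord hp2.chord, value_chord hp3.chord, value_chord hp4.chord]
  exact ChordDiagram.cls_fourTerm k ⟨a, b, U, V, rfl, rfl, rfl, rfl⟩

/-- Two resolutions at the same trivalent vertex agree by the four-term relation. -/
theorem diff_same_vertex (G : WellDefined k n) (G4 : FourTermHolds k n) {x a b : ℕ} {U V : List ℕ}
    {T T' : List (ℕ × ℕ × ℕ)} (hn : T.length = n)
    (hp : IsPaired (x :: (U ++ b :: V)) ((x, b, a) :: T)) (hT : cyc T = cyc T') :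
    value k (a :: b :: (U ++ b :: V)) T - value k (b :: a :: (U ++ b :: V)) T
      = value k (x :: a :: (V ++ x :: U)) T' - value k (a :: x :: (V ++ x :: U)) T' := by
  have hp0 := hp.counts (P := [])
  have hr := hp.resolve (P := [])
  have hn' : T'.length = n := by rw [← length_eq_of_cyc_eq hT, hn]
  have hb := hr b
  have hab : a ≠ b := by
    rintro rfl
    have := hp a
    simp only [vertEnds_cons, List.count_append, List.count_cons, beq_self_eq_true,
      if_true] at this
    omega
  have hbc : b ∉ U ∧ b ∉ V ∧ b ∉ vertEnds T := by
    simp only [List.nil_append, List.count_append, List.count_cons, beq_self_eq_true,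
      if_true, beq_iff_eq, if_neg hab] at hb
    refine ⟨?_, ?_, ?_⟩ <;> rw [← List.count_eq_zero] <;> omega
  have hxU : x ∉ U := fun h => hp0.2.1 (by simp [h])
  have hxV : x ∉ V := fun h => hp0.2.1 (by simp [h])
  have fix : ∀ l : List ℕ, x ∉ l → b ∉ l → l.map (Equiv.swap b x) = l := by
    intro l hxl hbl
    conv_rhs => rw [← List.map_id l]
    refine List.map_congr_left fun c hc => ?_
    exact Equiv.swap_apply_of_ne_of_ne (fun h => hbl (h ▸ hc)) (fun h => hxl (h ▸ hc))
  have fixT : mapVerts (Equiv.swap b x) T = T := by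
    have h : ∀ c ∈ vertEnds T, Equiv.swap b x c = c := fun c hc =>
      Equiv.swap_apply_of_ne_of_ne (fun h => hbc.2.2 (h ▸ hc)) (fun h => hp0.2.2.2.2 (h ▸ hc))
    conv_rhs => rw [← List.map_id T]
    refine List.map_congr_left fun v hv => ?_
    have hm : ∀ c ∈ triple v, c ∈ vertEnds T := fun c hc => List.mem_flatMap.mpr ⟨v, hv, hc⟩
    rw [h _ (hm v.1 (by simp [triple])), h _ (hm v.2.1 (by simp [triple])),
      h _ (hm v.2.2 (by simp [triple]))]
    rfl
  have hax : Equiv.swap b x a = a := Equiv.swap_apply_of_ne_of_ne hab hp0.2.2.1.symm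
  -- Resolving through the other leg leaves `x` as a chord in the place of `b`. Exchanging these two
  -- names and rotating turns the two diagrams of that resolution into the fourth and third terms of
  -- the four-term relation.
  have e1 : value k (b :: (U ++ b :: a :: V)) T = value k (x :: a :: (V ++ x :: U)) T' := by
    refine G.iso _ _ _ _ (Equiv.swap b x) hn (hr.congr (by
      rw [List.perm_iff_count]; intro c
      simp only [List.nil_append, List.count_append, List.count_cons]; omega) rfl) ?_
      (by rw [fixT, hT])
    simpa [fix U hxU hbc.1, fix V hxV hbc.2.1, hax] using
      List.isRotated_append (l := x :: U) (l' := x :: a :: V)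
  have e2 : value k (b :: (U ++ a :: b :: V)) T = value k (a :: x :: (V ++ x :: U)) T' := by
    refine G.iso _ _ _ _ (Equiv.swap b x) hn (hr.congr (by
      rw [List.perm_iff_count]; intro c
      simp only [List.nil_append, List.count_append, List.count_cons]; omega) rfl) ?_
      (by rw [fixT, hT])
    simpa [fix U hxU hbc.1, fix V hxV hbc.2.1, hax] using
      List.isRotated_append (l := x :: U) (l' := a :: x :: V)
  have h4 := G4 a b U V T hn hr
  rw [← e1, ← e2, ← sub_eq_zero, ← h4]
  abel

/-- There are three cases. At the same leg the resolutions coincide; at two legs of one vertex they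
differ by a four-term relation; at two different vertices each side can be resolved once more at the
other vertex, and the same four diagrams appear. -/
theorem diff_eq_diff (H : ∀ m ≤ n, WellDefined k m) (G4 : FourTermHolds k n) {r r' : Resolution}
    (hn : r.verts.length = n) (hp : IsPaired (r.x :: r.legs) ((r.x, r.b, r.a) :: r.verts))
    (hL : (r.x :: r.legs) ~r (r'.x :: r'.legs))
    (hT : cyc ((r.x, r.b, r.a) :: r.verts) = cyc ((r'.x, r'.b, r'.a) :: r'.verts)) :
    r.diff k = r'.diff k := by
  obtain ⟨x, b, a, L, T⟩ := r
  obtain ⟨x', b', a', L', T'⟩ := r'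
  have G := H n le_rfl
  dsimp only at hn hp hL hT
  simp only [Resolution.diff]
  have hc := hp.counts (P := [])
  have hn' : T'.length = n := by
    have := length_eq_of_cyc_eq hT
    simp only [List.length_cons] at this
    omega
  have hp' : IsPaired (x' :: L') ((x', b', a') :: T') := hp.congr hL.perm hT
  have hc' := hp'.counts (P := [])
  have hr := hp.resolve (P := [])
  rcases hL.cons_cases with ⟨rfl, rfl⟩ | ⟨U, V, rfl, rfl⟩
  · rw [cyc_cons, cyc_cons] at hT
    -- An edge that ends at a leg has only one other end, so both resolutions use the same trivalent
    -- vertex.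
    have hv : (([x, b, a] : List ℕ) : Cycle ℕ) = ([x, b', a'] : List ℕ) := by
      by_contra hne
      rcases Multiset.cons_eq_cons.mp hT with h | ⟨-, s, hs, -⟩
      · exact hne h.1
      · obtain ⟨v, T'', hv, hv', -⟩ := exists_perm_cons_of_cyc_eq hs
        refine hc.2.2.2.2 ?_
        rw [(vertEnds_perm (cyc_perm hv)).mem_iff]
        have hm : x ∈ (triple v : Cycle ℕ) := by rw [hv']; simp [triple]
        rw [Cycle.mem_coe_iff] at hm
        rw [vertEnds, List.flatMap_cons, List.mem_append]
        exact Or.inl hm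
    have hT' : cyc T = cyc T' := by
      simp only [triple, hv] at hT
      exact (Multiset.cons_inj_right _).mp hT
    rcases Cycle.coe_triple_eq hv with ⟨-, rfl, rfl⟩ | ⟨h, -, -⟩ | ⟨h, -, -⟩
    · have e1 := G.congr hn hr (List.IsRotated.refl _) hT'
      have e2 := G.congr hn hr.swap (List.IsRotated.refl _) hT'
      rw [List.nil_append] at e1 e2
      rw [e1, e2]
    · exact absurd h hc.2.2.2.1
    · exact absurd h hc.2.2.1
  · have hxx : x ≠ x' := by
      rintro rfl
      exact hc.2.1 (by simp)
    rw [cyc_cons, cyc_cons] at hT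
    by_cases hv : (triple (x, b, a) : Cycle ℕ) = triple (x', b', a')
    · have hT' : cyc T = cyc T' := by rw [hv] at hT; exact (Multiset.cons_inj_right _).mp hT
      rcases Cycle.coe_triple_eq hv with ⟨h, -, -⟩ | ⟨rfl, rfl, rfl⟩ | ⟨rfl, rfl, rfl⟩
      · exact absurd h hxx.symm
      · exact G.diff_same_vertex G4 hn hp hT'
      · refine (G.diff_same_vertex G4 hn' ?_ hT'.symm).symm
        exact hp'
    -- The two vertices are different, and `S` is what remains without both. This is where
    -- well-definedness with one vertex less is needed.
    · rcases Multiset.cons_eq_cons.mp hT with h | ⟨-, s, hs, hs'⟩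
      · exact absurd h.1 hv
      obtain ⟨v, S, hv, hv', hS⟩ := exists_perm_cons_of_cyc_eq hs
      have hTS : cyc T = cyc ((x', b', a') :: S) := by rw [hs, cyc_cons, hS]
      have hTS' : cyc T' = cyc ((x, b, a) :: S) := by rw [hs', cyc_cons, hS]
      have hlen := length_eq_of_cyc_eq hTS
      simp only [List.length_cons] at hlen
      obtain ⟨m, rfl⟩ : ∃ m, n = m + 1 := ⟨S.length, by omega⟩
      have G' := H m (by omega)
      have hr' := hp'.resolve (P := [])
      have hSm : S.length = m := by omega
      have s1 := G.stu_at G' (P := a :: b :: U) (Q := V) hn hr hTS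
      have s2 := G.stu_at G' (P := b :: a :: U) (Q := V) hn (IsPaired.swap (P := []) hr) hTS
      have s3 := G.stu_at G' (P := a' :: b' :: V) (Q := U) hn' hr' hTS'
      have s4 := G.stu_at G' (P := b' :: a' :: V) (Q := U) hn' (IsPaired.swap (P := []) hr') hTS'
      have q1 := (hr.congr (List.Perm.refl _) hTS).resolve (P := a :: b :: U)
      have q2 := ((IsPaired.swap (P := []) hr).congr (List.Perm.refl _) hTS).resolve
        (P := b :: a :: U)
      have rot : ∀ p q p' q' : ℕ, IsPaired (p :: q :: U ++ p' :: q' :: V) S →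
          value k (p :: q :: U ++ p' :: q' :: V) S = value k (p' :: q' :: V ++ p :: q :: U) S := by
        intro p q p' q' h
        exact G'.rotate (A := p :: q :: U) (B := p' :: q' :: V) hSm h
      simp only [List.cons_append] at s1 s2 s3 s4 rot ⊢
      rw [s1, s2, s3, s4, rot _ _ _ _ q1, rot _ _ _ _ q1.swap, rot _ _ _ _ q2,
        rot _ _ _ _ q2.swap]
      abel


/-- Renaming the edges of a resolution. -/
def _root_.DiagramData.Resolution.map (r : Resolution) (π : Equiv.Perm ℕ) : Resolution :=
  ⟨π r.x, π r.b, π r.a, r.legs.map π, mapVerts π r.verts⟩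

theorem _root_.DiagramData.Resolution.Of.map {r : Resolution} {L L' : List ℕ}
    {T T' : List (ℕ × ℕ × ℕ)} (h : r.Of L T) {π : Equiv.Perm ℕ} (hL : (L.map π) ~r L')
    (hT : cyc (mapVerts π T) = cyc T') : (r.map π).Of L' T' := by
  refine ⟨hL.symm.trans (h.1.map π), ?_⟩
  rw [← hT, cyc_mapVerts, h.2, ← cyc_mapVerts]
  rfl

theorem _root_.DiagramData.Resolution.Of.isPaired {r : Resolution} {L : List ℕ}
    {T : List (ℕ × ℕ × ℕ)} (h : r.Of L T) (hp : IsPaired L T) :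
    IsPaired (r.x :: r.legs) ((r.x, r.b, r.a) :: r.verts) := hp.congr h.1.perm h.2

/-- An isomorphism carries resolutions to resolutions. So both diagrams can be resolved or neither
can, and in the first case `diff_eq_diff` compares the chosen resolutions. The three-term relation
compares the chosen resolution with the given one. -/
theorem succ (H : ∀ m ≤ n, WellDefined k m) (G4 : FourTermHolds k n) : WellDefined k (n + 1) where
  iso := by
    intro L T L' T' π hn hp hL hT
    have hlen := length_eq_of_cyc_eq hT
    rw [mapVerts, List.length_map] at hlen
    have hL' : (L'.map (π⁻¹ : Equiv.Perm ℕ)) ~r L := by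
      have := hL.symm.map (π⁻¹ : Equiv.Perm ℕ)
      simpa using this
    have hT' : cyc (mapVerts (π⁻¹ : Equiv.Perm ℕ) T') = cyc T := by
      rw [cyc_mapVerts, ← hT, ← cyc_mapVerts]
      simp [mapVerts, Function.comp_def]
    by_cases h : ∃ r : Resolution, r.Of L T
    · obtain ⟨r, hr, e⟩ := exists_value_eq_diff (k := k) h
      obtain ⟨r', hr', e'⟩ := exists_value_eq_diff (k := k) ⟨_, hr.map hL hT⟩
      have hs := hr.map hL hT
      have hrn : r.verts.length = n := by have := hr.length; omega
      have hq := (hr.isPaired hp).resolve (P := [])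
      have hp' : IsPaired L' T' := (hp.map π).congr hL.perm hT
      rw [e, e', ← diff_eq_diff H G4 (r := r.map π) (by simpa [Resolution.map, mapVerts] using hrn)
        (hs.isPaired hp') (hs.1.symm.trans hr'.1) (hs.2.symm.trans hr'.2)]
      simp only [Resolution.diff]
      have e1 := (H n le_rfl).iso _ _ _ _ π hrn hq (List.IsRotated.refl _) rfl
      have e2 := (H n le_rfl).iso _ _ _ _ π hrn hq.swap (List.IsRotated.refl _) rfl
      simp only [List.nil_append] at e1 e2
      rw [e1, e2]
      rfl
    · rw [value_eq_zero (List.ne_nil_of_length_eq_add_one hn) h,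
        value_eq_zero (List.ne_nil_of_length_eq_add_one (hlen.symm.trans hn))]
      rintro ⟨r, hr⟩
      exact h ⟨_, hr.map hL' hT'⟩
  stu := by
    intro x a b L T hn hp
    have hr₀ : (⟨x, b, a, L, T⟩ : Resolution).Of (x :: L) ((x, b, a) :: T) :=
      ⟨List.IsRotated.refl _, rfl⟩
    obtain ⟨r, hr, e⟩ := exists_value_eq_diff (k := k) ⟨_, hr₀⟩
    rw [e, ← diff_eq_diff H G4 (r := ⟨x, b, a, L, T⟩) (by simpa using hn) hp hr.1 hr.2]
    rfl

/-- A trivalent vertex at some leg `x` is resolved in all four diagrams. If `x` stays fixed, two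
four-term relations with one vertex less result. If `x` is the moving leg, it becomes a pair of
neighbouring legs, which pass the ends of `b` one at a time. -/
theorem fourTermHolds_succ (G : WellDefined k (n + 1)) (G' : WellDefined k n)
    (G4 : FourTermHolds k n) : FourTermHolds k (n + 1) := by
  intro a b U V T hn hp
  have pm2 : (a :: b :: (U ++ b :: V)).Perm (b :: a :: (U ++ b :: V)) := List.Perm.swap _ _ _
  have pm3 : (a :: b :: (U ++ b :: V)).Perm (b :: (U ++ a :: b :: V)) := by
    rw [List.perm_iff_count]; intro c
    simp only [List.count_append, List.count_cons]; omega
  have pm4 : (a :: b :: (U ++ b :: V)).Perm (b :: (U ++ b :: a :: V)) := by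
    rw [List.perm_iff_count]; intro c
    simp only [List.count_append, List.count_cons]; omega
  by_cases h : ∃ x ∈ a :: b :: (U ++ b :: V), x ∈ vertEnds T
  · obtain ⟨x, hx, hxT⟩ := h
    obtain ⟨p, q, S, hS⟩ := exists_cyc_eq_cons hxT
    have hSn : S.length = n := by
      have := length_eq_of_cyc_eq hS
      simp only [List.length_cons] at this
      omega
    -- Both ends of `b` are legs, so `b` does not meet a trivalent vertex.
    have hxb : x ≠ b := by
      rintro rfl
      have h1 := hp x
      have h2 := List.count_pos_iff.mpr hxT
      simp only [List.count_append, List.count_cons, beq_self_eq_true, if_true] at h1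
      omega
    have hx' : x = a ∨ x ∈ U ∨ x ∈ V := by
      simp only [List.mem_cons, List.mem_append] at hx
      tauto
    rcases hx' with rfl | hxU | hxV
    · have s1 := G.stu_at G' (P := []) hn hp hS
      have s2 := G.stu_at G' (P := [b]) hn (hp.congr pm2 rfl) hS
      have s3 := G.stu_at G' (P := b :: U) hn (hp.congr pm3 rfl) hS
      have s4 := G.stu_at G' (P := b :: U ++ [b]) hn
        (by simpa using hp.congr pm4 rfl) hS
      have hq := (hp.congr (List.Perm.refl _) hS).resolve (P := [])
      have t : ∀ (c : ℕ) (P Q R : List ℕ),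
          (p :: q :: b :: (U ++ b :: V)).Perm (P ++ c :: b :: (Q ++ b :: R)) →
          value k (P ++ c :: b :: (Q ++ b :: R)) S - value k (P ++ b :: c :: (Q ++ b :: R)) S
            + value k (P ++ b :: (Q ++ c :: b :: R)) S
            - value k (P ++ b :: (Q ++ b :: c :: R)) S = 0 :=
        fun c P Q R h => G'.four_at G4 hSn (hq.congr h rfl)
      have pt : ∀ (P : List ℕ), (∀ c, (p :: q :: b :: (U ++ b :: V)).count c = P.count c) →
          (p :: q :: b :: (U ++ b :: V)).Perm P := fun P h => List.perm_iff_count.mpr h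
      -- In `t1` to `t4` the leg `q` moves while `p` rests in each of the four positions; in `u1` to
      -- `u4` the roles are exchanged. In the alternating sums the terms with `p` and `q` in
      -- different positions are symmetric, so they cancel in the difference.
      have t1 := t q [p] U V (pt _ fun e => by
        simp only [List.count_append, List.count_cons, List.count_nil]; omega)
      have t2 := t q [] (p :: U) V (pt _ fun e => by
        simp only [List.count_append, List.count_cons, List.count_nil]; omega)
      have t3 := t q [] (U ++ [p]) V (pt _ fun e => by
        simp only [List.count_append, List.count_cons, List.count_nil]; omega)
      have t4 := t q [] U (p :: V) (pt _ fun e => by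
        simp only [List.count_append, List.count_cons, List.count_nil]; omega)
      have u1 := t p [q] U V (pt _ fun e => by
        simp only [List.count_append, List.count_cons, List.count_nil]; omega)
      have u2 := t p [] (q :: U) V (pt _ fun e => by
        simp only [List.count_append, List.count_cons, List.count_nil]; omega)
      have u3 := t p [] (U ++ [q]) V (pt _ fun e => by
        simp only [List.count_append, List.count_cons, List.count_nil]; omega)
      have u4 := t p [] U (q :: V) (pt _ fun e => by
        simp only [List.count_append, List.count_cons, List.count_nil]; omega)
      simp only [List.cons_append, List.nil_append, List.append_assoc] at s1 s2 s3 s4 ⊢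
      simp only [List.cons_append, List.nil_append, List.append_assoc] at t1 t2 t3 t4 u1 u2 u3 u4
      rw [s1, s2, s3, s4]
      linear_combination (norm := abel) t1 - t2 + t3 - t4 - (u1 - u2 + u3 - u4)
    · obtain ⟨U, W, rfl⟩ := List.append_of_mem hxU
      have s1 := G.stu_at G' (P := a :: b :: U) (Q := W ++ b :: V) hn (by simpa using hp) hS
      have s2 := G.stu_at G' (P := b :: a :: U) (Q := W ++ b :: V) hn
        (by simpa using hp.congr pm2 rfl) hS
      have s3 := G.stu_at G' (P := b :: U) (Q := W ++ a :: b :: V) hn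
        (by simpa using hp.congr pm3 rfl) hS
      have s4 := G.stu_at G' (P := b :: U) (Q := W ++ b :: a :: V) hn
        (by simpa using hp.congr pm4 rfl) hS
      have hp' : IsPaired (a :: b :: U ++ x :: (W ++ b :: V)) T := by simpa using hp
      have hq := (hp'.congr (List.Perm.refl _) hS).resolve
      have t1 := G4 a b (U ++ p :: q :: W) V S hSn (by simpa using hq)
      have t2 := G4 a b (U ++ q :: p :: W) V S hSn (by simpa using hq.swap)
      simp only [List.cons_append, List.append_assoc] at s1 s2 s3 s4 t1 t2 ⊢
      rw [s1, s2, s3, s4, ← sub_eq_zero.mpr (t1.trans t2.symm)]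
      abel
    · obtain ⟨V, W, rfl⟩ := List.append_of_mem hxV
      have s1 := G.stu_at G' (P := a :: b :: U ++ b :: V) (Q := W) hn (by simpa using hp) hS
      have s2 := G.stu_at G' (P := b :: a :: U ++ b :: V) (Q := W) hn
        (by simpa using hp.congr pm2 rfl) hS
      have s3 := G.stu_at G' (P := b :: U ++ a :: b :: V) (Q := W) hn
        (by simpa using hp.congr pm3 rfl) hS
      have s4 := G.stu_at G' (P := b :: U ++ b :: a :: V) (Q := W) hn
        (by simpa using hp.congr pm4 rfl) hS
      have hp' : IsPaired (a :: b :: U ++ b :: V ++ x :: W) T := by simpa using hp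
      have hq := (hp'.congr (List.Perm.refl _) hS).resolve
      have t1 := G4 a b U (V ++ p :: q :: W) S hSn (by simpa using hq)
      have t2 := G4 a b U (V ++ q :: p :: W) S hSn (by simpa using hq.swap)
      simp only [List.cons_append, List.append_assoc] at s1 s2 s3 s4 t1 t2 ⊢
      rw [s1, s2, s3, s4, ← sub_eq_zero.mpr (t1.trans t2.symm)]
      abel
  -- No leg is joined to a trivalent vertex, so none of the four diagrams can be resolved, and all
  -- have the default value zero.
  · have hz : ∀ L : List ℕ, (a :: b :: (U ++ b :: V)).Perm L → value k L T = 0 := by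
      intro L hL
      refine value_eq_zero (List.ne_nil_of_length_eq_add_one hn) ?_
      rintro ⟨r, hr⟩
      refine h ⟨r.x, hL.mem_iff.mpr (hr.1.mem_iff.mpr (by simp)), ?_⟩
      rw [(vertEnds_perm hr.2).mem_iff]
      simp
    rw [hz _ (List.Perm.refl _), hz _ pm2, hz _ pm3, hz _ pm4]
    simp

/-- The two statements must be proved together: well-definedness with `n + 1` vertices uses the
four-term relation with `n` vertices, which in turn is propagated by means of well-definedness. -/
theorem wellDefined_and_fourTermHolds (k : Type*) [Field k] (n : ℕ) :
    WellDefined k n ∧ FourTermHolds k n := by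
  induction n using Nat.strong_induction_on with
  | _ n ih =>
    rcases n with _ | n
    · exact ⟨zero k, fourTermHolds_zero k⟩
    · have G := succ (fun m hm => (ih m (by omega)).1) (ih n (by omega)).2
      exact ⟨G, fourTermHolds_succ G (ih n (by omega)).1 (ih n (by omega)).2⟩

end WellDefined

theorem wellDefined (k : Type*) [Field k] (n : ℕ) : WellDefined k n :=
  (WellDefined.wellDefined_and_fourTermHolds k n).1

variable {L L' P Q R : List ℕ} {T T' : List (ℕ × ℕ × ℕ)} {x a b : ℕ}

theorem value_iso (π : Equiv.Perm ℕ) (hp : IsPaired L T) (hL : (L.map π) ~r L')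
    (hT : cyc (mapVerts π T) = cyc T') : value k L T = value k L' T' :=
  (wellDefined k _).iso L T L' T' π rfl hp hL hT

theorem value_congr (hp : IsPaired L T) (hL : L ~r L') (hT : cyc T = cyc T') :
    value k L T = value k L' T' := (wellDefined k _).congr rfl hp hL hT

theorem value_congr_verts (hp : IsPaired L T) (hT : cyc T = cyc T') :
    value k L T = value k L T' := value_congr hp (List.IsRotated.refl _) hT

/-- The three-term relation at an arbitrary leg. -/
theorem value_stu (hp : IsPaired (P ++ x :: Q) T) (hT : cyc T = cyc ((x, b, a) :: T')) :
    value k (P ++ x :: Q) T = value k (P ++ a :: b :: Q) T' - value k (P ++ b :: a :: Q) T' := by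
  have hl := length_eq_of_cyc_eq hT
  exact (wellDefined k (T'.length + 1)).stu_at (wellDefined k _) (by simpa using hl) hp hT

/-- The four-term relation in which a leg passes the two ends of a chord. -/
theorem value_four (hp : IsPaired (P ++ a :: b :: (Q ++ b :: R)) T) :
    value k (P ++ a :: b :: (Q ++ b :: R)) T - value k (P ++ b :: a :: (Q ++ b :: R)) T
      + value k (P ++ b :: (Q ++ a :: b :: R)) T - value k (P ++ b :: (Q ++ b :: a :: R)) T
      = 0 :=
  (wellDefined k _).four_at (WellDefined.wellDefined_and_fourTermHolds k _).2 rfl hp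

end DiagramData

/-! ### Connectedness, anchored diagrams and antisymmetry. -/

namespace DiagramData

variable {k : Type*} [Field k] {L L' P Q R : List ℕ} {T T' : List (ℕ × ℕ × ℕ)} {x a b : ℕ}

/-- The set of edges `S` is a union of connected components, as far as the trivalent vertices
are concerned. -/
def VertClosed (S : ℕ → Prop) (T : List (ℕ × ℕ × ℕ)) : Prop :=
  ∀ v ∈ T, (∀ e ∈ triple v, S e) ∨ (∀ e ∈ triple v, ¬ S e)

/-- Every connected component has a leg. -/
def Anchored (L : List ℕ) (T : List (ℕ × ℕ × ℕ)) : Prop :=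
  ∀ S : ℕ → Prop, VertClosed S T → (∃ e ∈ vertEnds T, S e) → ∃ e ∈ L, S e

/-- The diagram has a leg and it is connected. -/
def IsConnected (L : List ℕ) (T : List (ℕ × ℕ × ℕ)) : Prop :=
  L ≠ [] ∧ ∀ S : ℕ → Prop, VertClosed S T → (∃ e ∈ L ++ vertEnds T, S e) →
    ∀ e ∈ L ++ vertEnds T, S e

theorem vertClosed_iff {S : ℕ → Prop} :
    VertClosed S T ↔ ∀ c ∈ cyc T, (∀ e ∈ c, S e) ∨ (∀ e ∈ c, ¬ S e) := by
  constructor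
  · intro h c hc
    simp only [cyc, Multiset.mem_coe, List.mem_map] at hc
    obtain ⟨v, hv, rfl⟩ := hc
    exact h v hv
  · intro h v hv
    exact h (triple v : Cycle ℕ) (Multiset.mem_coe.mpr (List.mem_map.mpr ⟨v, hv, rfl⟩))

theorem VertClosed.congr {S : ℕ → Prop} (h : VertClosed S T) (hT : cyc T = cyc T') :
    VertClosed S T' := by
  rw [vertClosed_iff] at h ⊢
  rwa [← hT]

theorem vertClosed_cons {S : ℕ → Prop} {v : ℕ × ℕ × ℕ} :
    VertClosed S (v :: T) ↔
      ((S v.1 ∧ S v.2.1 ∧ S v.2.2) ∨ (¬ S v.1 ∧ ¬ S v.2.1 ∧ ¬ S v.2.2)) ∧ VertClosed S T := by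
  simp [VertClosed, triple]

theorem mem_vertEnds_of_mem {v : ℕ × ℕ × ℕ} {e : ℕ} (hv : v ∈ T) (he : e ∈ triple v) :
    e ∈ vertEnds T := List.mem_flatMap.mpr ⟨v, hv, he⟩

theorem vertClosed_congr_pred {S S' : ℕ → Prop} (h : VertClosed S T)
    (hS : ∀ e ∈ vertEnds T, S e ↔ S' e) : VertClosed S' T := by
  intro v hv
  refine (h v hv).imp (fun h e he => ?_) (fun h e he => ?_)
  · exact (hS e (mem_vertEnds_of_mem hv he)).mp (h e he)
  · exact fun h' => h e he ((hS e (mem_vertEnds_of_mem hv he)).mpr h')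

theorem Anchored.congr (h : Anchored L T) (hL : ∀ e, e ∈ L → e ∈ L') (hT : cyc T = cyc T') :
    Anchored L' T' := by
  rintro S hS ⟨e, he, hSe⟩
  obtain ⟨f, hf, hSf⟩ := h S (hS.congr hT.symm) ⟨e, (vertEnds_perm hT).mem_iff.mpr he, hSe⟩
  exact ⟨f, hL f hf, hSf⟩

theorem IsConnected.congr (h : IsConnected L T) (hL : L.Perm L') (hT : cyc T = cyc T') :
    IsConnected L' T' := by
  have hp := hL.append (vertEnds_perm hT)
  refine ⟨fun h0 => h.1 (by rw [h0] at hL; exact hL.eq_nil), ?_⟩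
  rintro S hS ⟨e, he, hSe⟩ f hf
  exact h.2 S (hS.congr hT.symm) ⟨e, hp.mem_iff.mpr he, hSe⟩ f (hp.mem_iff.mpr hf)

theorem IsConnected.anchored (h : IsConnected L T) : Anchored L T := by
  rintro S hS ⟨e, he, hSe⟩
  obtain ⟨f, hf⟩ := List.exists_mem_of_ne_nil _ h.1
  exact ⟨f, hf, h.2 S hS ⟨e, List.mem_append_right _ he, hSe⟩ f (List.mem_append_left _ hf)⟩

/-- A union of components of the resolved diagram that avoids both `a` and `b` is, after discarding
`x`, a union of components of the original one. All others contain the leg `a` or the leg `b`. -/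
theorem Anchored.resolve (hp : IsPaired (P ++ x :: Q) ((x, b, a) :: T))
    (h : Anchored (P ++ x :: Q) ((x, b, a) :: T)) : Anchored (P ++ a :: b :: Q) T := by
  obtain ⟨-, -, hxa, hxb, hxT⟩ := hp.counts
  rintro S hS ⟨e, he, hSe⟩
  by_cases ha : S a
  · exact ⟨a, by simp, ha⟩
  by_cases hb : S b
  · exact ⟨b, by simp, hb⟩
  obtain ⟨f, hf, hSf⟩ := h (fun e => S e ∧ e ≠ x) (by
      rw [vertClosed_cons]
      refine ⟨Or.inr (by simp [ha, hb]), ?_⟩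
      refine vertClosed_congr_pred hS fun e he => ?_
      have : e ≠ x := fun h => hxT (h ▸ he)
      simp [this])
    ⟨e, by simp [he], hSe, fun h => hxT (h ▸ he)⟩
  refine ⟨f, ?_, hSf.1⟩
  have := hSf.2
  simp only [List.mem_append, List.mem_cons] at hf ⊢
  tauto

theorem Anchored.unresolve (h : Anchored (P ++ a :: b :: Q) T) :
    Anchored (P ++ x :: Q) ((x, b, a) :: T) := by
  rintro S hS ⟨e, he, hSe⟩
  rw [vertClosed_cons] at hS
  by_cases hx : S x
  · exact ⟨x, by simp, hx⟩
  obtain ⟨hS1, hS⟩ := hS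
  have hb : ¬ S b := by tauto
  have ha : ¬ S a := by tauto
  simp only [vertEnds_cons, List.mem_cons] at he
  have heT : e ∈ vertEnds T := by
    rcases he with rfl | rfl | rfl | he
    · exact absurd hSe hx
    · exact absurd hSe hb
    · exact absurd hSe ha
    · exact he
  obtain ⟨f, hf, hSf⟩ := h S hS ⟨e, heT, hSe⟩
  refine ⟨f, ?_, hSf⟩
  simp only [List.mem_append, List.mem_cons] at hf ⊢
  rcases hf with hf | rfl | rfl | hf
  · exact Or.inl hf
  · exact absurd hSf ha
  · exact absurd hSf hb
  · exact Or.inr (Or.inr hf)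

/-- This direction, the joining of two legs, never disconnects. It keeps the correction terms of leg
transpositions among connected diagrams. -/
theorem IsConnected.unresolve (h : IsConnected (P ++ a :: b :: Q) T) :
    IsConnected (P ++ x :: Q) ((x, b, a) :: T) := by
  refine ⟨by simp, ?_⟩
  rintro S hS ⟨e, he, hSe⟩
  rw [vertClosed_cons] at hS
  obtain ⟨hS1, hS⟩ := hS
  have key : ∃ e ∈ (P ++ a :: b :: Q) ++ vertEnds T, S e := by
    by_cases hx : S x
    · exact ⟨a, by simp, by tauto⟩
    · have hb : ¬ S b := by tauto
      have ha : ¬ S a := by tauto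
      refine ⟨e, ?_, hSe⟩
      simp only [vertEnds_cons, List.mem_append, List.mem_cons] at he ⊢
      rcases he with (he | rfl | he) | rfl | rfl | rfl | he <;> tauto
  have hall := h.2 S hS key
  have ha : S a := hall a (by simp)
  have hb : S b := hall b (by simp)
  have hx : S x := by tauto
  intro f hf
  simp only [vertEnds_cons, List.mem_append, List.mem_cons] at hf
  rcases hf with (hf | rfl | hf) | rfl | rfl | rfl | hf
  · exact hall f (by simp [hf])
  · exact hx
  · exact hall f (by simp [hf])
  · exact hx
  · exact hb
  · exact ha
  · exact hall f (by simp [hf])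

theorem IsPaired.unresolve (h : IsPaired (P ++ a :: b :: Q) T)
    (hx : x ∉ (P ++ a :: b :: Q) ++ vertEnds T) :
    IsPaired (P ++ x :: Q) ((x, b, a) :: T) := by
  intro e
  have := h e
  by_cases hex : x = e
  · subst hex
    right
    rw [← List.count_eq_zero] at hx
    simp only [List.count_append, List.count_cons, vertEnds_cons, beq_self_eq_true, if_true]
      at hx ⊢
    omega
  · simp only [List.count_append, List.count_cons, vertEnds_cons, beq_iff_eq, if_neg hex]
      at this ⊢
    omega

theorem exists_fresh (L : List ℕ) : ∃ x, x ∉ L := by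
  obtain ⟨x, hx⟩ := Infinite.exists_notMem_finset L.toFinset
  exact ⟨x, by simpa using hx⟩

/-- Transposing two neighbouring legs changes the class by the class of a diagram with one leg
less. -/
theorem exists_value_sub_value_swap (h : IsPaired (P ++ a :: b :: Q) T) :
    ∃ x, x ∉ (P ++ a :: b :: Q) ++ vertEnds T ∧ IsPaired (P ++ x :: Q) ((x, b, a) :: T) ∧
      value k (P ++ a :: b :: Q) T - value k (P ++ b :: a :: Q) T
        = value k (P ++ x :: Q) ((x, b, a) :: T) := by
  obtain ⟨x, hx⟩ := exists_fresh ((P ++ a :: b :: Q) ++ vertEnds T)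
  exact ⟨x, hx, h.unresolve hx, (value_stu (h.unresolve hx) rfl).symm⟩

/-- Induction over the resolutions of diagrams all of whose components have legs. -/
theorem anchored_induction {motive : List ℕ → List (ℕ × ℕ × ℕ) → Prop}
    (chord : ∀ L, IsPaired L [] → motive L [])
    (step : ∀ (P Q : List ℕ) (x b a : ℕ) (T T' : List (ℕ × ℕ × ℕ)),
      IsPaired (P ++ x :: Q) T → Anchored (P ++ x :: Q) T → cyc T = cyc ((x, b, a) :: T') →
      motive (P ++ a :: b :: Q) T' → motive (P ++ b :: a :: Q) T' → motive (P ++ x :: Q) T)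
    (hp : IsPaired L T) (ha : Anchored L T) : motive L T := by
  induction hn : T.length generalizing L T with
  | zero =>
    obtain rfl := List.eq_nil_of_length_eq_zero hn
    exact chord L hp
  | succ n ih =>
    obtain ⟨v, hv⟩ := List.exists_mem_of_ne_nil _ (List.ne_nil_of_length_eq_add_one hn)
    -- All the edges that meet trivalent vertices form a union of components; its leg provides a
    -- vertex to resolve.
    obtain ⟨x, hxL, hxT⟩ := ha (fun e => e ∈ vertEnds T)
      (fun w hw => Or.inl fun e he => mem_vertEnds_of_mem hw he)
      ⟨v.1, mem_vertEnds_of_mem hv (by simp [triple]), mem_vertEnds_of_mem hv (by simp [triple])⟩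
    obtain ⟨a, b, T', hT⟩ := exists_cyc_eq_cons hxT
    obtain ⟨P, Q, rfl⟩ := List.append_of_mem hxL
    have hl := length_eq_of_cyc_eq hT
    have hp' := hp.congr (List.Perm.refl _) hT
    have ha' := (ha.congr (fun _ h => h) hT).resolve hp'
    refine step P Q x b a T T' hp ha hT (ih hp'.resolve ha' (by simpa using hl.symm.trans hn))
      (ih hp'.resolve.swap (ha'.congr ?_ rfl) (by simpa using hl.symm.trans hn))
    intro e he
    simp only [List.mem_append, List.mem_cons] at he ⊢
    tauto

theorem vertEnds_perm_flip (p q r : ℕ) (T : List (ℕ × ℕ × ℕ)) :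
    (vertEnds ((p, q, r) :: T)).Perm (vertEnds ((q, p, r) :: T)) := by
  simp only [vertEnds_cons]
  exact List.Perm.swap _ _ _

theorem IsPaired.flip {p q r : ℕ} {S : List (ℕ × ℕ × ℕ)} (hp : IsPaired L T)
    (h : cyc T = cyc ((p, q, r) :: S)) (h' : cyc T' = cyc ((q, p, r) :: S)) : IsPaired L T' :=
  hp.of_perm (((vertEnds_perm h).trans ((vertEnds_perm_flip p q r S).trans
    (vertEnds_perm h').symm)).append_left L)

/-- Reversing the orientation of a trivalent vertex changes the sign of the class. -/
theorem value_flip (hp : IsPaired L T) (ha : Anchored L T) {p q r : ℕ}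
    {S : List (ℕ × ℕ × ℕ)} (h : cyc T = cyc ((p, q, r) :: S))
    (h' : cyc T' = cyc ((q, p, r) :: S)) : value k L T + value k L T' = 0 := by
  suffices key : ∀ (T' : List (ℕ × ℕ × ℕ)) (p q r : ℕ) (S : List (ℕ × ℕ × ℕ)),
      cyc T = cyc ((p, q, r) :: S) → cyc T' = cyc ((q, p, r) :: S) →
      value k L T + value k L T' = 0 from key T' p q r S h h'
  clear h h'
  refine anchored_induction (motive := fun L T => ∀ (T' : List (ℕ × ℕ × ℕ)) (p q r : ℕ)
    (S : List (ℕ × ℕ × ℕ)), cyc T = cyc ((p, q, r) :: S) → cyc T' = cyc ((q, p, r) :: S) →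
    value k L T + value k L T' = 0) ?_ ?_ hp ha
  · intro L _ T' p q r S h
    simpa using congrArg Multiset.card h
  · intro P Q x b a T T₁ hp ha hT ih₁ ih₂ T' p q r S h h'
    have hp' := hp.flip h h'
    have hTS : cyc ((x, b, a) :: T₁) = cyc ((p, q, r) :: S) := hT.symm.trans h
    rw [value_stu hp hT]
    -- If the reversed vertex is the resolved one, the two resolved diagrams change places.
    -- Otherwise reversal commutes with the resolution, and the induction hypotheses apply.
    by_cases hv : (([x, b, a] : List ℕ) : Cycle ℕ) = ([p, q, r] : List ℕ)
    · have hS : cyc T₁ = cyc S := by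
        rw [cyc_cons, cyc_cons] at hTS
        simp only [triple, hv] at hTS
        exact (Multiset.cons_inj_right _).mp hTS
      have hT' : cyc T' = cyc ((x, a, b) :: T₁) := by
        rw [h']
        rcases Cycle.coe_triple_eq hv with ⟨rfl, rfl, rfl⟩ | ⟨rfl, rfl, rfl⟩ | ⟨rfl, rfl, rfl⟩
        · rw [cyc_rotate_left, cyc_cons, cyc_cons, hS]
        · rw [cyc_rotate_right, cyc_cons, cyc_cons, hS]
        · rw [cyc_cons, cyc_cons, hS]
      rw [value_stu hp' hT']
      abel
    · rw [cyc_cons, cyc_cons] at hTS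
      rcases Multiset.cons_eq_cons.mp hTS with h1 | ⟨-, s, hs, hs'⟩
      · exact absurd h1.1 hv
      obtain ⟨v, S', -, -, hS'⟩ := exists_perm_cons_of_cyc_eq hs
      have e1 : cyc T₁ = cyc ((p, q, r) :: S') := by rw [hs, cyc_cons, hS']
      have e2 : cyc T' = cyc ((x, b, a) :: (q, p, r) :: S') := by
        rw [h', cyc_cons, hs', cyc_cons, cyc_cons, hS', Multiset.cons_swap]
      rw [value_stu hp' e2]
      have i1 := ih₁ ((q, p, r) :: S') p q r S' e1 rfl
      have i2 := ih₂ ((q, p, r) :: S') p q r S' e1 rfl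
      linear_combination (norm := abel) i1 - i2

/-! ### Comparison with Feynman diagrams -/

theorem pred_of_adjacent {D : DiagramData} {E : Finset ℕ} {S : ℕ → Prop}
    (hS : VertClosed S D.verts) {e f : ℕ} (h : D.Adjacent E e f) (he : S e) : S f := by
  obtain ⟨-, -, (i | j), h1, h2⟩ := h
  · simp only [edgesAt, List.mem_singleton] at h1 h2
    rwa [h2, ← h1]
  · rcases hS _ (List.get_mem D.verts j) with h | h
    · exact h f h2
    · exact absurd he (h e h1)

theorem pred_of_reflTransGen {D : DiagramData} {E : Finset ℕ} {S : ℕ → Prop}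
    (hS : VertClosed S D.verts) {e f : ℕ} (h : Relation.ReflTransGen (D.Adjacent E) e f)
    (he : S e) : S f := by
  induction h with
  | refl => exact he
  | tail _ h ih => exact pred_of_adjacent hS h ih

theorem vertClosed_reachable (D : DiagramData) (e : ℕ) :
    VertClosed (fun f => Relation.ReflTransGen (D.Adjacent D.edges) e f) D.verts := by
  intro v hv
  by_cases h : ∃ f ∈ triple v, Relation.ReflTransGen (D.Adjacent D.edges) e f
  · obtain ⟨f, hf, hr⟩ := h
    obtain ⟨j, rfl⟩ := List.get_of_mem hv
    have hm : ∀ c ∈ triple (D.verts.get j), c ∈ D.edges := fun c hc => by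
      rw [edges, List.mem_toFinset, ends]
      exact List.mem_append_right _ (mem_vertEnds_of_mem hv hc)
    exact Or.inl fun c hc => hr.tail ⟨hm f hf, hm c hc, Sum.inr j, hf, hc⟩
  · push Not at h
    exact Or.inr h

theorem _root_.FeynmanDiagram.isPaired (F : FeynmanDiagram) : IsPaired F.legs F.verts := by
  intro e
  by_cases he : e ∈ F.ends
  · right
    have := F.two e he
    rwa [ends, List.count_append] at this
  · left
    rw [← List.count_eq_zero, ends, List.count_append] at he
    exact he

theorem _root_.FeynmanDiagram.isAnchored (F : FeynmanDiagram) : Anchored F.legs F.verts := by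
  rintro S hS ⟨e, he, hSe⟩
  obtain ⟨f, hf, h⟩ := F.anchored e (by
    rw [edges, List.mem_toFinset, ends]; exact List.mem_append_right _ he)
  exact ⟨f, hf, pred_of_reflTransGen hS h hSe⟩

/-- The Feynman diagram with legs `L` and trivalent vertices `T`. -/
def toFeynmanDiagram (L : List ℕ) (T : List (ℕ × ℕ × ℕ)) (hp : IsPaired L T)
    (ha : Anchored L T) : FeynmanDiagram where
  legs := L
  verts := T
  two := by
    intro e he
    have h1 := hp e
    have h2 := List.count_pos_iff.mpr he
    simp only [ends, List.count_append] at h2 ⊢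
    unfold vertEnds at h1
    omega
  anchored := by
    intro e he
    rw [edges, List.mem_toFinset, ends, List.mem_append] at he
    rcases he with he | he
    · exact ⟨e, he, Relation.ReflTransGen.refl⟩
    · exact ha _ (vertClosed_reachable ⟨L, T⟩ e) ⟨e, he, Relation.ReflTransGen.refl⟩

theorem connected_of_isConnected {D : DiagramData} (h : IsConnected D.legs D.verts) :
    D.Connected := by
  obtain ⟨f, hf⟩ := List.exists_mem_of_ne_nil _ h.1
  have hm : ∀ e, e ∈ D.edges ↔ e ∈ D.legs ++ vertEnds D.verts := fun e => by
    rw [edges, List.mem_toFinset, ends]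
    rfl
  refine ⟨⟨f, (hm f).mpr (List.mem_append_left _ hf)⟩, fun e he g hg => ?_⟩
  exact h.2 _ (vertClosed_reachable D e) ⟨e, (hm e).mp he, Relation.ReflTransGen.refl⟩ g
    ((hm g).mp hg)

theorem cls_toFeynmanDiagram_congr (hp : IsPaired L T) (ha : Anchored L T)
    (hp' : IsPaired L' T') (ha' : Anchored L' T') (hL : L ~r L') (hT : cyc T = cyc T') :
    (toFeynmanDiagram L T hp ha).cls k = (toFeynmanDiagram L' T' hp' ha').cls k := by
  refine FeynmanDiagram.cls_eq_of_iso k ⟨1, by rwa [map_perm_one], ?_⟩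
  have h := cyc_mapVerts (1 : Equiv.Perm ℕ) T
  rw [mapVerts_one] at h
  exact h.symm.trans hT

/-- The class of a Feynman diagram in `𝒜` is represented by this diagram. -/
theorem chordToFeynman_value (hp : IsPaired L T) (ha : Anchored L T) :
    chordToFeynman k (value k L T) = (toFeynmanDiagram L T hp ha).cls k := by
  have key : ∀ (hp : IsPaired L T) (ha : Anchored L T),
      chordToFeynman k (value k L T) = (toFeynmanDiagram L T hp ha).cls k := by
    refine anchored_induction (motive := fun L T => ∀ (hp : IsPaired L T) (ha : Anchored L T),
      chordToFeynman k (value k L T) = (toFeynmanDiagram L T hp ha).cls k) ?_ ?_ hp ha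
    · intro L _ hp ha
      rw [value_chord hp.chord, ChordDiagram.cls, chordToFeynman, Submodule.mkQ_apply,
        Submodule.liftQ_apply, Finsupp.linearCombination_single, one_smul]
      rfl
    · intro P Q x b a T T' _ _ hT ih₁ ih₂ hp ha
      have q := hp.congr (List.Perm.refl _) hT
      have q₁ := q.resolve
      have a₀ := ha.congr (fun _ h => h) hT
      have a₁ := a₀.resolve q
      have a₂ : Anchored (P ++ b :: a :: Q) T' := a₁.congr (fun e he => by
        simp only [List.mem_append, List.mem_cons] at he ⊢; tauto) rfl
      have rot : ∀ A B : List ℕ, ∀ e, e ∈ A ++ B → e ∈ B ++ A := fun A B e he => by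
        simp only [List.mem_append] at he ⊢; tauto
      -- The relation among Feynman diagrams is stated for the first leg, so all three diagrams are
      -- rotated accordingly.
      rw [value_stu hp hT, map_sub, ih₁ q₁ a₁, ih₂ q₁.swap a₂,
        cls_toFeynmanDiagram_congr hp ha (q.congr List.perm_append_comm rfl)
          (a₀.congr (rot _ _) rfl) List.isRotated_append hT,
        cls_toFeynmanDiagram_congr q₁ a₁ (q₁.congr List.perm_append_comm rfl)
          (a₁.congr (rot _ _) rfl) List.isRotated_append rfl,
        cls_toFeynmanDiagram_congr q₁.swap a₂ (q₁.swap.congr List.perm_append_comm rfl)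
          (a₂.congr (rot _ _) rfl) List.isRotated_append rfl]
      exact (FeynmanDiagram.cls_threeTerm k
        ⟨x, a, b, Q ++ P, T', ⟨rfl, rfl⟩, ⟨rfl, rfl⟩, ⟨rfl, rfl⟩⟩).symm
  exact key hp ha

end DiagramData

/-! ### The coproduct of a diagram. -/

namespace DiagramData

variable {k : Type*} [Field k] {L L' P Q R : List ℕ} {T T' : List (ℕ × ℕ × ℕ)} {x a b : ℕ}

/-- The trivalent vertices all of whose edges satisfy `p`. -/
def keepVerts (p : ℕ → Bool) (T : List (ℕ × ℕ × ℕ)) : List (ℕ × ℕ × ℕ) :=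
  T.filter fun v => p v.1 && p v.2.1 && p v.2.2

/-- The class of the part of a diagram that consists of the edges satisfying `p`. -/
noncomputable def part (k : Type*) [Field k] (p : ℕ → Bool) (L : List ℕ)
    (T : List (ℕ × ℕ × ℕ)) : ChordSpace k := value k (L.filter p) (keepVerts p T)

theorem cyc_keepVerts (p : ℕ → Bool) (T : List (ℕ × ℕ × ℕ)) :
    cyc (keepVerts p T) = (cyc T).filter fun c => ∀ e ∈ c.toMultiset, p e := by
  induction T with
  | nil => rfl
  | cons v T ih =>
    rw [cyc_cons, Multiset.filter_cons, ← ih, keepVerts, List.filter_cons]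
    by_cases h : p v.1 ∧ p v.2.1 ∧ p v.2.2
    · rw [if_pos (by simp [h]), if_pos (by simpa [triple] using h), cyc_cons]
      rfl
    · rw [if_neg (by simpa [and_assoc] using h), if_neg (by simpa [triple] using h), zero_add]
      rfl

theorem cyc_keepVerts_congr (p : ℕ → Bool) (hT : cyc T = cyc T') :
    cyc (keepVerts p T) = cyc (keepVerts p T') := by
  rw [cyc_keepVerts, cyc_keepVerts, hT]

theorem vertEnds_keepVerts {p : ℕ → Bool} (h : VertClosed (fun e => p e) T) :
    vertEnds (keepVerts p T) = (vertEnds T).filter p := by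
  induction T with
  | nil => rfl
  | cons v T ih =>
    rw [vertClosed_cons] at h
    have ih := ih h.2
    rw [keepVerts] at ih ⊢
    rcases h.1 with h | h
    · simp [h, ih]
    · simp [h, ih]

theorem IsPaired.keep {p : ℕ → Bool} (hp : IsPaired L T) (h : VertClosed (fun e => p e) T) :
    IsPaired (L.filter p) (keepVerts p T) := by
  intro e
  rw [vertEnds_keepVerts h]
  by_cases he : p e
  · rw [List.count_filter he, List.count_filter he]
    exact hp e
  · left
    simp [List.count_eq_zero, List.mem_filter, he]

theorem VertClosed.compl {S : ℕ → Prop} (h : VertClosed S T) : VertClosed (fun e => ¬ S e) T :=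
  fun v hv => (h v hv).symm.imp id fun h e he => not_not.mpr (h e he)

theorem VertClosed.not {p : ℕ → Bool} (h : VertClosed (fun e => p e) T) :
    VertClosed (fun e => (!p e) = true) T := by
  simpa using h.compl

theorem Anchored.keep {p : ℕ → Bool} (ha : Anchored L T) (h : VertClosed (fun e => p e) T) :
    Anchored (L.filter p) (keepVerts p T) := by
  rintro S hS ⟨e, he, hSe⟩
  rw [vertEnds_keepVerts h, List.mem_filter] at he
  obtain ⟨f, hf, hSf⟩ := ha (fun e => S e ∧ p e) (by
      intro v hv
      rcases h v hv with h | h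
      · refine (hS v ?_).imp (fun h' e he => ⟨h' e he, h e he⟩) (fun h' e he hc => h' e he hc.1)
        rw [keepVerts, List.mem_filter]
        simp only [triple, List.mem_cons, List.not_mem_nil, or_false, forall_eq_or_imp,
          forall_eq] at h
        exact ⟨hv, by simp [h]⟩
      · exact Or.inr fun e he hc => h e he hc.2)
    ⟨e, he.1, hSe, he.2⟩
  exact ⟨f, List.mem_filter.mpr ⟨hf, hSf.2⟩, hSf.1⟩

theorem keepVerts_congr {p q : ℕ → Bool} (h : ∀ e ∈ vertEnds T, p e = q e) :
    keepVerts p T = keepVerts q T := by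
  refine List.filter_congr fun v hv => ?_
  have hm : ∀ e ∈ triple v, p e = q e := fun e he => h e (mem_vertEnds_of_mem hv he)
  rw [hm v.1 (by simp [triple]), hm v.2.1 (by simp [triple]), hm v.2.2 (by simp [triple])]

theorem part_congr {p q : ℕ → Bool} (h : ∀ e ∈ L ++ vertEnds T, p e = q e) :
    part k p L T = part k q L T := by
  rw [part, part, keepVerts_congr fun e he => h e (List.mem_append_right _ he),
    List.filter_congr fun e he => h e (List.mem_append_left _ he)]

theorem part_congr_verts {p : ℕ → Bool} (hp : IsPaired L T) (h : VertClosed (fun e => p e) T)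
    (hT : cyc T = cyc T') : part k p L T = part k p L T' :=
  value_congr_verts (hp.keep h) (cyc_keepVerts_congr p hT)

theorem part_stu {p : ℕ → Bool} (hp : IsPaired (P ++ x :: Q) ((x, b, a) :: T))
    (h : VertClosed (fun e => p e) ((x, b, a) :: T)) (hx : p x = true) :
    part k p (P ++ x :: Q) ((x, b, a) :: T)
      = part k p (P ++ a :: b :: Q) T - part k p (P ++ b :: a :: Q) T := by
  have hk := hp.keep h
  rw [vertClosed_cons] at h
  have hb : p b = true := by have := h.1; simp only at this; tauto
  have ha : p a = true := by have := h.1; simp only at this; tauto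
  have e1 : keepVerts p ((x, b, a) :: T) = (x, b, a) :: keepVerts p T := by
    simp [keepVerts, hx, ha, hb]
  rw [e1] at hk
  simp only [part, e1, List.filter_append, List.filter_cons, hx, ha, hb, if_true] at hk ⊢
  exact value_stu hk rfl

theorem part_of_not {p : ℕ → Bool} (hx : p x = false) (ha : p a = false) (hb : p b = false) :
    part k p (P ++ x :: Q) ((x, b, a) :: T) = part k p (P ++ a :: b :: Q) T ∧
      part k p (P ++ x :: Q) ((x, b, a) :: T) = part k p (P ++ b :: a :: Q) T := by
  simp [part, keepVerts, hx, ha, hb]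

theorem part_swap {p : ℕ → Bool} (h : p a = false ∨ p b = false) :
    part k p (P ++ a :: b :: Q) T = part k p (P ++ b :: a :: Q) T := by
  rcases h with h | h <;> simp [part, List.filter_cons, h]

/-- The term of the coproduct that belongs to the set of edges `p`. -/
noncomputable def splitting (k : Type*) [Field k] (p : ℕ → Bool) (L : List ℕ)
    (T : List (ℕ × ℕ × ℕ)) : ChordSpace k ⊗[k] ChordSpace k :=
  part k p L T ⊗ₜ[k] part k (fun e => !p e) L T

theorem splitting_congr {p q : ℕ → Bool} (h : ∀ e ∈ L ++ vertEnds T, p e = q e) :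
    splitting k p L T = splitting k q L T := by
  rw [splitting, splitting, part_congr h, part_congr fun e he => congrArg (fun t => !t) (h e he)]

/-- The vertex lies in exactly one of the two factors. The three-term relation holds there, and the
other factor does not see `x`, `a` and `b`. -/
theorem splitting_stu {p : ℕ → Bool} (hp : IsPaired (P ++ x :: Q) ((x, b, a) :: T))
    (h : VertClosed (fun e => p e) ((x, b, a) :: T)) :
    splitting k p (P ++ x :: Q) ((x, b, a) :: T)
      = splitting k p (P ++ a :: b :: Q) T - splitting k p (P ++ b :: a :: Q) T := by
  have hc := (vertClosed_cons.mp h).1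
  dsimp only at hc
  rcases hc with hc | hc
  · have hn := part_of_not (k := k) (p := fun e => !p e) (P := P) (Q := Q) (T := T)
      (x := x) (a := a) (b := b) (by simp [hc]) (by simp [hc]) (by simp [hc])
    simp only [splitting]
    rw [part_stu hp h hc.1, TensorProduct.sub_tmul, ← hn.1, ← hn.2]
  · have hn := part_of_not (k := k) (p := p) (P := P) (Q := Q) (T := T)
      (x := x) (a := a) (b := b) (by simpa using hc.1) (by simpa using hc.2.2)
      (by simpa using hc.2.1)
    simp only [splitting]
    rw [part_stu (p := fun e => !p e) hp h.not (by simpa using hc.1), TensorProduct.tmul_sub,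
      ← hn.1, ← hn.2]

/-- The two legs lie in different factors, so neither factor sees their relative order. -/
theorem splitting_swap {p : ℕ → Bool} (h : p a ≠ p b) :
    splitting k p (P ++ a :: b :: Q) T = splitting k p (P ++ b :: a :: Q) T := by
  have h1 : p a = false ∨ p b = false := by
    cases ha : p a <;> cases hb : p b <;> simp_all
  have h2 : (!p a) = false ∨ (!p b) = false := by
    cases ha : p a <;> cases hb : p b <;> simp_all
  rw [splitting, splitting, part_swap h1, part_swap (p := fun e => !p e) h2]

open Classical in
/-- The unions of connected components of a diagram. -/
noncomputable def closedSets (L : List ℕ) (T : List (ℕ × ℕ × ℕ)) : Finset (Finset ℕ) :=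
  (L ++ vertEnds T).toFinset.powerset.filter fun E => VertClosed (· ∈ E) T

theorem mem_closedSets {E : Finset ℕ} :
    E ∈ closedSets L T ↔ (∀ e ∈ E, e ∈ L ++ vertEnds T) ∧ VertClosed (· ∈ E) T := by
  simp only [closedSets, Finset.mem_filter, Finset.mem_powerset, Finset.subset_iff,
    List.mem_toFinset]

theorem closedSets_congr (hL : L.Perm L') (hT : cyc T = cyc T') :
    closedSets L T = closedSets L' T' := by
  ext E
  rw [mem_closedSets, mem_closedSets]
  have := hL.append (vertEnds_perm hT)
  constructor
  · exact fun h => ⟨fun e he => this.mem_iff.mp (h.1 e he), h.2.congr hT⟩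
  · exact fun h => ⟨fun e he => this.mem_iff.mpr (h.1 e he), h.2.congr hT.symm⟩

theorem closedSets_swap :
    closedSets (P ++ b :: a :: Q) T = closedSets (P ++ a :: b :: Q) T :=
  closedSets_congr ((List.Perm.swap a b Q).append_left P) rfl

/-- Deleting the edge `x` from a union of components. -/
theorem erase_mem_closedSets (hp : IsPaired (P ++ x :: Q) ((x, b, a) :: T)) {E : Finset ℕ}
    (hE : E ∈ closedSets (P ++ x :: Q) ((x, b, a) :: T)) :
    E.erase x ∈ closedSets (P ++ a :: b :: Q) T ∧ (a ∈ E.erase x ↔ b ∈ E.erase x) ∧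
      (x ∈ E ↔ a ∈ E.erase x) := by
  obtain ⟨-, -, hxa, hxb, hxT⟩ := hp.counts
  rw [mem_closedSets, vertClosed_cons] at hE
  obtain ⟨h1, h2, h3⟩ := hE
  dsimp only at h2
  rw [mem_closedSets]
  refine ⟨⟨fun e he => ?_, vertClosed_congr_pred h3 fun e he => ?_⟩, ?_, ?_⟩
  · obtain ⟨h, h'⟩ := Finset.mem_erase.mp he
    have := h1 e h'
    simp only [vertEnds_cons, List.mem_append, List.mem_cons] at this ⊢
    tauto
  · have : e ≠ x := fun h => hxT (h ▸ he)
    simp [this]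
  · simp only [Finset.mem_erase, ne_eq, hxa.symm, hxb.symm, not_false_eq_true, true_and]
    tauto
  · simp only [Finset.mem_erase, ne_eq, hxa.symm, not_false_eq_true, true_and]
    tauto

/-- The coproduct of a diagram is the sum over all ways to distribute its connected components. -/
theorem chordComul_value (hp : IsPaired L T) (ha : Anchored L T) :
    chordComul k (value k L T)
      = ∑ E ∈ closedSets L T, splitting k (fun e => decide (e ∈ E)) L T := by
  refine anchored_induction (motive := fun L T => chordComul k (value k L T)
      = ∑ E ∈ closedSets L T, splitting k (fun e => decide (e ∈ E)) L T) ?_ ?_ hp ha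
  · intro L hp
    rw [value_chord hp.chord, ChordDiagram.cls, chordComul, Submodule.mkQ_apply,
      Submodule.liftQ_apply, Finsupp.linearCombination_single, one_smul, ChordDiagram.comul]
    have hc : closedSets L [] = (ChordDiagram.chords ⟨L, hp.chord⟩).powerset := by
      ext E
      simp [mem_closedSets, ChordDiagram.chords, VertClosed, Finset.subset_iff]
    rw [hc]
    refine Finset.sum_congr rfl fun E hE => ?_
    have hcl : VertClosed (fun e => (fun e => decide (e ∈ E)) e = true) [] := by
      simp [VertClosed]
    have q1 := hp.keep hcl
    have q2 := hp.keep hcl.not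
    simp only [splitting, part]
    have k0 : ∀ p, keepVerts p [] = [] := fun p => rfl
    rw [k0] at q1 q2 ⊢
    rw [k0, value_chord q1.chord, value_chord q2.chord]
    congr 2
    rw [ChordDiagram.ext_iff]
    refine List.filter_congr fun e he => ?_
    simp [ChordDiagram.chords, he]
  · intro P Q x b a T T' hp ha hT ih₁ ih₂
    have q := hp.congr (List.Perm.refl _) hT
    obtain ⟨-, -, hxa, hxb, hxT⟩ := q.counts
    have hx : x ∉ P ∧ x ∉ Q := ⟨q.counts.1, q.counts.2.1⟩
    rw [value_stu hp hT, map_sub, ih₁, ih₂, closedSets_swap (a := a) (b := b), ← Finset.sum_sub_distrib,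
      closedSets_congr (List.Perm.refl _) hT]
    have e1 : ∀ E ∈ closedSets (P ++ x :: Q) ((x, b, a) :: T'),
        splitting k (fun e => decide (e ∈ E)) (P ++ x :: Q) T
          = splitting k (fun e => decide (e ∈ E)) (P ++ x :: Q) ((x, b, a) :: T') := by
      intro E hE
      have hE' : VertClosed (fun e => (fun e => decide (e ∈ E)) e = true) T := by
        simpa using (mem_closedSets.mp hE).2.congr hT.symm
      simp only [splitting]
      rw [part_congr_verts hp hE' hT, part_congr_verts hp hE'.not hT]
    -- Sets that separate `a` from `b` contribute nothing to the difference of the two resolved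
    -- sums, by `splitting_swap`. The others correspond to the unions of components of the
    -- unresolved diagram.
    rw [Finset.sum_congr rfl e1, ← Finset.sum_filter_of_ne (s := closedSets (P ++ a :: b :: Q) T')
      (p := fun E => a ∈ E ↔ b ∈ E)]
    · symm
      -- The edge `x` belongs to a union of components exactly when `a` does, which determines the
      -- inverse map.
      refine Finset.sum_bij' (fun E _ => E.erase x) (fun E _ => if a ∈ E then insert x E else E)
        ?_ ?_ ?_ ?_ ?_
      · intro E hE
        rw [Finset.mem_filter]
        exact ⟨(erase_mem_closedSets q hE).1, (erase_mem_closedSets q hE).2.1⟩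
      · intro E hE
        rw [Finset.mem_filter, mem_closedSets] at hE
        obtain ⟨⟨h1, h2⟩, h3⟩ := hE
        have hsub : ∀ e ∈ E, e ∈ P ++ x :: Q ++ vertEnds ((x, b, a) :: T') := by
          intro e he
          have := h1 e he
          simp only [vertEnds_cons, List.mem_append, List.mem_cons] at this ⊢
          tauto
        have hxE : x ∉ E := by
          intro h
          have := h1 x h
          simp only [List.mem_append, List.mem_cons] at this
          tauto
        rw [mem_closedSets, vertClosed_cons]
        split_ifs with haE
        · refine ⟨fun e he => ?_, Or.inl ?_, vertClosed_congr_pred h2 fun e he => ?_⟩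
          · rcases Finset.mem_insert.mp he with rfl | he
            · simp
            · exact hsub e he
          · simp [haE, h3.mp haE]
          · have : e ≠ x := fun h => hxT (h ▸ he)
            simp [this]
        · exact ⟨hsub, Or.inr ⟨hxE, fun h => haE (h3.mpr h), haE⟩, h2⟩
      · intro E hE
        have h := (erase_mem_closedSets q hE).2.2
        split_ifs with hc
        · exact Finset.insert_erase (h.mpr hc)
        · exact Finset.erase_eq_of_notMem fun hx => hc (h.mp hx)
      · intro E hE
        rw [Finset.mem_filter, mem_closedSets] at hE
        have hxE : x ∉ E := by
          intro h
          have := hE.1.1 x h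
          simp only [List.mem_append, List.mem_cons] at this
          tauto
        split_ifs with hc
        · exact Finset.erase_insert hxE
        · exact Finset.erase_eq_of_notMem hxE
      · intro E hE
        have hE' := (mem_closedSets.mp hE).2
        rw [splitting_stu (p := fun e => decide (e ∈ E)) q (by simpa using hE')]
        have hc : ∀ e ∈ P ++ a :: b :: Q ++ vertEnds T',
            decide (e ∈ E) = decide (e ∈ E.erase x) := by
          intro e he
          have : e ≠ x := by
            rintro rfl
            simp only [List.mem_append, List.mem_cons] at he
            tauto
          simp [this]
        rw [splitting_congr hc, splitting_congr (L := P ++ b :: a :: Q) fun e he => hc e (by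
          simp only [List.mem_append, List.mem_cons] at he ⊢; tauto)]
    · intro E _ hne
      by_contra hab
      refine hne (sub_eq_zero.mpr (splitting_swap ?_))
      intro h
      exact hab (by simpa using h)

theorem value_empty : value k [] [] = ChordDiagram.empty.cls k := value_chord _

theorem part_eq_empty {p : ℕ → Bool} (h : ∀ e ∈ L ++ vertEnds T, p e = false) :
    part k p L T = ChordDiagram.empty.cls k := by
  rw [part_congr (q := fun _ => false) h, ← value_empty]
  simp [part, keepVerts]

theorem part_eq_value {p : ℕ → Bool} (h : ∀ e ∈ L ++ vertEnds T, p e = true) :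
    part k p L T = value k L T := by
  rw [part_congr (q := fun _ => true) h]
  simp [part, keepVerts]

theorem empty_mem_closedSets : ∅ ∈ closedSets L T := by
  simp [mem_closedSets, VertClosed]

theorem edges_mem_closedSets : (L ++ vertEnds T).toFinset ∈ closedSets L T := by
  rw [mem_closedSets]
  refine ⟨fun e he => List.mem_toFinset.mp he, fun v hv => Or.inl fun e he => List.mem_toFinset.mpr ?_⟩
  exact List.mem_append_right _ (mem_vertEnds_of_mem hv he)

theorem IsConnected.closedSets_eq (h : IsConnected L T) :
    closedSets L T = {∅, (L ++ vertEnds T).toFinset} := by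
  ext E
  rw [Finset.mem_insert, Finset.mem_singleton]
  constructor
  · intro hE
    rw [mem_closedSets] at hE
    rcases E.eq_empty_or_nonempty with h0 | ⟨e, he⟩
    · exact Or.inl h0
    · right
      ext f
      rw [List.mem_toFinset]
      exact ⟨hE.1 f, h.2 _ hE.2 ⟨e, hE.1 e he, he⟩ f⟩
  · rintro (rfl | rfl)
    · exact empty_mem_closedSets
    · exact edges_mem_closedSets

/-- Connected diagrams are primitive. -/
theorem value_mem_primitives (hp : IsPaired L T) (h : IsConnected L T) :
    value k L T ∈ primitives k := by
  change chordComul k (value k L T) = _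
  have hne : (∅ : Finset ℕ) ≠ (L ++ vertEnds T).toFinset := by
    intro h0
    have : L ++ vertEnds T = [] := by rwa [eq_comm, List.toFinset_eq_empty_iff] at h0
    exact h.1 (List.append_eq_nil_iff.mp this).1
  rw [chordComul_value hp h.anchored, h.closedSets_eq, Finset.sum_pair hne, splitting, splitting,
    part_eq_empty (by simp), part_eq_value (by simp),
    part_eq_value (p := fun e => decide (e ∈ (L ++ vertEnds T).toFinset))
      (fun e he => decide_eq_true (List.mem_toFinset.mpr he)),
    part_eq_empty (p := fun e => !decide (e ∈ (L ++ vertEnds T).toFinset))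
      (fun e he => by rw [decide_eq_true (List.mem_toFinset.mpr he)]; rfl)]

end DiagramData

/-! ### The commutative product of `𝒜` and the operator `adams`. -/

namespace DiagramData

variable {k : Type*} [Field k] {L L' P Q R : List ℕ} {T T' : List (ℕ × ℕ × ℕ)} {x a b : ℕ}

/-- Isomorphisms are given by permutations of all names, whereas convenient renamings are injective
only on the finitely many edges of a diagram. -/
theorem exists_perm_eqOn (s : Finset ℕ) (f : ℕ → ℕ) (hf : Set.InjOn f s) :
    ∃ π : Equiv.Perm ℕ, ∀ e ∈ s, π e = f e := by
  classical
  let e := Equiv.Set.imageOfInjOn f (s : Set ℕ) hf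
  have : Finite {x | x ∈ (s : Set ℕ)} := s.finite_toSet
  refine ⟨Equiv.extendSubtype (p := (· ∈ (s : Set ℕ))) (q := (· ∈ f '' (s : Set ℕ))) e,
    fun c hc => ?_⟩
  rw [Equiv.extendSubtype_apply_of_mem _ _ hc]
  rfl

theorem mapVerts_congr {f g : ℕ → ℕ} (h : ∀ e ∈ vertEnds T, f e = g e) :
    mapVerts f T = mapVerts g T := by
  refine List.map_congr_left fun v hv => ?_
  have hm : ∀ e ∈ triple v, f e = g e := fun e he => h e (mem_vertEnds_of_mem hv he)
  rw [hm v.1 (by simp [triple]), hm v.2.1 (by simp [triple]), hm v.2.2 (by simp [triple])]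

/-- The class of a diagram does not depend on the names of the edges. -/
theorem value_rename {f : ℕ → ℕ} (hp : IsPaired L T)
    (hf : Set.InjOn f {e | e ∈ L ++ vertEnds T}) :
    value k (L.map f) (mapVerts f T) = value k L T := by
  obtain ⟨π, hπ⟩ := exists_perm_eqOn (L ++ vertEnds T).toFinset f (by
    simpa only [List.coe_toFinset] using hf)
  have h1 : L.map f = L.map π := List.map_congr_left fun e he =>
    (hπ e (List.mem_toFinset.mpr (List.mem_append_left _ he))).symm
  have h2 : mapVerts f T = mapVerts π T := mapVerts_congr fun e he =>
    (hπ e (List.mem_toFinset.mpr (List.mem_append_right _ he))).symm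
  rw [h1, h2]
  exact (value_iso π hp (List.IsRotated.refl _) rfl).symm

/-! ### Closed words commute with everything -/

/-- The sum of the differences that occur when the leg `a` passes the legs `c` in `W`. -/
noncomputable def passing (k : Type*) [Field k] (T : List (ℕ × ℕ × ℕ)) (R : List ℕ) (a c : ℕ) :
    List ℕ → List ℕ → ChordSpace k
  | _, [] => 0
  | U, d :: W => (if d = c then
      value k (U ++ a :: d :: (W ++ R)) T - value k (U ++ d :: a :: (W ++ R)) T else 0)
      + passing k T R a c (U ++ [d]) W

/-- Carrying `a` across `W` is a telescoping sum over the letters of `W`. Here its terms are grouped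
by the names of these letters. -/
theorem sum_passing (s : Finset ℕ) (U W : List ℕ) (h : ∀ c ∈ W, c ∈ s) :
    ∑ c ∈ s, passing k T R a c U W
      = value k (U ++ a :: (W ++ R)) T - value k (U ++ W ++ a :: R) T := by
  induction W generalizing U with
  | nil => simp [passing]
  | cons d W ih =>
    have hd : d ∈ s := h d (by simp)
    simp only [passing, Finset.sum_add_distrib, Finset.sum_ite_eq, if_pos hd]
    rw [ih _ fun c hc => h c (by simp [hc])]
    simp

theorem passing_append_of_notMem {c : ℕ} {V : List ℕ} (hc : c ∉ V) (U W : List ℕ) :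
    passing k T R a c U (V ++ W) = passing k T R a c (U ++ V) W := by
  induction V generalizing U with
  | nil => simp
  | cons d V ih =>
    simp only [List.mem_cons, not_or] at hc
    rw [List.cons_append, passing, if_neg (Ne.symm hc.1), zero_add, ih hc.2]
    simp

theorem passing_of_notMem {c : ℕ} {V : List ℕ} (hc : c ∉ V) (U : List ℕ) :
    passing k T R a c U V = 0 := by
  have := passing_append_of_notMem (k := k) (T := T) (R := R) (a := a) hc U []
  rw [List.append_nil] at this
  rw [this, passing]

theorem exists_split_of_count_eq_two {W : List ℕ} {c : ℕ} (h : W.count c = 2) :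
    ∃ A B C, W = A ++ c :: (B ++ c :: C) ∧ c ∉ A ∧ c ∉ B ∧ c ∉ C := by
  have hc : c ∈ W := List.count_pos_iff.mp (by omega)
  obtain ⟨A, V, rfl, hA⟩ := List.eq_append_cons_of_mem hc
  have hV : V.count c = 1 := by
    simp only [List.count_append, List.count_cons, beq_self_eq_true, if_true,
      List.count_eq_zero.mpr hA] at h
    omega
  obtain ⟨B, C, rfl, hB⟩ := List.eq_append_cons_of_mem (List.count_pos_iff.mp (by omega : 0 < V.count c))
  refine ⟨A, B, C, rfl, hA, hB, ?_⟩
  simp only [List.count_append, List.count_cons, beq_self_eq_true, if_true,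
    List.count_eq_zero.mpr hB] at hV
  rw [← List.count_eq_zero]
  omega

/-- The two steps in which `a` passes the two ends of one chord of `W` add up to a four-term
relation, so each group of the telescoping sum vanishes. -/
theorem value_letter_comm {W : List ℕ} (hW : ∀ c ∈ W, W.count c = 2)
    (hp : IsPaired (P ++ a :: (W ++ R)) T) :
    value k (P ++ a :: (W ++ R)) T = value k (P ++ W ++ a :: R) T := by
  rw [← sub_eq_zero, ← sum_passing (k := k) W.toFinset P W (fun c hc => List.mem_toFinset.mpr hc)]
  refine Finset.sum_eq_zero fun c hc => ?_
  obtain ⟨A, B, C, rfl, hA, hB, hC⟩ := exists_split_of_count_eq_two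
    (hW c (List.mem_toFinset.mp hc))
  rw [passing_append_of_notMem hA, passing, if_pos rfl, passing_append_of_notMem hB, passing,
    if_pos rfl, passing_of_notMem hC, add_zero]
  have h := value_four (k := k) (P := P ++ A) (a := a) (b := c) (Q := B) (R := C ++ R) (T := T)
    (hp.congr (by
      rw [List.perm_iff_count]; intro e
      simp only [List.count_append, List.count_cons]; omega) rfl)
  rw [← h]
  simp only [List.append_assoc, List.cons_append, List.nil_append]
  abel

theorem value_word_comm {V W : List ℕ} (hW : ∀ c ∈ W, W.count c = 2)
    (hp : IsPaired (P ++ V ++ W ++ R) T) :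
    value k (P ++ V ++ W ++ R) T = value k (P ++ W ++ V ++ R) T := by
  induction V using List.reverseRecOn generalizing R with
  | nil => simp
  | append_singleton V a ih =>
    have h := value_letter_comm (k := k) (P := P ++ V) (a := a) (R := R) hW (by simpa using hp)
    have hp' : IsPaired (P ++ V ++ W ++ (a :: R)) T := hp.congr (by
      rw [List.perm_iff_count]; intro e
      simp only [List.count_append, List.count_cons, List.count_nil]; omega) rfl
    have := ih hp'
    simp only [List.append_assoc, List.cons_append, List.nil_append] at h this ⊢
    rw [h, this]

/-- Part of a diagram consisting of chords may be rotated separately. -/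
theorem value_rotate_left {A B W : List ℕ} (hW : ∀ c ∈ W, W.count c = 2)
    (hp : IsPaired (A ++ B ++ W) T) : value k (A ++ B ++ W) T = value k (B ++ A ++ W) T := by
  have hp' : IsPaired (B ++ A ++ W ++ []) T := hp.congr (by
    rw [List.perm_iff_count]; intro e
    simp only [List.count_append, List.count_nil]; omega) rfl
  -- The whole line is rotated so that `A` comes last; then the closed word `W` is moved past `A`.
  have h := value_word_comm (k := k) hW hp'
  have hr : (A ++ B ++ W) ~r (B ++ W ++ A) := by
    simpa using List.isRotated_append (l := A) (l' := B ++ W)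
  rw [value_congr hp hr rfl]
  simpa using h.symm

/-! ### The product -/

theorem count_map_of_injective {f : ℕ → ℕ} (hf : Function.Injective f)
    (hL : ∀ c ∈ L, L.count c = 2) : ∀ c ∈ L.map f, (L.map f).count c = 2 := by
  intro c hc
  obtain ⟨d, hd, rfl⟩ := List.mem_map.mp hc
  rw [List.count_map_of_injective L f hf]
  exact hL d hd

theorem two_mul_injective : Function.Injective fun e : ℕ => 2 * e := fun _ _ h => by
  dsimp only at h; omega

theorem two_mul_add_one_injective : Function.Injective fun e : ℕ => 2 * e + 1 := fun _ _ h => by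
  dsimp only at h; omega

/-- The letters of two words are made disjoint. -/
def juxtapose (W W' : List ℕ) : List ℕ := W.map (2 * ·) ++ W'.map (2 * · + 1)

theorem isPaired_append (h : IsPaired L T) (h' : IsPaired L' T')
    (hd : ∀ e ∈ L ++ vertEnds T, e ∉ L' ++ vertEnds T') : IsPaired (L ++ L') (T ++ T') := by
  intro e
  have h1 := h e
  have h2 := h' e
  simp only [vertEnds_append, List.count_append]
  by_cases he : e ∈ L ++ vertEnds T
  · have := List.count_eq_zero.mpr (hd e he)
    rw [List.count_append] at this
    omega
  · have := List.count_eq_zero.mpr he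
    rw [List.count_append] at this
    omega

theorem isPaired_of_count (h : ∀ c ∈ L, L.count c = 2) : IsPaired L [] := by
  intro e
  by_cases he : e ∈ L
  · right; simpa using h e he
  · left; simpa using List.count_eq_zero.mpr he

theorem isPaired_juxtapose {W W' : List ℕ} (h : ∀ c ∈ W, W.count c = 2)
    (h' : ∀ c ∈ W', W'.count c = 2) : IsPaired (juxtapose W W') [] := by
  refine isPaired_append (T := []) (T' := [])
    (isPaired_of_count (count_map_of_injective two_mul_injective h))
    (isPaired_of_count (count_map_of_injective two_mul_add_one_injective h')) ?_
  intro e he he'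
  simp only [vertEnds_nil, List.append_nil, List.mem_map] at he he'
  obtain ⟨c, -, rfl⟩ := he
  obtain ⟨d, -, hd⟩ := he'
  omega

/-- The product of the classes of two chord diagrams. -/
noncomputable def mulDiagram (k : Type*) [Field k] (D D' : ChordDiagram) : ChordSpace k :=
  value k (juxtapose D.word D'.word) []

theorem mulDiagram_comm (D D' : ChordDiagram) : mulDiagram k D D' = mulDiagram k D' D := by
  have hp := isPaired_juxtapose D.two D'.two
  -- The renaming exchanges the even letters of the first factor with the odd letters of the second
  -- one.
  let f : ℕ → ℕ := fun e => if e % 2 = 0 then e + 1 else e - 1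
  have hf : Function.Injective f := by
    intro e e' h
    simp only [f] at h
    split_ifs at h <;> omega
  have hm : (juxtapose D.word D'.word).map f = D.word.map (2 * · + 1) ++ D'.word.map (2 * ·) := by
    simp only [juxtapose, List.map_append, List.map_map]
    congr 1
    · refine List.map_congr_left fun e _ => ?_
      simp [f]
    · refine List.map_congr_left fun e _ => ?_
      simp only [f, Function.comp_apply]
      rw [if_neg (by omega), Nat.add_sub_cancel]
  have h := value_rename (k := k) hp hf.injOn
  rw [hm] at h
  rw [mulDiagram, ← h, mulDiagram, juxtapose]
  exact value_congr ((isPaired_juxtapose D'.two D.two).congr List.perm_append_comm rfl)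
    List.isRotated_append rfl

/-- The product does not depend on where the first circle is cut open: a rotation of the first word
alone is harmless by `value_rotate_left`, because the second word is closed. -/
theorem mulDiagram_iso {D D' E : ChordDiagram} (h : D.Iso D') :
    mulDiagram k D E = mulDiagram k D' E := by
  obtain ⟨π, hπ⟩ := h
  obtain ⟨A, B, h1, h2⟩ := List.isRotated_iff_exists_append.mp hπ
  have hp := isPaired_juxtapose D.two E.two
  have hp' := isPaired_juxtapose D'.two E.two
  let f : ℕ → ℕ := fun e => if e % 2 = 0 then 2 * π (e / 2) else e
  have hf : Function.Injective f := by
    intro e e' h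
    simp only [f] at h
    split_ifs at h with h1 h2 h2
    · have : π (e / 2) = π (e' / 2) := by omega
      have := π.injective this
      omega
    · omega
    · omega
    · exact h
  have hm : (juxtapose D.word E.word).map f = juxtapose (D.word.map π) E.word := by
    simp only [juxtapose, List.map_append, List.map_map]
    congr 1
    · refine List.map_congr_left fun e _ => ?_
      simp [f]
    · refine List.map_congr_left fun e _ => ?_
      simp only [f, Function.comp_apply]
      rw [if_neg (by omega)]
  have h := value_rename (k := k) hp hf.injOn
  rw [hm] at h
  rw [mulDiagram, ← h, mulDiagram, h1, h2]
  rw [h2] at hp'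
  simp only [juxtapose, List.map_append] at hp' ⊢
  exact (value_rotate_left (count_map_of_injective two_mul_add_one_injective E.two) hp').symm

theorem mulDiagram_fourTerm {D₁ D₂ D₃ D₄ E : ChordDiagram}
    (h : ChordDiagram.FourTerm D₁ D₂ D₃ D₄) :
    mulDiagram k D₁ E - mulDiagram k D₂ E + mulDiagram k D₃ E - mulDiagram k D₄ E = 0 := by
  obtain ⟨a, b, U, V, h₁, h₂, h₃, h₄⟩ := h
  have hp := isPaired_juxtapose D₁.two E.two
  have h := value_four (k := k) (P := []) (a := 2 * a) (b := 2 * b) (Q := U.map (2 * ·))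
    (R := V.map (2 * ·) ++ E.word.map (2 * · + 1)) (T := [])
    (by simpa [juxtapose, h₁] using hp)
  rw [← h]
  simp only [mulDiagram, juxtapose, h₁, h₂, h₃, h₄]
  simp

theorem chordRelations_le_ker_mulDiagram (E : ChordDiagram) :
    chordRelations k ≤ LinearMap.ker
      (Finsupp.linearCombination k fun D : ChordDiagram => mulDiagram k D E) := by
  refine Submodule.span_le.mpr ?_
  rintro x (⟨D, D', h, rfl⟩ | ⟨D₁, D₂, D₃, D₄, h, rfl⟩)
  · simp [mulDiagram_iso (k := k) (E := E) h]
  · simpa using mulDiagram_fourTerm (k := k) (E := E) h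

/-- Multiplication by the class of a chord diagram. -/
noncomputable def mulByDiagram (k : Type*) [Field k] (E : ChordDiagram) :
    ChordSpace k →ₗ[k] ChordSpace k :=
  (chordRelations k).liftQ
    (Finsupp.linearCombination k fun D : ChordDiagram => mulDiagram k D E)
    (chordRelations_le_ker_mulDiagram E)

theorem mulByDiagram_cls (D E : ChordDiagram) :
    mulByDiagram k E (D.cls k) = mulDiagram k D E := by
  rw [mulByDiagram, ChordDiagram.cls, Submodule.mkQ_apply, Submodule.liftQ_apply,
    Finsupp.linearCombination_single, one_smul]

theorem chordSpace_linearMap_ext {M : Type*} [AddCommGroup M] [Module k M]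
    {f g : ChordSpace k →ₗ[k] M} (h : ∀ D : ChordDiagram, f (D.cls k) = g (D.cls k)) : f = g := by
  refine Submodule.linearMap_qext _ (Finsupp.lhom_ext' fun D => LinearMap.ext_ring ?_)
  exact h D

/-- Commutativity transfers the independence of representatives from one factor to the other. -/
theorem linearCombination_mulByDiagram (D : ChordDiagram) (r : ChordDiagram →₀ k) :
    (Finsupp.linearCombination k fun E : ChordDiagram => mulByDiagram k E) r (D.cls k)
      = mulByDiagram k D ((chordRelations k).mkQ r) := by
  induction r using Finsupp.induction_linear with
  | zero => simp
  | add r s hr hs => rw [map_add, LinearMap.add_apply, hr, hs, map_add, map_add]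
  | single E c =>
    have hE : (chordRelations k).mkQ (Finsupp.single E c) = c • E.cls k := by
      rw [ChordDiagram.cls, ← map_smul, Finsupp.smul_single_one]
    rw [hE, map_smul, mulByDiagram_cls, Finsupp.linearCombination_single,
      LinearMap.smul_apply, mulByDiagram_cls, mulDiagram_comm]

theorem chordRelations_le_ker_mulByDiagram (k : Type*) [Field k] :
    chordRelations k ≤ LinearMap.ker
      (Finsupp.linearCombination k fun E : ChordDiagram => mulByDiagram k E) := by
  intro r hr
  rw [LinearMap.mem_ker]
  refine chordSpace_linearMap_ext fun D => ?_
  rw [linearCombination_mulByDiagram, Submodule.mkQ_apply,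
    (Submodule.Quotient.mk_eq_zero _).mpr hr, map_zero]
  rfl

/-- The product of `𝒜` as a bilinear map. -/
noncomputable def chordMul (k : Type*) [Field k] :
    ChordSpace k →ₗ[k] ChordSpace k →ₗ[k] ChordSpace k :=
  (chordRelations k).liftQ
    (Finsupp.linearCombination k fun E : ChordDiagram => mulByDiagram k E)
    (chordRelations_le_ker_mulByDiagram k)

theorem chordMul_cls (D E : ChordDiagram) :
    chordMul k (E.cls k) (D.cls k) = mulDiagram k E D := by
  rw [chordMul]
  conv_lhs => rw [ChordDiagram.cls]
  rw [Submodule.mkQ_apply, Submodule.liftQ_apply,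
    Finsupp.linearCombination_single, one_smul, mulByDiagram_cls, mulDiagram_comm]

theorem chordMul_chord {L L' : List ℕ} (h : IsPaired L []) (h' : IsPaired L' [])
    (hd : ∀ e ∈ L, e ∉ L') : chordMul k (value k L []) (value k L' []) = value k (L ++ L') [] := by
  have hp : IsPaired (L ++ L') [] := isPaired_append (T := []) (T' := []) h h' (by simpa using hd)
  rw [value_chord h.chord, value_chord h'.chord, chordMul_cls, mulDiagram]
  let f : ℕ → ℕ := fun e => if e ∈ L then 2 * e else 2 * e + 1
  have hf : Function.Injective f := by
    intro e e' h
    simp only [f] at h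
    split_ifs at h <;> omega
  have hm : (L ++ L').map f = juxtapose L L' := by
    rw [juxtapose, List.map_append]
    congr 1
    · exact List.map_congr_left fun e he => by simp [f, he]
    · exact List.map_congr_left fun e he => by
        simp [f, show e ∉ L from fun h => hd e h he]
  have := value_rename (k := k) hp hf.injOn
  rw [hm] at this
  exact this

/-- The product of two diagrams with disjoint sets of edges is their juxtaposition. -/
theorem chordMul_value (hp : IsPaired L T) (ha : Anchored L T) (hp' : IsPaired L' T')
    (ha' : Anchored L' T') (hd : ∀ e ∈ L ++ vertEnds T, e ∉ L' ++ vertEnds T') :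
    chordMul k (value k L T) (value k L' T') = value k (L ++ L') (T ++ T') := by
  revert hd
  refine anchored_induction (motive := fun L T =>
    (∀ e ∈ L ++ vertEnds T, e ∉ L' ++ vertEnds T') →
    chordMul k (value k L T) (value k L' T') = value k (L ++ L') (T ++ T')) ?_ ?_ hp ha
  · intro L hp
    refine anchored_induction (motive := fun L' T' =>
      (∀ e ∈ L ++ vertEnds [], e ∉ L' ++ vertEnds T') →
      chordMul k (value k L []) (value k L' T') = value k (L ++ L') ([] ++ T')) ?_ ?_ hp' ha'
    · intro L' hp' hd
      exact chordMul_chord hp hp' (by simpa using hd)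
    · intro P Q x b a T T' hp' _ hT ih₁ ih₂ hd
      have hT' := fun e => (vertEnds_perm hT).mem_iff (a := e)
      have q : IsPaired ((L ++ P) ++ x :: Q) T := by
        rw [List.append_assoc]
        exact isPaired_append (T := []) hp hp' hd
      have hq := value_stu (k := k) q hT
      simp only [List.append_assoc] at hq
      rw [value_stu hp' hT, map_sub, ih₁, ih₂, List.nil_append, List.nil_append, hq]
      · intro e he h
        have := hd e he
        rw [List.mem_append, hT'] at this
        simp only [List.mem_append, List.mem_cons, vertEnds_cons] at this h
        tauto
      · intro e he h
        have := hd e he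
        rw [List.mem_append, hT'] at this
        simp only [List.mem_append, List.mem_cons, vertEnds_cons] at this h
        tauto
  · intro P Q x b a T T₁ hp _ hT ih₁ ih₂ hd
    have hT' := fun e => (vertEnds_perm hT).mem_iff (a := e)
    have q : IsPaired (P ++ x :: (Q ++ L')) (T ++ T') := by
      simpa using isPaired_append hp hp' hd
    have hTT : cyc (T ++ T') = cyc ((x, b, a) :: (T₁ ++ T')) := by
      rw [cyc_append, hT, ← cyc_append]
      rfl
    have hd' : ∀ e, e ∈ P ++ a :: b :: Q ++ vertEnds T₁ → e ∉ L' ++ vertEnds T' := by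
      intro e he
      refine hd e ?_
      rw [List.mem_append, hT']
      simp only [List.mem_append, List.mem_cons, vertEnds_cons] at he ⊢
      tauto
    rw [value_stu hp hT, map_sub, LinearMap.sub_apply, ih₁ hd', ih₂ fun e he => hd' e (by
      simp only [List.mem_append, List.mem_cons] at he ⊢; tauto)]
    have hq := value_stu (k := k) q hTT
    simp only [List.append_assoc, List.cons_append] at hq ⊢
    rw [hq]

theorem chordMul_empty (p : ChordSpace k) : chordMul k (ChordDiagram.empty.cls k) p = p := by
  have : chordMul k (ChordDiagram.empty.cls k) = LinearMap.id := by
    refine chordSpace_linearMap_ext fun D => ?_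
    rw [← value_empty, ← value_chord (k := k) D.two,
      chordMul_chord (isPaired_of_count (by simp)) (isPaired_of_count D.two) (by simp)]
    rfl
  rw [this]
  rfl

theorem chordMul_empty_right (p : ChordSpace k) :
    chordMul k p (ChordDiagram.empty.cls k) = p := by
  have : (chordMul k).flip (ChordDiagram.empty.cls k) = LinearMap.id := by
    refine chordSpace_linearMap_ext fun D => ?_
    rw [LinearMap.flip_apply, ← value_empty, ← value_chord (k := k) D.two,
      chordMul_chord (isPaired_of_count D.two) (isPaired_of_count (by simp)) (by simp),
      List.append_nil]
    rfl
  exact congrArg (fun f : ChordSpace k →ₗ[k] ChordSpace k => f p) this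

/-- The composition of the coproduct and the product. -/
noncomputable def adams (k : Type*) [Field k] : ChordSpace k →ₗ[k] ChordSpace k :=
  (TensorProduct.lift (chordMul k)).comp (chordComul k)

theorem adams_of_mem_primitives {p : ChordSpace k} (h : p ∈ primitives k) :
    adams k p = p + p := by
  change chordComul k p = _ at h
  rw [adams, LinearMap.comp_apply, h, map_add, TensorProduct.lift.tmul, TensorProduct.lift.tmul,
    chordMul_empty, chordMul_empty_right]

theorem keepVerts_append_not_perm {p : ℕ → Bool} (h : VertClosed (fun e => p e) T) :
    (keepVerts p T ++ keepVerts (fun e => !p e) T).Perm T := by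
  have : keepVerts (fun e => !p e) T = T.filter fun v => !(p v.1 && p v.2.1 && p v.2.2) := by
    refine List.filter_congr fun v hv => ?_
    have := h v hv
    simp only [triple, List.mem_cons, List.not_mem_nil, or_false, forall_eq_or_imp,
      forall_eq] at this
    rcases this with ⟨h1, h2, h3⟩ | ⟨h1, h2, h3⟩
    · simp [h1, h2, h3]
    · simp [Bool.not_eq_true _ ▸ h1, Bool.not_eq_true _ ▸ h2, Bool.not_eq_true _ ▸ h3]
  rw [this]
  exact List.filter_append_perm _ _

/-- Multiplying the two parts of a splitting restores the same graph. Only the order of the legs has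
changed: those in `E` now come first. -/
theorem adams_value (hp : IsPaired L T) (ha : Anchored L T) :
    adams k (value k L T) = ∑ E ∈ closedSets L T,
      value k (L.filter (fun e => decide (e ∈ E)) ++ L.filter fun e => !decide (e ∈ E)) T := by
  rw [adams, LinearMap.comp_apply, chordComul_value hp ha, map_sum]
  refine Finset.sum_congr rfl fun E hE => ?_
  have h : VertClosed (fun e => (fun e => decide (e ∈ E)) e = true) T := by
    simpa using (mem_closedSets.mp hE).2
  have hd : ∀ e ∈ L.filter (fun e => decide (e ∈ E)) ++
      vertEnds (keepVerts (fun e => decide (e ∈ E)) T),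
      e ∉ L.filter (fun e => !decide (e ∈ E)) ++
        vertEnds (keepVerts (fun e => !decide (e ∈ E)) T) := by
    intro e he he'
    rw [vertEnds_keepVerts h, ← List.filter_append, List.mem_filter] at he
    rw [vertEnds_keepVerts h.not, ← List.filter_append, List.mem_filter] at he'
    have h1 := he.2
    have h2 := he'.2
    rw [h1] at h2
    exact absurd h2 (by simp)
  rw [splitting, TensorProduct.lift.tmul, part, part,
    chordMul_value (hp.keep h) (ha.keep h) (hp.keep h.not) (ha.keep h.not) hd]
  exact value_congr_verts (isPaired_append (hp.keep h) (hp.keep h.not) hd)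
    (cyc_perm (keepVerts_append_not_perm h))

end DiagramData

/-! ### Primitive elements as combinations of connected diagrams without cherries. -/

namespace DiagramData

variable {k : Type*} [Field k] {L L' P Q R : List ℕ} {T T' : List (ℕ × ℕ × ℕ)} {x a b : ℕ}

/-- The subspace of `𝒜` spanned by the diagrams with a given property. -/
noncomputable def diagramSpan (k : Type*) [Field k]
    (C : List ℕ → List (ℕ × ℕ × ℕ) → Prop) : Submodule k (ChordSpace k) :=
  Submodule.span k {v | ∃ L T, IsPaired L T ∧ Anchored L T ∧ C L T ∧ v = value k L T}

theorem value_mem_diagramSpan {C : List ℕ → List (ℕ × ℕ × ℕ) → Prop} (hp : IsPaired L T)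
    (ha : Anchored L T) (hC : C L T) : value k L T ∈ diagramSpan k C :=
  Submodule.subset_span ⟨L, T, hp, ha, hC, rfl⟩

theorem diagramSpan_le {C : List ℕ → List (ℕ × ℕ × ℕ) → Prop} {G : Submodule k (ChordSpace k)}
    (h : ∀ L T, IsPaired L T → Anchored L T → C L T → value k L T ∈ G) : diagramSpan k C ≤ G := by
  refine Submodule.span_le.mpr ?_
  rintro v ⟨L, T, hp, ha, hC, rfl⟩
  exact h L T hp ha hC

theorem diagramSpan_mono {C C' : List ℕ → List (ℕ × ℕ × ℕ) → Prop}
    (h : ∀ L T, C L T → C' L T) : diagramSpan k C ≤ diagramSpan k C' :=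
  diagramSpan_le fun _ _ hp ha hC => value_mem_diagramSpan hp ha (h _ _ hC)

/-! ### Sorting the legs -/

/-- Only transpositions of a leg outside `p` with a following leg in `p` occur, so nothing need be
known about two legs of the same kind. -/
theorem value_sub_move_mem {G : Submodule k (ChordSpace k)} {p : ℕ → Bool} {L₀ : List ℕ}
    (H : ∀ (P : List ℕ) (a b : ℕ) (R : List ℕ), (P ++ a :: b :: R).Perm L₀ → p a = false →
      p b = true → value k (P ++ a :: b :: R) T - value k (P ++ b :: a :: R) T ∈ G)
    (ha : p a = false) (W P R : List ℕ) (hW : ∀ c ∈ W, p c = true)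
    (hp : (P ++ a :: (W ++ R)).Perm L₀) :
    value k (P ++ a :: (W ++ R)) T - value k (P ++ (W ++ a :: R)) T ∈ G := by
  induction W generalizing P with
  | nil => simp
  | cons b W ih =>
    have h1 := H P a b (W ++ R) hp ha (hW b (by simp))
    have h2 := ih (P ++ [b]) (fun c hc => hW c (by simp [hc])) (by
      refine List.Perm.trans ?_ hp
      rw [List.perm_iff_count]; intro c
      simp only [List.count_append, List.count_cons, List.count_nil]; omega)
    have h3 := add_mem h1 h2
    simpa using h3

theorem value_sub_sorted_mem {G : Submodule k (ChordSpace k)} {p : ℕ → Bool} {L₀ : List ℕ}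
    (H : ∀ (P : List ℕ) (a b : ℕ) (R : List ℕ), (P ++ a :: b :: R).Perm L₀ → p a = false →
      p b = true → value k (P ++ a :: b :: R) T - value k (P ++ b :: a :: R) T ∈ G)
    (P L : List ℕ) (hp : (P ++ L).Perm L₀) :
    value k (P ++ L) T - value k (P ++ (L.filter p ++ L.filter fun e => !p e)) T ∈ G := by
  induction L generalizing P with
  | nil => simp
  | cons a L ih =>
    have h1 := ih (P ++ [a]) (by simpa using hp)
    cases ha : p a with
    | true => simpa [ha] using h1
    | false =>
      have h2 := value_sub_move_mem H ha (L.filter p) P (L.filter fun e => !p e)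
        (fun c hc => (List.mem_filter.mp hc).2) (by
          refine List.Perm.trans ?_ hp
          exact ((List.filter_append_perm p L).cons a).append_left P)
      have h3 := add_mem h1 h2
      simpa [ha] using h3

/-! ### The filtration by the number of connected components -/

/-- Diagrams with a condition on the number of vertices and at most `N` unions of connected
components. -/
def HasAtMost (Q : ℕ → Prop) (N : ℕ) (L : List ℕ) (T : List (ℕ × ℕ × ℕ)) : Prop :=
  Q (L.length + T.length) ∧ (closedSets L T).card ≤ N

/-- Joining `a` and `b` merges two components. Erasing `x` embeds the unions of components of the
joined diagram into those of the original one, and the separating set `E` is missed. -/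
theorem card_closedSets_lt (hp : IsPaired (P ++ x :: R) ((x, b, a) :: T)) {E : Finset ℕ}
    (hE : E ∈ closedSets (P ++ a :: b :: R) T) (hab : ¬ (a ∈ E ↔ b ∈ E)) :
    (closedSets (P ++ x :: R) ((x, b, a) :: T)).card < (closedSets (P ++ a :: b :: R) T).card := by
  rw [← Finset.card_image_of_injOn (s := closedSets (P ++ x :: R) ((x, b, a) :: T))
    (f := fun E => E.erase x)]
  · refine Finset.card_lt_card ⟨?_, fun h => ?_⟩
    · intro E' h
      obtain ⟨E'', h', rfl⟩ := Finset.mem_image.mp h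
      exact (erase_mem_closedSets hp h').1
    · obtain ⟨E'', h', rfl⟩ := Finset.mem_image.mp (h hE)
      exact hab (erase_mem_closedSets hp h').2.1
  · intro E₁ h₁ E₂ h₂ h
    have e₁ := (erase_mem_closedSets hp h₁).2.2
    have e₂ := (erase_mem_closedSets hp h₂).2.2
    dsimp only at h
    rw [h] at e₁
    ext c
    by_cases hc : c = x
    · subst hc
      exact e₁.trans e₂.symm
    · have := congrArg (fun s => c ∈ s) h
      simpa [hc] using this

/-- Every term of `adams_value` arises by sorting the legs. Each transposition involved exchanges
legs of different components, so its cost is a diagram with fewer unions of components. -/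
theorem adams_value_sub_mem {Q : ℕ → Prop} {M : ℕ} (hp : IsPaired L T) (ha : Anchored L T)
    (hC : HasAtMost Q (M + 1) L T) :
    adams k (value k L T) - (closedSets L T).card • value k L T
      ∈ diagramSpan k (HasAtMost Q M) := by
  rw [adams_value hp ha, ← Finset.sum_const, ← Finset.sum_sub_distrib]
  refine Submodule.sum_mem _ fun E hE => ?_
  rw [← neg_mem_iff, neg_sub]
  refine value_sub_sorted_mem (L₀ := L) (fun P a b R hperm ha' hb' => ?_) [] L (List.Perm.refl _)
  have hp' := hp.congr hperm.symm rfl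
  have hA := ha.congr (fun e he => hperm.symm.mem_iff.mp he) rfl
  obtain ⟨x, -, hx, e⟩ := exists_value_sub_value_swap (k := k) hp'
  rw [e]
  have hE' : E ∈ closedSets (P ++ a :: b :: R) T := by rwa [closedSets_congr hperm rfl]
  have hlt := card_closedSets_lt hx hE' (by
    rw [decide_eq_false_iff_not] at ha'
    rw [decide_eq_true_iff] at hb'
    tauto)
  rw [closedSets_congr hperm rfl] at hlt
  refine value_mem_diagramSpan hx hA.unresolve ⟨?_, ?_⟩
  · have h1 := hC.1
    rw [← hperm.length_eq] at h1
    convert h1 using 1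
    simp only [List.length_append, List.length_cons]
    omega
  · have := hC.2
    omega

theorem diagramSpan_hasAtMost_mono {Q : ℕ → Prop} {M N : ℕ} (h : M ≤ N) :
    diagramSpan k (HasAtMost Q M) ≤ diagramSpan k (HasAtMost Q N) :=
  diagramSpan_mono fun _ _ hC => ⟨hC.1, hC.2.trans h⟩

theorem adams_sub_mem {Q : ℕ → Prop} {M : ℕ} {p : ChordSpace k}
    (h : p ∈ diagramSpan k (HasAtMost Q (M + 1))) :
    adams k p - (M + 1) • p ∈ diagramSpan k (HasAtMost Q M) := by
  refine Submodule.span_induction ?_ ?_ ?_ ?_ h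
  · rintro v ⟨L, T, hp, ha, hC, rfl⟩
    have h1 := adams_value_sub_mem (k := k) hp ha hC
    -- Diagrams with fewer than `M + 1` unions already lie in the smaller span, so for them the
    -- factor is irrelevant.
    rcases Nat.lt_or_ge (closedSets L T).card (M + 1) with hlt | hge
    · have hv : value k L T ∈ diagramSpan k (HasAtMost Q M) :=
        value_mem_diagramSpan hp ha ⟨hC.1, by omega⟩
      have h2 := sub_mem (add_mem h1 (Submodule.smul_of_tower_mem _ (closedSets L T).card hv))
        (Submodule.smul_of_tower_mem _ (M + 1) hv)
      simpa using h2
    · have : (closedSets L T).card = M + 1 := le_antisymm hC.2 hge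
      rwa [this] at h1
  · simp
  · intro u v _ _ hu hv
    have := add_mem hu hv
    rw [map_add, smul_add]
    convert this using 1
    abel
  · intro c v _ hv
    rw [map_smul, smul_comm, ← smul_sub]
    exact Submodule.smul_mem _ c hv

/-- On the quotient of the two spans `adams` acts as `M + 1`, but on primitive elements as `2`. The
difference `1 - M` is invertible. -/
theorem mem_hasAtMost_of_mem_primitives [CharZero k] {Q : ℕ → Prop} {M : ℕ} (hM : 2 ≤ M)
    {p : ChordSpace k} (hp : p ∈ primitives k) (h : p ∈ diagramSpan k (HasAtMost Q (M + 1))) :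
    p ∈ diagramSpan k (HasAtMost Q M) := by
  have h1 := adams_sub_mem h
  rw [adams_of_mem_primitives hp] at h1
  obtain ⟨j, rfl⟩ : ∃ j, M = j + 2 := ⟨M - 2, by omega⟩
  have h2 : p + p - (j + 2 + 1) • p = (-((j + 1 : ℕ) : k)) • p := by
    rw [neg_smul, Nat.cast_smul_eq_nsmul]
    simp only [add_smul, one_smul, two_smul]
    abel
  rw [h2] at h1
  exact (Submodule.smul_mem_iff _ (neg_ne_zero.mpr (Nat.cast_ne_zero.mpr (by omega)))).mp h1

theorem exists_mem_hasAtMost {Q : ℕ → Prop} {p : ChordSpace k}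
    (h : p ∈ diagramSpan k fun L T => Q (L.length + T.length)) :
    ∃ N, p ∈ diagramSpan k (HasAtMost Q N) := by
  refine Submodule.span_induction ?_ ?_ ?_ ?_ h
  · rintro v ⟨L, T, hp, ha, hC, rfl⟩
    exact ⟨_, value_mem_diagramSpan hp ha ⟨hC, le_rfl⟩⟩
  · exact ⟨0, zero_mem _⟩
  · rintro u v _ _ ⟨M, hu⟩ ⟨N, hv⟩
    exact ⟨max M N, add_mem (diagramSpan_hasAtMost_mono (le_max_left _ _) hu)
      (diagramSpan_hasAtMost_mono (le_max_right _ _) hv)⟩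
  · rintro c v _ ⟨N, hv⟩
    exact ⟨N, Submodule.smul_mem _ c hv⟩

theorem isConnected_of_card_closedSets (hL : L ≠ []) (h : (closedSets L T).card ≤ 2) :
    IsConnected L T := by
  classical
  refine ⟨hL, ?_⟩
  rintro S hS ⟨e, he, hSe⟩
  obtain ⟨f, hf⟩ := List.exists_mem_of_ne_nil _ hL
  set A := (L ++ vertEnds T).toFinset with hA
  have hA0 : A ≠ ∅ := Finset.ne_empty_of_mem (a := f)
    (List.mem_toFinset.mpr (List.mem_append_left _ hf))
  have hB : A.filter S ∈ closedSets L T := by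
    rw [mem_closedSets]
    refine ⟨fun e he => List.mem_toFinset.mp (Finset.mem_filter.mp he).1,
      vertClosed_congr_pred hS fun e he => ?_⟩
    simp [hA, he]
  have hB0 : A.filter S ≠ ∅ := Finset.ne_empty_of_mem (a := e) (by simp [hA, hSe, List.mem_append.mp he])
  have hAB : A.filter S = A := by
    by_contra hne
    have hsub : ({∅, A, A.filter S} : Finset (Finset ℕ)) ⊆ closedSets L T := by
      intro E hE
      simp only [Finset.mem_insert, Finset.mem_singleton] at hE
      rcases hE with rfl | rfl | rfl
      · exact empty_mem_closedSets
      · exact edges_mem_closedSets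
      · exact hB
    have h3 : ({∅, A, A.filter S} : Finset (Finset ℕ)).card = 3 :=
      Finset.card_eq_three.mpr ⟨_, _, _, hA0.symm, hB0.symm, Ne.symm hne, rfl⟩
    have := Finset.card_le_card hsub
    omega
  intro g hg
  have : g ∈ A.filter S := by rw [hAB, hA, List.mem_toFinset]; exact hg
  exact (Finset.mem_filter.mp this).2

theorem eq_nil_of_anchored_nil (ha : Anchored [] T) : T = [] := by
  by_contra h
  obtain ⟨v, hv⟩ := List.exists_mem_of_ne_nil _ h
  obtain ⟨f, hf, -⟩ := ha (fun _ => True) (fun w _ => Or.inl fun _ _ => trivial)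
    ⟨v.1, mem_vertEnds_of_mem hv (by simp [triple]), trivial⟩
  exact absurd hf (by simp)

theorem adams_empty : adams k (ChordDiagram.empty.cls k) = ChordDiagram.empty.cls k := by
  have hc : closedSets [] [] = {∅} := by
    ext E
    rw [mem_closedSets, Finset.mem_singleton]
    constructor
    · intro h
      exact Finset.eq_empty_of_forall_notMem fun e he => by simpa using h.1 e he
    · rintro rfl
      simp [VertClosed]
  rw [← value_empty, adams_value (isPaired_of_count (by simp)) (by intro S _ h; simp at h), hc,
    Finset.sum_singleton]
  rfl

/-- Primitive elements are linear combinations of connected diagrams. -/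
theorem mem_connected_of_mem_primitives [CharZero k] {Q : ℕ → Prop} {p : ChordSpace k}
    (hp : p ∈ primitives k) (h : p ∈ diagramSpan k fun L T => Q (L.length + T.length)) :
    p ∈ diagramSpan k fun L T => IsConnected L T ∧ Q (L.length + T.length) := by
  obtain ⟨N, hN⟩ := exists_mem_hasAtMost h
  have h2 : ∀ j, p ∈ diagramSpan k (HasAtMost Q (2 + j)) → p ∈ diagramSpan k (HasAtMost Q 2) := by
    intro j
    induction j with
    | zero => exact id
    | succ j ih => exact fun h => ih (mem_hasAtMost_of_mem_primitives (by omega) hp h)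
  have h3 := h2 N (diagramSpan_hasAtMost_mono (by omega) hN)
  set C := diagramSpan k fun L T => IsConnected L T ∧ Q (L.length + T.length) with hC
  -- A diagram with at most two unions of components is connected or empty; the empty diagram must
  -- be split off because connectedness requires a leg.
  have h4 : diagramSpan k (HasAtMost Q 2) ≤ C ⊔ Submodule.span k {ChordDiagram.empty.cls k} := by
    refine diagramSpan_le fun L T hpL ha hL => ?_
    by_cases hL0 : L = []
    · subst hL0
      obtain rfl := eq_nil_of_anchored_nil ha
      rw [value_empty]
      exact Submodule.mem_sup_right (Submodule.mem_span_singleton_self _)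
    · exact Submodule.mem_sup_left (value_mem_diagramSpan hpL ha
        ⟨isConnected_of_card_closedSets hL0 hL.2, hL.1⟩)
  obtain ⟨c, hc, d, hd, rfl⟩ := Submodule.mem_sup.mp (h4 h3)
  have hcp : c ∈ primitives k :=
    (diagramSpan_le fun L T hp _ h => value_mem_primitives hp h.1) hc
  have hdp : d ∈ primitives k := by simpa using sub_mem hp hcp
  obtain ⟨t, rfl⟩ := Submodule.mem_span_singleton.mp hd
  -- `adams` fixes the class of the empty diagram but doubles primitive elements, so a primitive
  -- multiple of that class is zero.
  have h5 := adams_of_mem_primitives hdp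
  rw [map_smul, adams_empty, left_eq_add] at h5
  rw [h5, add_zero]
  exact hc

theorem mem_diagramSpan_true (p : ChordSpace k) :
    p ∈ diagramSpan k fun _ _ => True := by
  obtain ⟨r, rfl⟩ := (chordRelations k).mkQ_surjective p
  induction r using Finsupp.induction_linear with
  | zero => simp
  | add r s hr hs => rw [map_add]; exact add_mem hr hs
  | single D c =>
    rw [← mul_one c, ← smul_eq_mul, ← Finsupp.smul_single, map_smul]
    refine Submodule.smul_mem _ c ?_
    have : (chordRelations k).mkQ (Finsupp.single D 1) = value k D.word [] :=
      (value_chord D.two).symm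
    rw [this]
    exact value_mem_diagramSpan (isPaired_of_count D.two) (by intro S _ h; simp at h) trivial

/-- A resolution trades one trivalent vertex for one additional leg, so the total number of vertices
is preserved down to chord diagrams. -/
theorem degree_eq_diagramSpan (n : ℕ) :
    ChordSpace.degree k n = diagramSpan k fun L T => L.length + T.length = 2 * n := by
  apply le_antisymm
  · refine Submodule.span_le.mpr ?_
    rintro v ⟨D, hD, rfl⟩
    have : D.cls k = value k D.word [] := (value_chord D.two).symm
    rw [this]
    exact value_mem_diagramSpan (isPaired_of_count D.two) (by intro S _ h; simp at h)
      (by simpa using hD)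
  · refine diagramSpan_le fun L T hp ha => ?_
    refine anchored_induction (motive := fun L T => L.length + T.length = 2 * n →
      value k L T ∈ ChordSpace.degree k n) ?_ ?_ hp ha
    · intro L hp hn
      rw [value_chord hp.chord]
      exact Submodule.subset_span ⟨_, by simpa using hn, rfl⟩
    · intro P Q x b a T T' hp _ hT ih₁ ih₂ hn
      rw [value_stu hp hT]
      have hl := length_eq_of_cyc_eq hT
      simp only [List.length_append, List.length_cons] at hl hn ih₁ ih₂
      exact sub_mem (ih₁ (by omega)) (ih₂ (by omega))

/-! ### Permutations of the legs and cherries -/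

/-- The span of the connected diagrams with `m` vertices and less than `l` legs. -/
noncomputable def lowerSpan (k : Type*) [Field k] (m l : ℕ) : Submodule k (ChordSpace k) :=
  diagramSpan k fun L T => IsConnected L T ∧ L.length + T.length = m ∧ L.length < l

/-- A permutation of the legs of a connected diagram changes its class by diagrams with fewer
legs. -/
theorem value_sub_value_perm_mem (h : L.Perm L') (P : List ℕ) (hp : IsPaired (P ++ L) T)
    (hc : IsConnected (P ++ L) T) :
    value k (P ++ L) T - value k (P ++ L') T
      ∈ lowerSpan k ((P ++ L).length + T.length) (P ++ L).length := by
  induction h generalizing P with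
  | nil => simp
  | @cons a L L' _ ih =>
    have := ih (P ++ [a]) (by simpa using hp) (by simpa using hc)
    simpa using this
  | swap a b L =>
    obtain ⟨x, -, hx, e⟩ := exists_value_sub_value_swap (k := k) hp
    rw [e]
    refine value_mem_diagramSpan hx hc.unresolve.anchored ⟨hc.unresolve, ?_, ?_⟩
    · simp only [List.length_append, List.length_cons]; omega
    · simp
  | @trans L₁ L₂ L₃ h₁ h₂ ih₁ ih₂ =>
    have i1 := ih₁ P hp hc
    have h12 := h₁.append_left P
    have i2 := ih₂ P (hp.congr h12 rfl) (hc.congr h12 rfl)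
    rw [← h12.length_eq] at i2
    have := add_mem i1 i2
    simpa using this

/-- Two legs are joined to the same trivalent vertex. -/
def HasCherry (L : List ℕ) (T : List (ℕ × ℕ × ℕ)) : Prop :=
  ∃ x y c L' T', L.Perm (x :: y :: L') ∧ cyc T = cyc ((x, y, c) :: T')

/-- A connected diagram with a cherry is a combination of diagrams with fewer legs. -/
theorem HasCherry.value_mem [CharZero k] (h : HasCherry L T) (hp : IsPaired L T)
    (hc : IsConnected L T) : value k L T ∈ lowerSpan k (L.length + T.length) L.length := by
  obtain ⟨x, y, c, M, S, hL, hT⟩ := h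
  have hp₁ : IsPaired (x :: y :: M) T := hp.congr hL rfl
  have hp₂ : IsPaired (y :: x :: M) T := hp₁.congr (List.Perm.swap _ _ _) rfl
  have m₁ := value_sub_value_perm_mem (k := k) hL [] hp hc
  have m₂ := value_sub_value_perm_mem (k := k) (hL.trans (List.Perm.swap y x M)) [] hp hc
  have s₁ := value_stu (k := k) (P := []) hp₁ hT
  have s₂ := value_stu (k := k) (P := [y]) hp₂ hT
  have hq := (hp₁.congr (List.Perm.refl _) hT).resolve (P := [])
  -- After resolution `y` is a chord. With the leg `x` before and behind the leg `y`, the two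
  -- resolutions sum to the difference between `c` before and `c` behind this chord with
  -- neighbouring ends, which is the four-term relation with empty `Q`.
  have f := value_four (k := k) (P := []) (a := c) (b := y) (Q := []) (R := M) hq
  simp only [List.nil_append, List.cons_append] at m₁ m₂ s₁ s₂ f
  have e : value k (x :: y :: M) T + value k (y :: x :: M) T = 0 := by
    rw [s₁, s₂, ← f]
    abel
  have m₃ := add_mem m₁ m₂
  -- Modulo fewer legs the diagram equals each of two diagrams that are negatives of each other, so
  -- twice its class vanishes there.
  have e₂ : value k L T - value k (x :: y :: M) T + (value k L T - value k (y :: x :: M) T)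
      = (2 : k) • value k L T := by
    rw [two_smul, ← sub_zero (value k L T + value k L T), ← e]
    abel
  rw [e₂] at m₃
  exact (Submodule.smul_mem_iff _ two_ne_zero).mp m₃

/-- The span of the connected diagrams without cherries whose number of vertices satisfies `Q`. -/
noncomputable def cherryFreeSpan (k : Type*) [Field k] (Q : ℕ → Prop) :
    Submodule k (ChordSpace k) :=
  diagramSpan k fun L T => IsConnected L T ∧ Q (L.length + T.length) ∧ ¬ HasCherry L T

/-- Induction on the number of legs terminates the replacement of diagrams with cherries, since all
replacements are connected with the same number of vertices. -/
theorem value_mem_cherryFreeSpan [CharZero k] {Q : ℕ → Prop} (hp : IsPaired L T)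
    (hc : IsConnected L T) (hQ : Q (L.length + T.length)) :
    value k L T ∈ cherryFreeSpan k Q := by
  induction hn : L.length using Nat.strong_induction_on generalizing L T with
  | _ n ih =>
    by_cases h : HasCherry L T
    · have hle : lowerSpan k (L.length + T.length) L.length ≤ cherryFreeSpan k Q := by
        refine diagramSpan_le fun L' T' hp' _ h' => ?_
        exact ih _ (by omega) hp' h'.1 (by rw [h'.2.1]; exact hQ) rfl
      exact hle (h.value_mem hp hc)
    · exact value_mem_diagramSpan hp hc.anchored ⟨hc, hQ, h⟩

theorem mem_cherryFreeSpan_of_mem_primitives [CharZero k] {Q : ℕ → Prop} {p : ChordSpace k}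
    (hp : p ∈ primitives k) (h : p ∈ diagramSpan k fun L T => Q (L.length + T.length)) :
    p ∈ cherryFreeSpan k Q :=
  (diagramSpan_le fun _ _ hp _ h => value_mem_cherryFreeSpan hp h.1 h.2)
    (mem_connected_of_mem_primitives hp h)

end DiagramData

/-! ### Counting arguments: cherries, hanging trees and wheels. -/

namespace DiagramData

variable {k : Type*} [Field k] {L L' P Q R : List ℕ} {T T' : List (ℕ × ℕ × ℕ)} {x a b : ℕ}

/-! ### Finding cherries -/

theorem exists_perm_cons_cons {i i' : Fin L.length} (h : i ≠ i') :
    ∃ M, L.Perm (L.get i :: L.get i' :: M) := by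
  have h1 : L.Perm (L[i] :: L.eraseIdx i) := (List.getElem_cons_eraseIdx_perm i.2).symm
  have h2 : L[i'] ∈ L.eraseIdx i := by
    rw [List.mem_eraseIdx_iff_getElem]
    exact ⟨i', i'.2, fun h' => h (Fin.ext h'.symm), rfl⟩
  exact ⟨_, h1.trans ((List.perm_cons_erase h2).cons _)⟩

theorem hasCherry_of_mem_triple (hp : IsPaired L T) {i i' : Fin L.length} (h : i ≠ i')
    {v : ℕ × ℕ × ℕ} (hv : v ∈ T) (hi : L.get i ∈ triple v) (hi' : L.get i' ∈ triple v) :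
    HasCherry L T := by
  obtain ⟨M, hM⟩ := exists_perm_cons_cons h
  generalize L.get i = x at hi hM
  generalize L.get i' = y at hi' hM
  have hxy : x ≠ y := by
    rintro rfl
    have h1 := hp x
    rw [hM.count_eq] at h1
    have h2 := List.count_pos_iff.mpr (mem_vertEnds_of_mem hv hi)
    simp only [List.count_cons, beq_self_eq_true, if_true] at h1
    omega
  have hM' := hM.trans (List.Perm.swap y x M)
  have hT := cyc_perm (List.perm_cons_erase hv)
  generalize T.erase v = S at hT
  obtain ⟨p, q, r⟩ := v
  simp only [triple, List.mem_cons, List.not_mem_nil, or_false] at hi hi'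
  rcases hi with rfl | rfl | rfl <;> rcases hi' with rfl | rfl | rfl
  · exact absurd rfl hxy
  · exact ⟨_, _, _, _, _, hM, hT⟩
  · exact ⟨_, _, _, _, _, hM', hT.trans (cyc_rotate_right _ _ _ _)⟩
  · exact ⟨_, _, _, _, _, hM', hT⟩
  · exact absurd rfl hxy
  · exact ⟨_, _, _, _, _, hM, hT.trans (cyc_rotate_left _ _ _ _)⟩
  · exact ⟨_, _, _, _, _, hM, hT.trans (cyc_rotate_right _ _ _ _)⟩
  · exact ⟨_, _, _, _, _, hM', hT.trans (cyc_rotate_left _ _ _ _)⟩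
  · exact absurd rfl hxy

/-- Pigeonhole principle: two of the legs share a trivalent vertex. -/
theorem hasCherry_of_card_lt (hp : IsPaired L T) {I : Finset (Fin L.length)}
    {J : Finset (Fin T.length)} (h : ∀ i ∈ I, ∃ j ∈ J, L.get i ∈ triple (T.get j))
    (hc : J.card < I.card) : HasCherry L T := by
  have h' : ∀ i : I, ∃ j : J, L.get i ∈ triple (T.get j) := fun i => by
    obtain ⟨j, hj, hij⟩ := h i i.2
    exact ⟨⟨j, hj⟩, hij⟩
  choose f hf using h'
  obtain ⟨i, i', hne, he⟩ := Fintype.exists_ne_map_eq_of_card_lt f (by simpa using hc)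
  exact hasCherry_of_mem_triple hp (fun h => hne (Subtype.ext h)) (List.get_mem T (f i)) (hf i)
    (he ▸ hf i')

/-- In a connected diagram that is not a single chord every leg is joined to a trivalent vertex. -/
theorem mem_vertEnds_of_mem_legs (hp : IsPaired L T) (hc : IsConnected L T)
    (hn : 2 < L.length + T.length) {e : ℕ} (he : e ∈ L) : e ∈ vertEnds T := by
  by_contra heT
  have h1 := hp e
  rw [List.count_eq_zero.mpr heT] at h1
  have h2 := List.count_pos_iff.mpr he
  -- An edge that does not meet a trivalent vertex is a component by itself, so by connectedness it
  -- is the only edge.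
  have hall := hc.2 (· = e) (fun v hv => Or.inr fun c hc' hce =>
    heT (hce ▸ mem_vertEnds_of_mem hv hc')) ⟨e, List.mem_append_left _ he, rfl⟩
  have hT : T = [] := by
    by_contra h
    obtain ⟨v, hv⟩ := List.exists_mem_of_ne_nil _ h
    have hm := mem_vertEnds_of_mem hv (e := v.1) (by simp [triple])
    exact heT (hall v.1 (List.mem_append_right _ hm) ▸ hm)
  have hL : L.count e = L.length := List.count_eq_length.mpr fun c hc' =>
    (hall c (List.mem_append_left _ hc')).symm
  rw [hT] at hn
  simp only [List.length_nil] at hn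
  omega

theorem exists_vertex_of_leg (hp : IsPaired L T) (hc : IsConnected L T)
    (hn : 2 < L.length + T.length) (i : Fin L.length) :
    ∃ j : Fin T.length, L.get i ∈ triple (T.get j) := by
  have h := mem_vertEnds_of_mem_legs hp hc hn (List.get_mem L i)
  simp only [vertEnds, List.mem_flatMap] at h
  obtain ⟨v, hv, hx⟩ := h
  obtain ⟨j, rfl⟩ := List.get_of_mem hv
  exact ⟨j, hx⟩

/-- A connected diagram without cherries does not have more legs than trivalent vertices. -/
theorem length_legs_le (hp : IsPaired L T) (hc : IsConnected L T)
    (hn : 2 < L.length + T.length) (h : ¬ HasCherry L T) : L.length ≤ T.length := by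
  by_contra hlt
  refine h (hasCherry_of_card_lt hp (I := Finset.univ) (J := Finset.univ) (fun i _ => ?_)
    (by simpa using hlt))
  obtain ⟨j, hj⟩ := exists_vertex_of_leg hp hc hn i
  exact ⟨j, Finset.mem_univ _, hj⟩

theorem countP_mem_eq_sum (S : Finset ℕ) (l : List ℕ) :
    l.countP (· ∈ S) = ∑ e ∈ S, l.count e := by
  induction l with
  | nil => simp
  | cons a l ih =>
    simp only [List.countP_cons, List.count_cons, Finset.sum_add_distrib, ih, beq_iff_eq,
      Finset.sum_ite_eq, decide_eq_true_eq]

theorem sum_degreeIn (D : DiagramData) (S : Finset ℕ) :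
    ∑ x : D.Vertex, D.degreeIn S x = D.ends.countP (· ∈ S) := by
  rw [Fintype.sum_sum_type, ends, List.countP_append, List.countP_flatMap]
  congr 1
  · have : ∀ l : List ℕ, ∑ i : Fin l.length, [l.get i].countP (· ∈ S) = l.countP (· ∈ S) := by
      intro l
      induction l with
      | nil => simp
      | cons a l ih =>
        rw [List.countP_cons, ← ih, add_comm]
        refine (Fin.sum_univ_succ _).trans ?_
        simp [List.countP_cons]
    exact this D.legs
  · have : ∀ l : List (ℕ × ℕ × ℕ), ∑ i : Fin l.length, (triple (l.get i)).countP (· ∈ S)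
        = (l.map (List.countP (· ∈ S) ∘ triple)).sum := by
      intro l
      induction l with
      | nil => simp
      | cons a l ih =>
        rw [List.map_cons, List.sum_cons, ← ih]
        exact Fin.sum_univ_succ _
    exact this D.verts

/-- Double counting of edge ends: every edge of `S` has exactly two of them. -/
theorem sum_degreeIn_vertexSet (D : DiagramData) (hp : IsPaired D.legs D.verts) {S : Finset ℕ}
    (hS : S ⊆ D.edges) : ∑ x ∈ D.vertexSet S, D.degreeIn S x = 2 * S.card := by
  have h1 : ∑ x ∈ D.vertexSet S, D.degreeIn S x = ∑ x : D.Vertex, D.degreeIn S x := by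
    refine Finset.sum_subset (Finset.subset_univ _) fun x _ hx => ?_
    simpa [vertexSet] using hx
  rw [h1, sum_degreeIn, countP_mem_eq_sum, mul_comm, ← smul_eq_mul, ← Finset.sum_const]
  refine Finset.sum_congr rfl fun e he => ?_
  have h2 := hp e
  have h3 := hS he
  rw [edges, List.mem_toFinset, ← List.count_pos_iff] at h3
  rw [ends, List.count_append] at h3 ⊢
  unfold vertEnds at h2
  omega

theorem eq_of_countP_eq_one {S : Finset ℕ} {l : List ℕ} (h : l.countP (· ∈ S) = 1) {e f : ℕ}
    (he : e ∈ l) (hf : f ∈ l) (heS : e ∈ S) (hfS : f ∈ S) : e = f := by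
  rw [List.countP_eq_length_filter, List.length_eq_one_iff] at h
  obtain ⟨c, hc⟩ := h
  have h1 : e ∈ l.filter (· ∈ S) := List.mem_filter.mpr ⟨he, by simpa using heS⟩
  have h2 : f ∈ l.filter (· ∈ S) := List.mem_filter.mpr ⟨hf, by simpa using hfS⟩
  rw [hc, List.mem_singleton] at h1 h2
  rw [h1, h2]

/-- A hanging tree contains a cherry. -/
theorem IsHangingTree.hasCherry {D : DiagramData} (hp : IsPaired D.legs D.verts) {S : Finset ℕ}
    (h : D.IsHangingTree S) : HasCherry D.legs D.verts := by
  classical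
  obtain ⟨hS, ⟨hconn, hcard⟩, h1, r, hr, hdr, hx⟩ := h
  let I : Finset (Fin D.legs.length) := Finset.univ.filter fun i =>
    Sum.inl i ∈ (D.vertexSet S).erase r
  let J : Finset (Fin D.verts.length) := Finset.univ.filter fun j =>
    Sum.inr j ∈ (D.vertexSet S).erase r
  have hdisj : (D.vertexSet S).erase r = I.disjSum J := by
    ext x
    rcases x with i | j
    · rw [Finset.inl_mem_disjSum]; simp [I]
    · rw [Finset.inr_mem_disjSum]; simp [J]
  have hmem : ∀ x ∈ (D.vertexSet S).erase r, x ∈ D.vertexSet S ∧ x ≠ r := fun x hx =>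
    ⟨Finset.mem_of_mem_erase hx, Finset.ne_of_mem_erase hx⟩
  have hc1 : I.card + J.card + 1 = S.card + 1 := by
    rw [← hcard, ← Finset.card_disjSum, ← hdisj, Finset.card_erase_add_one hr]
  have hI : ∀ i ∈ I, D.legs.get i ∈ S := by
    intro i hi
    exact hx _ (hmem _ (Finset.mem_filter.mp hi).2).1 (hmem _ (Finset.mem_filter.mp hi).2).2 _
      (by simp [edgesAt])
  have hc2 : I.card + 3 * J.card + 1 = 2 * S.card := by
    rw [← sum_degreeIn_vertexSet D hp hS, ← Finset.sum_erase_add _ _ hr, hdr, hdisj,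
      Finset.sum_disjSum]
    congr 2
    · rw [Finset.card_eq_sum_ones]
      refine Finset.sum_congr rfl fun i hi => ?_
      have := hI i hi
      simp only [degreeIn, edgesAt, List.countP_singleton]
      rw [if_pos (by simpa using this)]
    · rw [mul_comm, ← smul_eq_mul, ← Finset.sum_const]
      refine Finset.sum_congr rfl fun j hj => ?_
      have h3 := hx _ (hmem _ (Finset.mem_filter.mp hj).2).1
        (hmem _ (Finset.mem_filter.mp hj).2).2
      symm
      have : D.degreeIn S (Sum.inr j) = (D.edgesAt (Sum.inr j)).length :=
        List.countP_eq_length.mpr fun e he => by simpa using h3 e he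
      rw [this]
      rfl
  -- With `I` the legs and `J` the trivalent vertices other than `r`, the vertex count `hc1` and the
  -- degree count `hc2` give `I.card = J.card + 1`.
  refine hasCherry_of_card_lt hp (I := I) (J := J) ?_ (by omega)
  intro i hi
  by_contra hno
  push Not at hno
  set e := D.legs.get i with he
  have heS : e ∈ S := hI i hi
  obtain ⟨f, hf, hfe⟩ := Finset.exists_mem_ne h1 e
  -- The other end of the edge `e` could only be a leg or `r`. As `r` has degree one in the tree, no
  -- second edge of the tree can be reached from `e`, contrary to connectedness.
  have key : ∀ g, Relation.ReflTransGen (D.Adjacent S) e g → g = e := by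
    intro g hg
    induction hg with
    | refl => rfl
    | @tail b c _ hbc ih =>
      subst ih
      obtain ⟨-, hcS, (i' | j), hb, hc⟩ := hbc
      · simp only [edgesAt, List.mem_singleton] at hb hc
        rw [hc, ← hb]
      · have hjr : Sum.inr j = r := by
          by_contra hjr
          refine hno j ?_ hb
          simp only [J, Finset.mem_filter, Finset.mem_univ, true_and, Finset.mem_erase]
          refine ⟨hjr, ?_⟩
          rw [vertexSet, Finset.mem_filter]
          exact ⟨Finset.mem_univ _, List.countP_pos_iff.mpr ⟨_, hb, by simpa using heS⟩⟩
        rw [← hjr] at hdr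
        exact eq_of_countP_eq_one hdr hc hb hcS heS
  exact hfe (key f (hconn.2 e heS f hf))

/-! ### Wheels -/

/-- In a diagram without cherries with as many legs as trivalent vertices each trivalent vertex is
joined to exactly one leg. -/
theorem exists_vertices_of_legs (hp : IsPaired L T) (hc : IsConnected L T)
    (hn : 2 < L.length + T.length) (h : ¬ HasCherry L T) (hl : L.length = T.length) :
    ∃ S, cyc T = cyc S ∧ S.map Prod.fst = L := by
  choose f hf using exists_vertex_of_leg hp hc hn
  have hinj : Function.Injective f := by
    intro i i' he
    by_contra hne
    exact h (hasCherry_of_mem_triple hp hne (List.get_mem T (f i)) (hf i) (he ▸ hf i'))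
  have hbij : Function.Bijective f :=
    (Fintype.bijective_iff_injective_and_card f).mpr ⟨hinj, by simpa using hl⟩
  have hq : ∀ i, ∃ q p, (triple (T.get (f i)) : Cycle ℕ) = triple (L.get i, q, p) := by
    intro i
    have := hf i
    generalize T.get (f i) = v at this
    generalize L.get i = x at this
    obtain ⟨p, q, r⟩ := v
    simp only [triple, List.mem_cons, List.not_mem_nil, or_false] at this
    rcases this with h | h | h <;> subst h
    · exact ⟨_, _, rfl⟩
    · exact ⟨r, p, Cycle.coe_cons_eq_coe_append [_, r] p⟩
    · exact ⟨p, q, (Cycle.coe_cons_eq_coe_append [p, q] _).symm⟩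
  choose q p hqp using hq
  refine ⟨List.ofFn fun i => (L.get i, q i, p i), ?_, ?_⟩
  · have h1 : cyc T = (Finset.univ.val.map fun j : Fin T.length => (triple (T.get j) : Cycle ℕ)) := by
      rw [Fin.univ_val_map, cyc]
      conv_lhs => rw [← List.ofFn_get T, List.map_ofFn]
      rfl
    have h2 : Finset.univ.val.map f = (Finset.univ : Finset (Fin T.length)).val :=
      Multiset.map_univ_val_equiv (Equiv.ofBijective f hbij)
    rw [h1, ← h2, Multiset.map_map, cyc, List.map_ofFn, ← Fin.univ_val_map]
    exact Multiset.map_congr rfl fun i _ => hqp i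
  · rw [List.map_ofFn]
    exact List.ofFn_get L

/-- A chain of trivalent vertices: the legs and the edges met along the way are listed. -/
def chain : ℕ → List (ℕ × ℕ) → List (ℕ × ℕ × ℕ)
  | _, [] => []
  | e, c :: C => (c.1, c.2, e) :: chain c.2 C

/-- The last edge of a chain. -/
def chainEnd : ℕ → List (ℕ × ℕ) → ℕ
  | e, [] => e
  | _, c :: C => chainEnd c.2 C

/-- Each interior edge meets two consecutive vertices of the chain, whereas the first and the last
edge meet one. Adding the last edge on the left avoids a subtraction. -/
theorem count_chain (c e : ℕ) (C : List (ℕ × ℕ)) :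
    (vertEnds (chain e C)).count c + [chainEnd e C].count c
      = (C.map Prod.fst).count c + 2 * (C.map Prod.snd).count c + [e].count c := by
  induction C generalizing e with
  | nil => simp [chain, chainEnd]
  | cons d C ih =>
    have := ih d.2
    simp only [chain, chainEnd, vertEnds_cons, List.count_cons, List.map_cons, List.count_nil] at this ⊢
    omega

theorem length_chain (e : ℕ) (C : List (ℕ × ℕ)) : (chain e C).length = C.length := by
  induction C generalizing e with
  | nil => rfl
  | cons d C ih => simp [chain, ih]

theorem getElem?_chain (e : ℕ) (C : List (ℕ × ℕ)) (i : ℕ) (hi : i < C.length) :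
    (chain e C)[i]? = some ((C.map Prod.fst).getD i 0, (C.map Prod.snd).getD i 0,
      (e :: C.map Prod.snd).getD i 0) := by
  induction C generalizing e i with
  | nil => simp at hi
  | cons d C ih =>
    rcases i with _ | i
    · simp [chain]
    · have := ih d.2 i (by simpa using hi)
      simpa [chain] using this

theorem chainEnd_eq (e : ℕ) (C : List (ℕ × ℕ)) :
    chainEnd e C = (e :: C.map Prod.snd).getD C.length 0 := by
  induction C generalizing e with
  | nil => rfl
  | cons d C ih =>
    rw [chainEnd, ih d.2]
    simp

theorem two_mul_card_edges (hp : IsPaired L T) :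
    2 * (L ++ vertEnds T).toFinset.card = (L ++ vertEnds T).length := by
  rw [← List.sum_toFinset_count_eq_length (L ++ vertEnds T), mul_comm, ← smul_eq_mul,
    ← Finset.sum_const]
  refine Finset.sum_congr rfl fun e he => ?_
  have h1 := hp e
  have h2 := List.count_pos_iff.mpr (List.mem_toFinset.mp he)
  rw [List.count_append] at h2 ⊢
  omega

theorem wheel_isPaired (n : ℕ) : IsPaired (wheel n).legs (wheel n).verts := (wheel n).isPaired

/-- A closed chain is a wheel. -/
theorem value_closed_chain {e : ℕ} {C : List (ℕ × ℕ)}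
    (hp : IsPaired (C.map Prod.fst) (chain e C)) (hC : chainEnd e C = e) :
    value k (C.map Prod.fst) (chain e C)
      = value k (wheel C.length).legs (wheel C.length).verts := by
  set n := C.length with hn
  -- The spoke `i` goes to the leg number `i`, and the rim edge `n + j` to the edge number `j` of
  -- the chain, counted from `e`. That the rim wraps around is the hypothesis `hC`.
  let g : ℕ → ℕ := fun i => if i < n then (C.map Prod.fst).getD i 0 else
    (e :: C.map Prod.snd).getD (i - n) 0
  have hL : (wheel n).legs.map g = C.map Prod.fst := by
    refine List.ext_getElem (by simp [wheel, hn]) fun i h1 h2 => ?_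
    have hi : i < C.length := by simpa using h2
    simp [wheel, g, hn, hi]
  have hT : mapVerts g (wheel n).verts = chain e C := by
    refine List.ext_getElem (by simp [wheel, mapVerts, length_chain, hn]) fun i h1 h2 => ?_
    have hi : i < C.length := by simpa [length_chain] using h2
    have h3 := getElem?_chain e C i hi
    rw [List.getElem?_eq_getElem h2, Option.some_inj] at h3
    rw [h3]
    have e1 : g i = (C.map Prod.fst).getD i 0 := by simp [g, hn, hi]
    have e2 : ∀ j, g (n + j) = (e :: C.map Prod.snd).getD j 0 := by intro j; simp [g]
    have e3 : (e :: C.map Prod.snd).getD ((i + 1) % n) 0 = (C.map Prod.snd).getD i 0 := by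
      rcases Nat.lt_or_ge (i + 1) n with hlt | hge
      · rw [Nat.mod_eq_of_lt hlt]
        simp
      · have hin : i + 1 = n := by omega
        rw [hin, Nat.mod_self]
        have h4 := chainEnd_eq e C
        rw [hC, ← hn, ← hin] at h4
        simpa using h4
    simp only [mapVerts, wheel, List.map_map, List.getElem_map, List.getElem_range,
      Function.comp_apply, e1, e2, e3]
  have hcard : (Finset.range (2 * n)).image g = (C.map Prod.fst ++ vertEnds (chain e C)).toFinset := by
    rw [← hL, ← hT, vertEnds_mapVerts, ← List.map_append]
    ext c
    have hm : ∀ i, i ∈ (wheel n).legs ++ vertEnds (wheel n).verts ↔ i ∈ Finset.range (2 * n) := by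
      intro i
      have h : i ∈ (wheel n).legs ++ vertEnds (wheel n).verts ↔ _ :=
        (wheel_ends_perm n).mem_iff (a := i)
      rw [h]
      simp
    simp only [Finset.mem_image, List.mem_toFinset, List.mem_map, hm]
  have hlen : ∀ S, (vertEnds S).length = 3 * S.length := by
    intro S
    induction S with
    | nil => rfl
    | cons v S ih => simp only [vertEnds_cons, List.length_cons, ih]; omega
  -- Injectivity comes from counting: the closed chain has `n + 3n` edge ends, hence `2n` edges, and
  -- `g` maps a set of `2n` names onto them.
  have hinj : Set.InjOn g {i | i ∈ (wheel n).legs ++ vertEnds (wheel n).verts} := by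
    have h1 := two_mul_card_edges hp
    rw [← hcard, List.length_append, hlen, length_chain, List.length_map] at h1
    have h2 : Set.InjOn g (Finset.range (2 * n)) :=
      Finset.injOn_of_card_image_eq (by rw [Finset.card_range]; omega)
    refine h2.mono fun i hi => ?_
    have := (wheel_ends_perm n).mem_iff (a := i)
    have hi' := this.mp hi
    simpa using hi'
  have := value_rename (k := k) (wheel_isPaired n) hinj
  rw [hL, hT] at this
  exact this

theorem IsConnected.flip {p q r : ℕ} {S : List (ℕ × ℕ × ℕ)} (hc : IsConnected L T)
    (h : cyc T = cyc ((p, q, r) :: S)) (h' : cyc T' = cyc ((q, p, r) :: S)) :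
    IsConnected L T' := by
  have hm := (vertEnds_perm h).trans ((vertEnds_perm_flip p q r S).trans (vertEnds_perm h').symm)
  refine ⟨hc.1, ?_⟩
  rintro X hX ⟨e, he, hXe⟩ f hf
  have hX' := hX.congr h'
  have hX'' : VertClosed X ((p, q, r) :: S) := by
    rw [vertClosed_cons] at hX' ⊢
    refine ⟨?_, hX'.2⟩
    have := hX'.1
    dsimp only at this ⊢
    tauto
  have hp := hm.append_left L
  exact hc.2 X (hX''.congr h.symm) ⟨e, hp.mem_iff.mpr he, hXe⟩ f (hp.mem_iff.mpr hf)

/-- The span of the wheel and of the diagrams with fewer legs. -/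
noncomputable def wheelSpan (k : Type*) [Field k] (n : ℕ) : Submodule k (ChordSpace k) :=
  Submodule.span k {value k (wheel n).legs (wheel n).verts} ⊔ lowerSpan k (2 * n) n

theorem count_map_fst_le (S : List (ℕ × ℕ × ℕ)) (c : ℕ) :
    (S.map Prod.fst).count c ≤ (vertEnds S).count c := by
  induction S with
  | nil => simp
  | cons v S ih =>
    simp only [List.map_cons, vertEnds_cons, List.count_cons]
    omega

/-- A closed chain in a connected diagram exhausts its trivalent vertices. -/
theorem eq_nil_of_chain_closed {e : ℕ} {C : List (ℕ × ℕ)} {S : List (ℕ × ℕ × ℕ)}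
    (hp : IsPaired L (chain e C ++ S)) (hc : IsConnected L (chain e C ++ S)) (hC : C ≠ [])
    (hL : L.Perm (C.map Prod.fst ++ S.map Prod.fst)) (he : chainEnd e C = e) : S = [] := by
  -- Both ends of an edge of the closed chain are used up by the chain and its legs, so none is left
  -- for a vertex of `S`.
  have hdisj : ∀ c, c ∈ vertEnds (chain e C) → c ∉ vertEnds S := by
    intro c h1 h2
    have h3 := hp c
    have h4 := count_chain c e C
    have h5 := hL.count_eq c
    rw [← List.count_pos_iff] at h1 h2
    rw [vertEnds_append, List.count_append] at h3
    rw [List.count_append] at h5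
    rw [he] at h4
    omega
  by_contra hS
  obtain ⟨v, hv⟩ := List.exists_mem_of_ne_nil _ hS
  have hvS := mem_vertEnds_of_mem hv (e := v.1) (by simp [triple])
  obtain ⟨d, D, rfl⟩ := List.exists_cons_of_ne_nil hC
  refine hdisj v.1 (hc.2 (fun c => c ∈ vertEnds (chain e (d :: D))) ?_ ⟨e, ?_, ?_⟩ v.1 ?_) hvS
  · intro w hw
    rcases List.mem_append.mp hw with hw | hw
    · exact Or.inl fun c hc => mem_vertEnds_of_mem hw hc
    · exact Or.inr fun c hc h => hdisj c h (mem_vertEnds_of_mem hw hc)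
  · simp [chain]
  · simp [chain]
  · simp [hvS]

/-- The chain grows at its initial edge `e` by absorbing the vertex of `S` at the free end of `e`,
until `S` is exhausted. The hypothesis `hL` records that every vertex, in the chain or not, still
carries its own leg. -/
theorem value_chain_mem {e : ℕ} {C : List (ℕ × ℕ)} {S : List (ℕ × ℕ × ℕ)} {n : ℕ}
    (hp : IsPaired L (chain e C ++ S)) (hc : IsConnected L (chain e C ++ S)) (hC : C ≠ [])
    (hL : L.Perm (C.map Prod.fst ++ S.map Prod.fst)) (hn : L.length = n) :
    value k L (chain e C ++ S) ∈ wheelSpan k n := by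
  induction hm : S.length generalizing e C S with
  | zero =>
    obtain rfl := List.eq_nil_of_length_eq_zero hm
    simp only [List.append_nil, List.map_nil] at hp hc hL ⊢
    have hlen : C.length = n := by rw [← hn, hL.length_eq, List.length_map]
    -- An open chain would leave `e` with an odd number of ends.
    have he : chainEnd e C = e := by
      by_contra hne
      have h1 := count_chain e e C
      have h2 := hp e
      rw [hL.count_eq] at h2
      simp only [List.count_singleton, beq_iff_eq, if_neg hne, if_true] at h1
      omega
    have h1 := value_sub_value_perm_mem (k := k) hL [] hp hc
    rw [List.nil_append, List.nil_append, value_closed_chain (hp.congr hL rfl) he, hlen,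
      length_chain, hlen, hn, ← two_mul] at h1
    rw [← sub_add_cancel (value k L (chain e C)) (value k (wheel n).legs (wheel n).verts)]
    exact add_mem (Submodule.mem_sup_right h1)
      (Submodule.mem_sup_left (Submodule.mem_span_singleton_self _))
  | succ m ih =>
    have he : chainEnd e C ≠ e := fun he => by
      rw [eq_nil_of_chain_closed hp hc hC hL he] at hm
      simp at hm
    have h1 := count_chain e e C
    have h2 := hp e
    have h3 := hL.count_eq e
    have h4 := count_map_fst_le S e
    simp only [List.count_singleton, beq_iff_eq, if_neg he, if_true] at h1
    rw [vertEnds_append, List.count_append] at h2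
    rw [List.count_append] at h3
    -- The chain is open, so `e` has exactly one end on it. The other end is at a vertex of `S` and
    -- not at a leg, since every leg edge meets its own vertex as well.
    have heS : e ∈ vertEnds S := List.count_pos_iff.mp (by omega)
    have heL : e ∉ L := List.count_eq_zero.mp (by omega)
    obtain ⟨v, hv, hev⟩ := List.mem_flatMap.mp heS
    have hS := List.perm_cons_erase hv
    generalize S.erase v = S' at hS
    obtain ⟨x, q, p⟩ := v
    have hx : x ∈ L := hL.mem_iff.mpr (List.mem_append_right _ (List.mem_map.mpr ⟨_, hv, rfl⟩))
    have hm' : S'.length = m := by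
      have := hS.length_eq
      simp only [List.length_cons] at this
      omega
    have hL' : ∀ f : ℕ, L.Perm (((x, f) :: C).map Prod.fst ++ S'.map Prod.fst) := fun f => by
      refine hL.trans (((hS.map Prod.fst).append_left _).trans ?_)
      simp only [List.map_cons, List.cons_append]
      exact List.perm_middle
    have hT : cyc (chain e C ++ S) = cyc ((x, q, p) :: (chain e C ++ S')) :=
      cyc_perm ((hS.append_left _).trans List.perm_middle)
    simp only [triple, List.mem_cons, List.not_mem_nil, or_false] at hev
    rcases hev with rfl | rfl | rfl
    · exact absurd hx heL
    · have := ih (e := p) (C := (x, e) :: C) (S := S') (hp.congr (List.Perm.refl _) hT)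
        (hc.congr (List.Perm.refl _) hT) (by simp) (hL' e) hm'
      rw [value_congr_verts hp hT]
      exact this
    -- Here the cyclic order at the new vertex is opposite to the one in a chain. Reversing it costs
    -- a sign by `value_flip`.
    · have hT' : cyc ((x, e, q) :: (chain e C ++ S')) = cyc ((q, x, e) :: (chain e C ++ S')) :=
        cyc_rotate_right _ _ _ _
      have := ih (e := q) (C := (x, e) :: C) (S := S') (hp.flip hT hT') (hc.flip hT hT') (by simp)
        (hL' e) hm'
      rw [eq_neg_of_add_eq_zero_left (value_flip hp hc.anchored hT hT')]
      exact neg_mem this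

/-- Connected diagrams without cherries that have as many legs as trivalent vertices are wheels, up
to diagrams with fewer legs. -/
theorem value_mem_wheelSpan {n : ℕ} (hp : IsPaired L T) (hc : IsConnected L T)
    (h : ¬ HasCherry L T) (hn : 2 ≤ n) (hL : L.length = n) (hT : T.length = n) :
    value k L T ∈ wheelSpan k n := by
  obtain ⟨S, hS, hSL⟩ := exists_vertices_of_legs hp hc (by omega) h (by omega)
  rw [value_congr_verts hp hS]
  have hlen : S.length = n := by rw [← length_eq_of_cyc_eq hS, hT]
  obtain ⟨⟨x, q, p⟩, S, rfl⟩ := List.exists_cons_of_ne_nil (l := S) (by rintro rfl; simp at hlen; omega)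
  exact value_chain_mem (e := p) (C := [(x, q)]) (S := S) (hp.congr (List.Perm.refl _) hS)
    (hc.congr (List.Perm.refl _) hS) (by simp) (by rw [← hSL]; rfl) hL

end DiagramData

/-! ### The filtration, the wheel quotient and the basis. -/

namespace DiagramData

variable {k : Type*} [Field k] {L L' P Q R : List ℕ} {T T' : List (ℕ × ℕ × ℕ)} {x a b : ℕ}

theorem wheel_isConnected {n : ℕ} (hn : 0 < n) :
    IsConnected (wheel n).legs (wheel n).verts := by
  refine ⟨by simp [wheel]; omega, ?_⟩
  rintro S hS ⟨e, he, hSe⟩ f hf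
  have hm : ∀ i, i ∈ (wheel n).legs ++ vertEnds (wheel n).verts → i < 2 * n := fun i hi => by
    have := (wheel_ends_perm n).mem_iff.mp hi
    simpa using this
  have h1 : ∀ i < n, (S i ↔ S (n + i)) ∧ (S (n + (i + 1) % n) ↔ S (n + i)) := by
    intro i hi
    have := hS (i, n + (i + 1) % n, n + i) (List.mem_map.mpr ⟨i, List.mem_range.mpr hi, rfl⟩)
    simp only [triple, List.mem_cons, List.not_mem_nil, or_false, forall_eq_or_imp,
      forall_eq] at this
    tauto
  have h2 : ∀ i < n, S (n + i) ↔ S (n + 0) := by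
    intro i
    induction i with
    | zero => exact fun _ => Iff.rfl
    | succ i ih =>
      intro hi
      have := (h1 i (by omega)).2
      rw [Nat.mod_eq_of_lt hi] at this
      exact this.trans (ih (by omega))
  have h3 : ∀ i < 2 * n, S i ↔ S (n + 0) := by
    intro i hi
    rcases Nat.lt_or_ge i n with h | h
    · exact (h1 i h).1.trans (h2 i h)
    · obtain ⟨j, rfl⟩ := Nat.exists_eq_add_of_le h
      exact h2 j (by omega)
  exact (h3 f (hm f hf)).mpr ((h3 e (hm e he)).mp hSe)

theorem diagramSpan_le_legFiltration {n l : ℕ} {C : List ℕ → List (ℕ × ℕ × ℕ) → Prop}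
    (h : ∀ L T, IsPaired L T → C L T → L.length + T.length = 2 * n ∧ L.length ≤ l) :
    diagramSpan k C ≤ legFiltration k n l := by
  refine diagramSpan_le fun L T hp ha hC => Submodule.subset_span ⟨?_, ?_⟩
  · rw [degree_eq_diagramSpan]
    exact value_mem_diagramSpan hp ha (h L T hp hC).1
  · exact ⟨toFeynmanDiagram L T hp ha, (h L T hp hC).1, (h L T hp hC).2,
      chordToFeynman_value hp ha⟩

theorem legFiltration_le_degree (n l : ℕ) : legFiltration k n l ≤ ChordSpace.degree k n :=
  Submodule.span_le.mpr fun _ h => h.1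

theorem diagramSpan_le_primitives {C : List ℕ → List (ℕ × ℕ × ℕ) → Prop}
    (h : ∀ L T, C L T → IsConnected L T) : diagramSpan k C ≤ primitives k :=
  diagramSpan_le fun L T hp _ hC => value_mem_primitives hp (h L T hC)

/-- Of the `2n` vertices at most half are legs. The bound `2 ≤ n` excludes the single chord, which
is cherry-free but consists of two legs only. -/
theorem cherryFreeSpan_le_legFiltration {n : ℕ} (hn : 2 ≤ n) :
    cherryFreeSpan k (· = 2 * n) ≤ legFiltration k n n := by
  refine diagramSpan_le_legFiltration fun L T hp h => ⟨h.2.1, ?_⟩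
  have h0 := h.2.1
  have := length_legs_le hp h.1 (by omega) h.2.2
  omega

theorem mem_cherryFreeSpan_of_mem_degree [CharZero k] {n : ℕ} {p : ChordSpace k}
    (hp : p ∈ primitives k) (h : p ∈ ChordSpace.degree k n) :
    p ∈ cherryFreeSpan k (· = 2 * n) := by
  rw [degree_eq_diagramSpan] at h
  exact mem_cherryFreeSpan_of_mem_primitives (Q := (· = 2 * n)) hp h

/-- The filtration of the primitive elements of degree `n` stabilizes at `n` legs. -/
theorem primitivesFiltration_eq [CharZero k] {n l : ℕ} (hn : 2 ≤ n) (hl : n ≤ l) :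
    primitivesFiltration k n l = primitivesDegree k n := by
  apply le_antisymm
  · exact inf_le_inf_left _ (legFiltration_le_degree n l)
  · rintro p ⟨hp, hd⟩
    refine ⟨hp, Submodule.span_mono ?_
      (cherryFreeSpan_le_legFiltration hn (mem_cherryFreeSpan_of_mem_degree hp hd))⟩
    rintro v ⟨h, F, hF, hFl, e⟩
    exact ⟨h, F, hF, hFl.trans hl, e⟩

theorem cherryFreeSpan_le_wheelSpan {n : ℕ} (hn : 2 ≤ n) :
    cherryFreeSpan k (· = 2 * n) ≤ wheelSpan k n := by
  refine diagramSpan_le fun L T hp ha h => ?_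
  have h0 := h.2.1
  have hle := length_legs_le hp h.1 (by omega) h.2.2
  rcases Nat.lt_or_ge L.length n with hlt | hge
  · exact Submodule.mem_sup_right (value_mem_diagramSpan hp ha ⟨h.1, h0, hlt⟩)
  · exact value_mem_wheelSpan hp h.1 h.2.2 hn (by omega) (by omega)

theorem lowerSpan_le_primitivesFiltration {n : ℕ} :
    lowerSpan k (2 * n) n ≤ primitivesFiltration k n (n - 1) :=
  le_inf (diagramSpan_le_primitives fun _ _ h => h.1)
    (diagramSpan_le_legFiltration fun _ _ _ h => ⟨h.2.1, by omega⟩)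

theorem wheel_mem_primitivesFiltration {n : ℕ} (hn : 0 < n) :
    value k (wheel n).legs (wheel n).verts ∈ primitivesFiltration k n n := by
  have hc := wheel_isConnected hn
  refine ⟨value_mem_primitives (wheel_isPaired n) hc, Submodule.subset_span ⟨?_, wheel n, ?_, ?_,
    chordToFeynman_value (wheel_isPaired n) hc.anchored⟩⟩
  · rw [degree_eq_diagramSpan]
    refine value_mem_diagramSpan (wheel_isPaired n) hc.anchored ?_
    simp [wheel]
    omega
  · simp [FeynmanDiagram.HasOrder, wheel]
    omega
  · simp [wheel]

/-- By `cherryFreeSpan_le_wheelSpan` an element is a multiple of the wheel plus connected diagrams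
with fewer than `n` legs, and the latter vanish in the quotient. -/
theorem span_wheel_eq_top [CharZero k] {n : ℕ} (hn : 2 ≤ n) :
    Submodule.span k {((primitivesFiltration k n (n - 1)).submoduleOf
      (primitivesFiltration k n n)).mkQ ⟨_, wheel_mem_primitivesFiltration (k := k)
        (by omega : 0 < n)⟩} = ⊤ := by
  rw [eq_top_iff]
  rintro y -
  obtain ⟨p, rfl⟩ := Submodule.mkQ_surjective _ y
  have hp := cherryFreeSpan_le_wheelSpan hn (mem_cherryFreeSpan_of_mem_degree p.2.1
    (legFiltration_le_degree n n p.2.2))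
  obtain ⟨u, hu, v, hv, e⟩ := Submodule.mem_sup.mp hp
  obtain ⟨c, rfl⟩ := Submodule.mem_span_singleton.mp hu
  refine Submodule.mem_span_singleton.mpr ⟨c, ?_⟩
  rw [← map_smul, ← sub_eq_zero, ← map_sub, Submodule.mkQ_apply, Submodule.Quotient.mk_eq_zero,
    Submodule.submoduleOf, Submodule.mem_comap]
  have hv' := lowerSpan_le_primitivesFiltration hv
  rw [← neg_mem_iff]
  convert hv' using 1
  simp [← e]

/-- The primitive space has a basis of connected diagrams without hanging trees. -/
theorem exists_basis_primitives (k : Type*) [Field k] [CharZero k] :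
    ∃ (B : Set FeynmanDiagram) (b : Module.Basis B k (primitives k)),
      ∀ F : B, F.1.Connected ∧ (¬ ∃ S : Finset ℕ, F.1.IsHangingTree S) ∧
        chordToFeynman k (b F : ChordSpace k) = F.1.cls k := by
  let s : Set (primitives k) := {p | ∃ F : FeynmanDiagram, IsConnected F.legs F.verts ∧
    ¬ HasCherry F.legs F.verts ∧ (p : ChordSpace k) = value k F.legs F.verts}
  have hs : Submodule.span k s = ⊤ := by
    have h1 : cherryFreeSpan k (fun _ => True) ≤ (Submodule.span k s).map (primitives k).subtype := by
      refine diagramSpan_le fun L T hp ha h => ?_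
      refine ⟨⟨value k L T, value_mem_primitives hp h.1⟩, Submodule.subset_span ?_, rfl⟩
      exact ⟨toFeynmanDiagram L T hp ha, h.1, h.2.2, rfl⟩
    rw [eq_top_iff]
    rintro p -
    obtain ⟨q, hq, e⟩ := h1 (mem_cherryFreeSpan_of_mem_primitives (Q := fun _ => True) p.2
      (mem_diagramSpan_true p.1))
    rwa [← Subtype.ext e]
  obtain ⟨t, hts, htspan, hli⟩ := exists_linearIndependent k s
  have ht : ∀ p : t, ∃ F : FeynmanDiagram, IsConnected F.legs F.verts ∧
    ¬ HasCherry F.legs F.verts ∧ ((p : primitives k) : ChordSpace k) = value k F.legs F.verts :=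
    fun p => hts p.2
  choose F hFc hFt hFv using ht
  -- A diagram determines its class, so distinct basis vectors have distinct diagrams, and the basis
  -- can be indexed by diagrams.
  have hinj : Function.Injective F := by
    intro p q h
    have : ((p : primitives k) : ChordSpace k) = ((q : primitives k) : ChordSpace k) := by
      rw [hFv, hFv, h]
    exact Subtype.ext (Subtype.ext this)
  let b₀ : Module.Basis t k (primitives k) := Module.Basis.mk hli (by
    rw [Subtype.range_coe, htspan, hs])
  let e := Equiv.ofInjective F hinj
  refine ⟨Set.range F, b₀.reindex e, fun G => ?_⟩
  obtain ⟨p, rfl⟩ := e.surjective G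
  have hG : ((e p : Set.range F) : FeynmanDiagram) = F p := rfl
  rw [hG, Module.Basis.reindex_apply, Equiv.symm_apply_apply, Module.Basis.mk_apply, hFv]
  exact ⟨connected_of_isConnected (hFc p),
    fun ⟨S, hS⟩ => hFt p (hS.hasCherry (F p).isPaired),
    chordToFeynman_value (F p).isPaired (F p).isAnchored⟩

end DiagramData

theorem theorem3p2 {k : Type*} [Field k] [CharZero k] :
    (∃ (B : Set FeynmanDiagram) (b : Module.Basis B k (primitives k)),
      ∀ F : B, F.1.Connected ∧ (¬ ∃ S : Finset ℕ, F.1.IsHangingTree S) ∧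
        chordToFeynman k (b F : ChordSpace k) = F.1.cls k) ∧
    (∀ n : ℕ, 2 ≤ n → ∀ l : ℕ, n ≤ l → primitivesFiltration k n l = primitivesDegree k n) ∧
    (∀ n : ℕ, 2 ≤ n → ∃ w : primitivesFiltration k n n,
      chordToFeynman k (w : ChordSpace k) = (wheel n).cls k ∧
      Submodule.span k
        {((primitivesFiltration k n (n - 1)).submoduleOf (primitivesFiltration k n n)).mkQ w} = ⊤)
    := by
  refine ⟨DiagramData.exists_basis_primitives k,
    fun n hn l hl => DiagramData.primitivesFiltration_eq hn hl, fun n hn => ?_⟩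
  have hn' : 0 < n := by omega
  exact ⟨⟨_, DiagramData.wheel_mem_primitivesFiltration hn'⟩,
    DiagramData.chordToFeynman_value (DiagramData.wheel_isPaired n)
      (DiagramData.wheel_isConnected hn').anchored, DiagramData.span_wheel_eq_top hn⟩
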